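/- **Notation.** Let $n=65537$, $z=e^{2\pi i/n}$, and $p_k=z^k+z^{-k}=2\cos(2\pi k/n)$ (the *pairs*). For $1\le k\le 2048$ let $\hat G_k$ be the set of the 32 residues $3^{k-1}2^{i-1} \bmod n$, $1\le i\le 32$ (in this "natural" order); the $i$-th pair of $G_k$, $1\le i\le 16$, is $p_r$ with $r=3^{k-1}2^{i-1}$. Write $G_k=\sum_{d\in\hat G_k}z^d$, which is the sum of the 16 pairs of $G_k$. For $M\mid 16$, $1\le j\le M$, let $G_k(j,M)$ be the sum of the $j$-th, $(j+M)$-th, $(j+2M)$-th, … pairs of $G_k$. For $M\mid 2048$, $1\le j\le M$, let $F(j,M)=G_j+G_{j+M}+G_{j+2M}+\cdots$ (indices $\le 2048$), so $F(j,2048)=G_j$. Let $S=F(1,1)$. Let $\rho(k,M)\in\{1,\dots,M\}$ be congruent to $k$ modulo $M$. For $q\ne1$ the product $G_1G_q$ is a sum of 32 invariant sets, namely of the sets $G_l$ with $1+d\in\hat G_l$ (mod $n$), $d$ running through $\hat G_q$. For $M=2,4,\dots,512$, $\mu(k,M)$ is the number of invariant sets $G_l$ with $\rho(l,M)=k$ in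 the sum $G_1G_{1+M}+G_1G_{1+3M}+G_1G_{1+5M}+\cdots+G_1G_{1+1024-M}$. "$A,B$ is split from $s$ with product $q$" means $A+B=s$, $AB=q$, so that $A,B$ are the roots $\frac{s\pm\sqrt{s^2-4q}}2$ of $x^2-sx+q=0$; it is always also stated which of the two is (strictly) larger. **Theorem.** (0) Every $d\in\{1,\dots,65536\}$ lies in exactly one $\hat G_k$, $1\le k\le2048$, and each $\hat G_k$ has 32 elements. $S=\sum_{k=1}^{n-1}z^k=-1$. For $2\le q\le 2048$, $G_1G_q$ is the sum of invariant sets described above. Moreover $$G_1^2=32+3G_1+4G_2+2(G_3+G_{778}+G_{801}+G_{1025}+G_{1100}+G_{1117}+G_{1179}+G_{1264}+G_{1266}+G_{1900}+G_{1956}+G_{1957}),$$ $$\begin{aligned}G_1G_{1025}=\;&2F(1,1024)+F(24,1024)+2F(155,1024)+F(185,1024)+F(309,1024)+F(360,1024)+F(531,1024)\\&+F(667,1024)+F(719,1024)+F(734,1024)+2F(778,1024)+F(841,1024)+F(946,1024),\end{aligned}$$ where $F(j,1024)=G_j+G_{j+1024}$. For $M=2,4,8,\dots,512$ and $1\le j\le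 M$, $$F(j,2M)\,F(j+M,2M)=\sum_{k=1}^{M}\mu(k,M)\,F(\rho(k+j-1,M),M),$$ with the following values of $\mu$ (listed for $k=1,2,\dots,M$). $M=2$: 4096, 4096. $M=4$: 992, 1040, 1024, 1040. $M=8$: 284, 237, 272, 237, 256, 269, 256, 237. $M=16$: 80, 62, 60, 64, 57, 60, 61, 60, 68, 64, 64, 58, 65, 70, 61, 70. $M=32$: 4, 12, 20, 13, 20, 18, 16, 19, 19, 22, 12, 22, 13, 13, 11, 22, 20, 15, 25, 12, 16, 12, 16, 17, 29, 16, 7, 17, 13, 17, 13, 11. For $M=64,128,256,512$ the values $\mu(k,M)$ are at most $10,5,3,2$ respectively, and with $\mathcal K(m,M)=\{k:\mu(k,M)=m\}$: $\mathcal K(1,64)=\{13, 24, 31, 33, 37, 38\}$; $\mathcal K(2,64)=\{3, 7, 9, 21, 36, 46, 56, 57\}$; $\mathcal K(3,64)=\{2, 15, 19, 25, 27, 28, 35, 40, 41, 42, 45, 47, 59, 61, 64\}$; $\mathcal K(4,64)=\{29, 32, 43, 48, 51, 52, 58, 60\}$; $\mathcal K(5,64)=\{4, 5, 6, 8, 11,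 16, 20, 22, 23, 30, 53, 62\}$; $\mathcal K(6,64)=\{10, 12, 14, 17, 34, 44, 54\}$; $\mathcal K(7,64)=\{39, 49, 50\}$; $\mathcal K(8,64)=\{18, 55, 63\}$; $\mathcal K(9,64)=\emptyset$; $\mathcal K(10,64)=\{26\}$. $\mathcal K(1,128)=\{2, 4, 5, 7, 8, 9, 15, 16, 17, 21, 23, 26, 27, 31, 36, 38, 46, 48, 49, 52, 57, 59, 61, 62, 81, 83, 87, 90, 91, 96, 99, 100, 111, 112, 116, 117, 119, 120, 124, 125, 126\}$; $\mathcal K(2,128)=\{1, 34, 35, 37, 39, 41, 42, 43, 60, 64, 68, 71, 74, 75, 77, 80, 84, 88, 89, 95, 98, 102, 104, 105, 109, 110, 118, 122, 128\}$; $\mathcal K(3,128)=\{11, 30, 101, 106\}$; $\mathcal K(4,128)=\{66, 107, 115\}$; $\mathcal K(5,128)=\{58\}$. $\mathcal K(1,256)=\{5, 8, 15, 20, 30, 31, 34, 38, 40, 42, 44, 45, 51, 52, 54, 57, 60, 62, 66, 69, 71, 79, 80, 82, 85, 89, 90, 107, 110, 113, 118, 125, 129, 136, 143, 147, 174, 176,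 187, 188, 189, 196, 201, 213, 220, 232, 234, 244, 251, 253, 254\}$; $\mathcal K(2,256)=\{4, 29, 157, 186, 246\}$; $\mathcal K(3,256)=\{83\}$. $\mathcal K(1,512)=\{41, 49, 81, 92, 106, 109, 114, 211, 226, 233, 269, 275, 278, 281, 303, 349, 379, 390, 431, 465\}$; $\mathcal K(2,512)=\{68, 86, 88, 135, 175, 451\}$. (1)–(11) For $1\le m\le 11$ and $1\le j\le M:=2^{m-1}$ we have $F(j,2M)+F(j+M,2M)=F(j,M)$, and the product $F(j,2M)F(j+M,2M)$ is an explicit integer linear combination of 1 and the values $F(k,M)$, namely: Step 1: $-16384$. Step 2: $-4096$. Step 3: $-1040-48F(j,4)-16F(\rho(2+j,4),4)$. Step 4: $-237+47F(j,8)+35F(\rho(2+j,8),8)+19F(\rho(4+j,8),8)+32F(\rho(5+j,8),8)+19F(\rho(6+j,8),8)$. Step 5: $-60+20f(0)+2f(1)+4f(3)-3f(4)+f(6)+8f(8)+4f(9)+4f(10)-2f(11)+5f(12)+10f(13)+f(14)+10f(15)$, where $f(i)=F(\rho(i+j,16),16)$. Steps 6–10: the sum $\sum_k\mu(k,M)F(\rho(k+j-1,M),M)$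 with the tables above. Step 11: $2F(j,1024)+f(23)+2f(154)+f(184)+f(308)+f(359)+f(530)+f(666)+f(718)+f(733)+2f(777)+f(840)+f(945)$, where $f(i)=F(\rho(i+j,1024),1024)$. Which part is larger: in steps 1–9, for every $1\le j\le M$, $F(j,2M)>F(j+M,2M)$ if $j$ is in the following list, and $F(j,2M)<F(j+M,2M)$ otherwise. Step 1: 1. Step 2: no $j$. Step 3: 2, 3. Step 4: 1, 2, 3, 5, 7. Step 5: 1, 3, 4, 5, 8, 9, 10, 12, 13, 15. Step 6: 1, 2, 4, 5, 9, 10, 11, 12, 15, 21, 24, 28, 29, 31, 32. Step 7: 1, 2, 3, 4, 6, 8, 10, 12, 16, 17, 18, 19, 20, 21, 24, 26, 27, 28, 29, 31, 32, 33, 34, 36, 37, 39, 40, 42, 45, 46, 48, 50, 51, 57, 58, 59, 62, 63. Step 8: 1, 2, 3, 4, 5, 6, 7, 9, 10, 11, 12, 14, 16, 20, 21, 24, 25, 26, 28, 29, 30, 31, 32, 33, 34, 35, 41, 44, 47, 49, 53, 55, 56, 60, 61, 63, 65, 66, 67, 69, 71, 72, 73, 74, 76, 77, 78, 82, 83, 85,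 91, 92, 93, 98, 100, 102, 104, 105, 107, 108, 109, 110, 111, 113, 117, 120, 121, 124, 125, 126, 128. Step 9: 1, 2, 5, 6, 13, 14, 15, 16, 18, 19, 20, 21, 22, 23, 24, 25, 27, 30, 31, 32, 37, 38, 39, 42, 44, 45, 46, 47, 48, 49, 52, 54, 55, 58, 59, 62, 63, 65, 66, 76, 77, 78, 79, 82, 84, 87, 89, 90, 91, 93, 94, 96, 97, 98, 102, 103, 107, 110, 115, 117, 118, 119, 123, 127, 133, 134, 136, 139, 144, 145, 147, 148, 149, 151, 152, 155, 156, 157, 160, 161, 162, 166, 168, 170, 171, 180, 182, 185, 186, 187, 188, 189, 191, 194, 195, 197, 200, 203, 206, 207, 209, 210, 213, 215, 217, 220, 221, 222, 223, 225, 230, 232, 234, 235, 236, 237, 238, 240, 241, 242, 244, 245, 254, 255, 256. In step 10 only the 181 values $F(j,512)$ are split with $j$ in the list $L_{10}$: 1, 2, 6, 14, 15, 18, 19, 20, 22, 23, 24, 25, 28, 32, 36, 37, 38, 43, 58, 62, 63, 64, 68, 71, 73, 81, 82, 87, 88, 89, 92, 93, 94, 98, 101, 106, 111, 112, 114, 115,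 116, 117, 119, 123, 124, 125, 128, 129, 130, 131, 138, 144, 145, 150, 154, 155, 156, 160, 163, 165, 168, 173, 174, 175, 176, 180, 181, 182, 184, 185, 186, 193, 203, 206, 207, 208, 209, 211, 216, 217, 218, 221, 222, 223, 225, 236, 237, 238, 242, 245, 247, 248, 249, 250, 252, 255, 260, 265, 266, 267, 268, 269, 272, 276, 277, 278, 285, 290, 295, 299, 300, 303, 304, 308, 309, 310, 314, 315, 328, 329, 330, 334, 339, 341, 342, 343, 346, 347, 350, 351, 352, 356, 357, 358, 359, 360, 361, 364, 369, 371, 377, 382, 387, 391, 396, 401, 402, 406, 415, 420, 421, 422, 426, 429, 433, 434, 435, 438, 439, 440, 443, 444, 445, 447, 448, 450, 452, 453, 456, 458, 463, 474, 478, 479, 482, 483, 488, 493, 507, 509, 512. Among these, $F(j,1024)>F(j+512,1024)$ exactly for $j$ = 1, 2, 6, 18, 22, 24, 25, 37, 62, 68, 73, 93, 94, 98, 101, 106, 112, 116, 124, 125, 131, 138, 144, 150, 154, 155, 156, 163, 165, 168, 175, 176, 180, 182, 184, 185, 186, 206, 209, 211, 216, 218, 221, 225, 236, 238, 242, 260,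 265, 268, 269, 272, 276, 277, 295, 299, 300, 304, 309, 310, 314, 315, 328, 330, 334, 342, 350, 352, 356, 357, 359, 360, 369, 371, 377, 382, 387, 396, 406, 415, 426, 429, 433, 438, 440, 444, 447, 448, 452, 463, 474, 479, 482, 483, 512 (and $<$ for the others). In step 11 only the 18 values $F(j,1024)$ are split with $j$ in the list $L_{11}$: 1, 2, 93, 94, 150, 185, 242, 334, 784, 840, 841, 876, 932, 933, 934, 941, 968, 1024. Among these, $G_j>G_{j+1024}$ exactly for $j$ = 1, 2, 185, 334, 968, 1024 (and $<$ for the others). The values $F(k,1024)$ that occur in the sums and products of step 11 for $j\in L_{11}$ are exactly those with $k$ in the following list $N$ of 213 numbers: 1, 2, 6, 14, 15, 23, 24, 25, 28, 36, 43, 58, 62, 63, 64, 68, 71, 87, 92, 93, 94, 98, 101, 106, 116, 117, 119, 124, 125, 128, 150, 154, 155, 156, 160, 163, 173, 175, 176, 184, 185, 186, 208, 211, 216, 217, 218, 225, 242, 247, 248, 252, 255, 265, 267, 268, 269, 276, 277, 278, 290, 303, 304, 308, 309, 310, 334, 339, 346, 347, 357, 359, 360, 361, 369, 382, 396, 401,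 402, 426, 438, 439, 440, 447, 452, 453, 458, 474, 478, 482, 483, 488, 493, 509, 518, 530, 531, 532, 534, 535, 537, 544, 549, 550, 570, 574, 575, 576, 583, 585, 593, 594, 600, 601, 610, 623, 624, 626, 627, 628, 629, 635, 641, 642, 643, 650, 656, 657, 662, 666, 667, 668, 677, 680, 685, 686, 687, 692, 693, 694, 705, 715, 718, 719, 720, 721, 733, 734, 735, 748, 749, 750, 757, 759, 760, 761, 762, 772, 777, 778, 779, 784, 797, 807, 811, 812, 816, 826, 827, 840, 841, 842, 851, 853, 854, 855, 862, 863, 864, 868, 870, 871, 876, 883, 889, 899, 903, 908, 918, 927, 932, 933, 934, 938, 941, 945, 946, 947, 955, 956, 957, 960, 962, 964, 968, 975, 990, 991, 994, 995, 1000, 1019, 1024. The list $L_{10}$ is exactly the set of $j\le512$ with $j\in N$ or $j+512\in N$; both are in $N$ exactly for the 32 numbers 6, 23, 25, 58, 62, 63, 64, 71, 98, 116, 117, 150, 154, 155, 156, 173, 175, 208, 247, 248, 265, 267, 304, 339, 359, 396, 426, 452, 478, 482, 483, 488. For all $G_l$ occurring in step 12, $\rho(l,1024)\in L_{11}$. (12)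 For $k\in\{1,93,933,1025,1117,1957\}$: $G_k(1,2)+G_k(2,2)=G_k$ and $G_k(1,2)G_k(2,2)=\frac{G_k^2-G_k}2-16-\sum_{l\in T_k}G_l$ with $T_1=\{2,1025,1117,1266,1900,1956,1957\}$, $T_{93}=\{1,94,1117,1209,1358,1992,2048\}$, $T_{933}=\{1,150,784,840,841,934,1957\}$, $T_{1025}=\{1,93,242,876,932,933,1026\}$, $T_{1117}=\{93,185,334,968,1024,1025,1118\}$, $T_{1957}=\{933,1025,1174,1808,1864,1865,1958\}$; $G_1(1,2)>G_1(2,2)$ and $G_k(1,2)<G_k(2,2)$ for the other five $k$. (13) For $k\in\{1,1025\}$, $s\in\{1,2\}$: $G_k(s,4)+G_k(s+2,4)=G_k(s,2)$, and $G_1(1,4)G_1(3,4)=\frac{G_1(1,2)^2-G_1(2,2)}2-8-G_{1025}(2,2)-G_{1117}(2,2)-G_{1957}(2,2)$, $G_1(2,4)G_1(4,4)=\frac{G_1(2,2)^2-G_1(1,2)}2-8-G_{1025}(1,2)-G_{1117}(1,2)-G_{1957}(1,2)$, $G_{1025}(1,4)G_{1025}(3,4)=\frac{G_{1025}(1,2)^2-G_{1025}(2,2)}2-8-G_1(1,2)-G_{93}(1,2)-G_{933}(1,2)$,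 $G_{1025}(2,4)G_{1025}(4,4)=\frac{G_{1025}(2,2)^2-G_{1025}(1,2)}2-8-G_1(2,2)-G_{93}(2,2)-G_{933}(2,2)$; the first factor is larger in the first three products, the second one in the fourth. (14) For $s\in\{1,2\}$: $G_1(s,8)+G_1(s+4,8)=G_1(s,4)$ and $G_1(s,8)>G_1(s+4,8)$, with $G_1(1,8)G_1(5,8)=\frac{G_1(1,4)^2-G_1(2,4)}2-4-G_{1025}(4,4)$ and $G_1(2,8)G_1(6,8)=\frac{G_1(2,4)^2-G_1(3,4)}2-4-G_{1025}(1,4)$. (15) $p_1+p_{256}=G_1(1,8)$, $p_1p_{256}=\frac{G_1(1,8)^2-G_1(2,8)}2-2$, $p_1>p_{256}$. Here $G_1=p_1+p_2+p_4+\cdots+p_{32768}$, $G_1(1,2)=p_1+p_4+p_{16}+p_{64}+p_{256}+p_{1024}+p_{4096}+p_{16384}$, $G_1(2,2)=p_2+p_8+p_{32}+p_{128}+p_{512}+p_{2048}+p_{8192}+p_{32768}$, $G_1(1,4)=p_1+p_{16}+p_{256}+p_{4096}$, $G_1(3,4)=p_4+p_{64}+p_{1024}+p_{16384}$, $G_1(1,8)=p_1+p_{256}$,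 $G_1(5,8)=p_{16}+p_{4096}$. **The chain is complete.** Start with $S=-1$ and carry out the 15 steps in order, calculating in each step the two parts of every listed value by $\frac{s\pm\sqrt{s^2-4q}}2$, where $s$ and $q$ are calculated by the above formulas from the numbers obtained in the previous step alone, and the sign is chosen according to the above lists (in step 10 only the 213 values $F(k,1024)$, $k\in N$, are calculated). The real numbers obtained are the values $F(j,2^m)$, $G_j$, $G_k(j,2)$, $G_k(j,4)$, $G_1(j,8)$ in question, and the last one is $p_1=2\cos\frac{2\pi}{65537}$. Consequently all the numbers $F(j,2^m)$, $0\le m\le 11$, the number $p_1$, and all vertices $e^{2\pi ik/65537}$ of the regular 65537-gon can be constructed with compass and straightedge from the points $0$ and $1$ of the plane. -/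

import Mathlib

namespace Gon65537

/-- The `65537`-th root of unity `exp (2πi / 65537)`. -/
noncomputable def z : ℂ := Complex.exp (2 * Real.pi * Complex.I / 65537)

/-- The pair `p_k = z ^ k + z ^ (-k) = 2 cos (2πk / 65537)`. -/
noncomputable def p (k : ℕ) : ℝ := 2 * Real.cos (2 * Real.pi * k / 65537)

/-- The `i`-th degree, `1 ≤ i ≤ 32`, of the `k`-th invariant set, `1 ≤ k ≤ 2048`, in natural order:
the first degree is `3 ^ (k - 1)`, each further one is the double of its predecessor,
all modulo `65537`. -/
def deg (k i : ℕ) : ℕ := 3 ^ (k - 1) * 2 ^ (i - 1) % 65537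

/-- The set of the `32` degrees of the elements of the `k`-th invariant set. -/
def degSet (k : ℕ) : Finset ℕ := (Finset.Icc 1 32).image (deg k)

/-- The number of the `i`-th pair, `1 ≤ i ≤ 16`, of the `k`-th invariant set,
normalised to lie between `1` and `32768`. -/
def pairNo (k i : ℕ) : ℕ := min (deg k i) (65537 - deg k i)

/-- The invariant set `G_k`, understood as the (real) sum of its `16` pairs. -/
noncomputable def G (k : ℕ) : ℝ := ∑ i ∈ Finset.Icc 1 16, p (pairNo k i)

/-- `G_k(j, M)`, where `M` divides `16` and `1 ≤ j ≤ M`: the sum of every `M`-th pair of the `k`-th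
invariant set in natural order, beginning with the `j`-th pair. -/
noncomputable def Gpart (k j M : ℕ) : ℝ :=
  ∑ t ∈ Finset.range (16 / M), p (pairNo k (j + t * M))

/-- `F(j, M)`, where `M` divides `2048` and `1 ≤ j ≤ M`: the sum `G_j + G_{j+M} + ⋯` of every `M`-th
invariant set, beginning with `G_j`. -/
noncomputable def F (j M : ℕ) : ℝ := ∑ t ∈ Finset.range (2048 / M), G (j + t * M)

/-- The representative of `k` modulo `m` that lies between `1` and `m`. -/
def rho (k m : ℕ) : ℕ := if m ∣ k then m else k % m

/-- The number of invariant sets, among the `32` ones whose sum is the product `G_1 * G_q` (`q ≠ 1`),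
that belong to `F(k, M)`. These `32` sets are the ones which contain the degrees `1 + d`, with `1`
the first degree of `G_1` and `d` running through the degrees of `G_q`. -/
def prodCount (q k M : ℕ) : ℕ :=
  ((degSet q).filter fun d =>
    ∃ l ∈ Finset.Icc 1 2048, rho l M = k ∧ (1 + d) % 65537 ∈ degSet l).card

/-- `μ(k, M)`: the number of invariant sets belonging to `F(k, M)` in the sum
`G_1 G_{1+M} + G_1 G_{1+M+2M} + ⋯ + G_1 G_{1+1024-M}`. -/
def mu (k M : ℕ) : ℕ := ∑ t ∈ Finset.range (512 / M), prodCount (1 + M + t * (2 * M)) k M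

/-- `a` is the larger and `b` the smaller root of the quadratic equation `x ^ 2 - s x + q = 0`,
which are calculated by extracting a square root. -/
def Splits (s q a b : ℝ) : Prop :=
  a + b = s ∧ a * b = q ∧ b < a ∧
    a = (s + Real.sqrt (s ^ 2 - 4 * q)) / 2 ∧ b = (s - Real.sqrt (s ^ 2 - 4 * q)) / 2

/-- `a` and `b` are the two roots of `x ^ 2 - s x + q = 0`; `a` is the larger one if `first` holds,
and `b` is the larger one otherwise. -/
def SplitsBy (first : Prop) (s q a b : ℝ) : Prop :=
  (first → Splits s q a b) ∧ (¬ first → Splits s q b a)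

/-! ### Tables for the splittings of sums of invariant sets -/

/-- The list of the numbers `μ(1, 32), …, μ(32, 32)`. -/
def mu32 : List ℕ :=
  [4, 12, 20, 13, 20, 18, 16, 19, 19, 22, 12, 22, 13, 13, 11, 22, 20, 15, 25, 12, 16, 12, 16, 17,
   29, 16, 7, 17, 13, 17, 13, 11]

/-- The list of those `k` for which `μ(k, 64) = m`, for `1 ≤ m ≤ 10`. -/
def K64 (m : ℕ) : List ℕ :=
  match m with
  | 1 =>
    [13, 24, 31, 33, 37, 38]
  | 2 =>
    [3, 7, 9, 21, 36, 46, 56, 57]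
  | 3 =>
    [2, 15, 19, 25, 27, 28, 35, 40, 41, 42, 45, 47, 59, 61, 64]
  | 4 =>
    [29, 32, 43, 48, 51, 52, 58, 60]
  | 5 =>
    [4, 5, 6, 8, 11, 16, 20, 22, 23, 30, 53, 62]
  | 6 =>
    [10, 12, 14, 17, 34, 44, 54]
  | 7 =>
    [39, 49, 50]
  | 8 =>
    [18, 55, 63]
  | 9 => []
  | 10 =>
    [26]
  | _ => []

/-- The list of those `k` for which `μ(k, 128) = m`, for `1 ≤ m ≤ 5`. -/
def K128 (m : ℕ) : List ℕ :=
  match m with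
  | 1 =>
    [2, 4, 5, 7, 8, 9, 15, 16, 17, 21, 23, 26, 27, 31, 36, 38, 46, 48, 49, 52, 57, 59, 61, 62, 81,
     83, 87, 90, 91, 96, 99, 100, 111, 112, 116, 117, 119, 120, 124, 125, 126]
  | 2 =>
    [1, 34, 35, 37, 39, 41, 42, 43, 60, 64, 68, 71, 74, 75, 77, 80, 84, 88, 89, 95, 98, 102, 104,
     105, 109, 110, 118, 122, 128]
  | 3 =>
    [11, 30, 101, 106]
  | 4 =>
    [66, 107, 115]
  | 5 =>
    [58]
  | _ => []

/-- The list of those `k` for which `μ(k, 256) = m`, for `1 ≤ m ≤ 3`. -/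
def K256 (m : ℕ) : List ℕ :=
  match m with
  | 1 =>
    [5, 8, 15, 20, 30, 31, 34, 38, 40, 42, 44, 45, 51, 52, 54, 57, 60, 62, 66, 69, 71, 79, 80, 82,
     85, 89, 90, 107, 110, 113, 118, 125, 129, 136, 143, 147, 174, 176, 187, 188, 189, 196, 201,
     213, 220, 232, 234, 244, 251, 253, 254]
  | 2 =>
    [4, 29, 157, 186, 246]
  | 3 =>
    [83]
  | _ => []

/-- The list of those `k` for which `μ(k, 512) = m`, for `1 ≤ m ≤ 2`. -/
def K512 (m : ℕ) : List ℕ :=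
  match m with
  | 1 =>
    [41, 49, 81, 92, 106, 109, 114, 211, 226, 233, 269, 275, 278, 281, 303, 349, 379, 390, 431,
     465]
  | 2 =>
    [68, 86, 88, 135, 175, 451]
  | _ => []

/-- Step `m` splits `F(j, 2 ^ (m - 1))` into `F(j, 2 ^ m)` and `F(j + 2 ^ (m - 1), 2 ^ m)`. The list
contains those `j` for which the former part is the larger one (in step `10` only for the `j` in
`split10`, in step `11` only for the `j` in `split11`). -/
def larger (m : ℕ) : List ℕ :=
  match m with
  | 1 => [1]
  | 2 => []
  | 3 => [2, 3]
  | 4 => [1, 2, 3, 5, 7]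
  | 5 =>
    [1, 3, 4, 5, 8, 9, 10, 12, 13, 15]
  | 6 =>
    [1, 2, 4, 5, 9, 10, 11, 12, 15, 21, 24, 28, 29, 31, 32]
  | 7 =>
    [1, 2, 3, 4, 6, 8, 10, 12, 16, 17, 18, 19, 20, 21, 24, 26, 27, 28, 29, 31, 32, 33, 34, 36, 37,
     39, 40, 42, 45, 46, 48, 50, 51, 57, 58, 59, 62, 63]
  | 8 =>
    [1, 2, 3, 4, 5, 6, 7, 9, 10, 11, 12, 14, 16, 20, 21, 24, 25, 26, 28, 29, 30, 31, 32, 33, 34,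
     35, 41, 44, 47, 49, 53, 55, 56, 60, 61, 63, 65, 66, 67, 69, 71, 72, 73, 74, 76, 77, 78, 82,
     83, 85, 91, 92, 93, 98, 100, 102, 104, 105, 107, 108, 109, 110, 111, 113, 117, 120, 121, 124,
     125, 126, 128]
  | 9 =>
    [1, 2, 5, 6, 13, 14, 15, 16, 18, 19, 20, 21, 22, 23, 24, 25, 27, 30, 31, 32, 37, 38, 39, 42,
     44, 45, 46, 47, 48, 49, 52, 54, 55, 58, 59, 62, 63, 65, 66, 76, 77, 78, 79, 82, 84, 87, 89,
     90, 91, 93, 94, 96, 97, 98, 102, 103, 107, 110, 115, 117, 118, 119, 123, 127, 133, 134, 136,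
     139, 144, 145, 147, 148, 149, 151, 152, 155, 156, 157, 160, 161, 162, 166, 168, 170, 171,
     180, 182, 185, 186, 187, 188, 189, 191, 194, 195, 197, 200, 203, 206, 207, 209, 210, 213,
     215, 217, 220, 221, 222, 223, 225, 230, 232, 234, 235, 236, 237, 238, 240, 241, 242, 244,
     245, 254, 255, 256]
  | 10 =>
    [1, 2, 6, 18, 22, 24, 25, 37, 62, 68, 73, 93, 94, 98, 101, 106, 112, 116, 124, 125, 131, 138,
     144, 150, 154, 155, 156, 163, 165, 168, 175, 176, 180, 182, 184, 185, 186, 206, 209, 211,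
     216, 218, 221, 225, 236, 238, 242, 260, 265, 268, 269, 272, 276, 277, 295, 299, 300, 304,
     309, 310, 314, 315, 328, 330, 334, 342, 350, 352, 356, 357, 359, 360, 369, 371, 377, 382,
     387, 396, 406, 415, 426, 429, 433, 438, 440, 444, 447, 448, 452, 463, 474, 479, 482, 483,
     512]
  | 11 => [1, 2, 185, 334, 968, 1024]
  | _ => []

/-- The numbers `j` for which `F(j, 1024)` is split in step `11`. -/
def split11 : List ℕ :=
  [1, 2, 93, 94, 150, 185, 242, 334, 784, 840, 841, 876, 932, 933, 934, 941, 968, 1024]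

/-- The numbers `j` of the values `F(j, 1024)` which are used in step `11`. -/
def needed11 : List ℕ :=
  [1, 2, 6, 14, 15, 23, 24, 25, 28, 36, 43, 58, 62, 63, 64, 68, 71, 87, 92, 93, 94, 98, 101, 106,
   116, 117, 119, 124, 125, 128, 150, 154, 155, 156, 160, 163, 173, 175, 176, 184, 185, 186, 208,
   211, 216, 217, 218, 225, 242, 247, 248, 252, 255, 265, 267, 268, 269, 276, 277, 278, 290, 303,
   304, 308, 309, 310, 334, 339, 346, 347, 357, 359, 360, 361, 369, 382, 396, 401, 402, 426, 438,
   439, 440, 447, 452, 453, 458, 474, 478, 482, 483, 488, 493, 509, 518, 530, 531, 532, 534, 535,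
   537, 544, 549, 550, 570, 574, 575, 576, 583, 585, 593, 594, 600, 601, 610, 623, 624, 626, 627,
   628, 629, 635, 641, 642, 643, 650, 656, 657, 662, 666, 667, 668, 677, 680, 685, 686, 687, 692,
   693, 694, 705, 715, 718, 719, 720, 721, 733, 734, 735, 748, 749, 750, 757, 759, 760, 761, 762,
   772, 777, 778, 779, 784, 797, 807, 811, 812, 816, 826, 827, 840, 841, 842, 851, 853, 854, 855,
   862, 863, 864, 868, 870, 871, 876, 883, 889, 899, 903, 908, 918, 927, 932, 933, 934, 938, 941,
   945, 946, 947, 955, 956, 957, 960, 962, 964, 968, 975, 990, 991, 994, 995, 1000, 1019, 1024]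

/-- The numbers `j` for which `F(j, 512)` is split in step `10`. -/
def split10 : List ℕ :=
  [1, 2, 6, 14, 15, 18, 19, 20, 22, 23, 24, 25, 28, 32, 36, 37, 38, 43, 58, 62, 63, 64, 68, 71,
   73, 81, 82, 87, 88, 89, 92, 93, 94, 98, 101, 106, 111, 112, 114, 115, 116, 117, 119, 123, 124,
   125, 128, 129, 130, 131, 138, 144, 145, 150, 154, 155, 156, 160, 163, 165, 168, 173, 174, 175,
   176, 180, 181, 182, 184, 185, 186, 193, 203, 206, 207, 208, 209, 211, 216, 217, 218, 221, 222,
   223, 225, 236, 237, 238, 242, 245, 247, 248, 249, 250, 252, 255, 260, 265, 266, 267, 268, 269,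
   272, 276, 277, 278, 285, 290, 295, 299, 300, 303, 304, 308, 309, 310, 314, 315, 328, 329, 330,
   334, 339, 341, 342, 343, 346, 347, 350, 351, 352, 356, 357, 358, 359, 360, 361, 364, 369, 371,
   377, 382, 387, 391, 396, 401, 402, 406, 415, 420, 421, 422, 426, 429, 433, 434, 435, 438, 439,
   440, 443, 444, 445, 447, 448, 450, 452, 453, 456, 458, 463, 474, 478, 479, 482, 483, 488, 493,
   507, 509, 512]

/-- The numbers `j` in `split10` for which both parts of `F(j, 512)` are used in step `11`. -/
def both10 : List ℕ :=
  [6, 23, 25, 58, 62, 63, 64, 71, 98, 116, 117, 150, 154, 155, 156, 173, 175, 208, 247, 248, 265,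
   267, 304, 339, 359, 396, 426, 452, 478, 482, 483, 488]

/-- The pairs `(c, o)` of the terms `c * F(o, 1024)` in the product `G_1 * G_1025`. -/
def terms11 : List (ℕ × ℕ) :=
  [(2, 1), (1, 24), (2, 155), (1, 185), (1, 309), (1, 360), (1, 531), (1, 667), (1, 719), (1, 734),
   (2, 778), (1, 841), (1, 946)]

/-- The product `F(j, 2 ^ m) * F(j + 2 ^ (m - 1), 2 ^ m)` of the two parts of step `m`, calculated
from the values `v k = F(k, 2 ^ (m - 1))`. -/
noncomputable def prodF (m : ℕ) (v : ℕ → ℝ) (j : ℕ) : ℝ :=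
  match m with
  | 1 => -16384
  | 2 => -4096
  | 3 => -1040 - 48 * v j - 16 * v (rho (2 + j) 4)
  | 4 => -237 + 47 * v j + 35 * v (rho (2 + j) 8) + 19 * v (rho (4 + j) 8)
          + 32 * v (rho (5 + j) 8) + 19 * v (rho (6 + j) 8)
  | 5 => -60 + 20 * v j + 2 * v (rho (1 + j) 16) + 4 * v (rho (3 + j) 16) - 3 * v (rho (4 + j) 16)
          + v (rho (6 + j) 16) + 8 * v (rho (8 + j) 16) + 4 * v (rho (9 + j) 16)
          + 4 * v (rho (10 + j) 16) - 2 * v (rho (11 + j) 16) + 5 * v (rho (12 + j) 16)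
          + 10 * v (rho (13 + j) 16) + v (rho (14 + j) 16) + 10 * v (rho (15 + j) 16)
  | 6 => ∑ k ∈ Finset.Icc (1 : ℕ) 32, ((mu32.getD (k - 1) 0 : ℕ) : ℝ) * v (rho (k + j - 1) 32)
  | 7 => ∑ m ∈ Finset.Icc (1 : ℕ) 10, (m : ℝ) * ((K64 m).map fun k => v (rho (k + j - 1) 64)).sum
  | 8 => ∑ m ∈ Finset.Icc (1 : ℕ) 5, (m : ℝ) * ((K128 m).map fun k => v (rho (k + j - 1) 128)).sum
  | 9 => ∑ m ∈ Finset.Icc (1 : ℕ) 3, (m : ℝ) * ((K256 m).map fun k => v (rho (k + j - 1) 256)).sum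
  | 10 => ∑ m ∈ Finset.Icc (1 : ℕ) 2, (m : ℝ) * ((K512 m).map fun k => v (rho (k + j - 1) 512)).sum
  | 11 => (terms11.map fun t => (t.1 : ℝ) * v (rho (t.2 + j - 1) 1024)).sum
  | _ => 0

/-! ### Tables for the splittings of invariant sets -/

/-- The numbers `k` of the invariant sets `G_k` which are split in step `12`. -/
def split12 : List ℕ := [1, 93, 933, 1025, 1117, 1957]

/-- The numbers `l` of the invariant sets that are subtracted in the formula for
`G_k(1,2) * G_k(2,2)`. -/
def terms12 (k : ℕ) : List ℕ :=
  match k with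
  | 1 => [2, 1025, 1117, 1266, 1900, 1956, 1957]
  | 93 => [1, 94, 1117, 1209, 1358, 1992, 2048]
  | 933 => [1, 150, 784, 840, 841, 934, 1957]
  | 1025 => [1, 93, 242, 876, 932, 933, 1026]
  | 1117 => [93, 185, 334, 968, 1024, 1025, 1118]
  | 1957 => [933, 1025, 1174, 1808, 1864, 1865, 1958]
  | _ => []

/-- The product `G_k(1,2) * G_k(2,2)`, `k ∈ split12`, calculated from the values `g l = G_l`. -/
noncomputable def prod12 (g : ℕ → ℝ) (k : ℕ) : ℝ :=
  (g k ^ 2 - g k) / 2 - 16 - ((terms12 k).map g).sum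

/-- The product `G_k(s,4) * G_k(s+2,4)`, for `k = 1, 1025` and `s = 1, 2`, calculated from the values
`h l t = G_l(t,2)`. -/
noncomputable def prod13 (h : ℕ → ℕ → ℝ) (k s : ℕ) : ℝ :=
  match k, s with
  | 1, 1 => (h 1 1 ^ 2 - h 1 2) / 2 - 8 - h 1025 2 - h 1117 2 - h 1957 2
  | 1, 2 => (h 1 2 ^ 2 - h 1 1) / 2 - 8 - h 1025 1 - h 1117 1 - h 1957 1
  | 1025, 1 => (h 1025 1 ^ 2 - h 1025 2) / 2 - 8 - h 1 1 - h 93 1 - h 933 1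
  | 1025, 2 => (h 1025 2 ^ 2 - h 1025 1) / 2 - 8 - h 1 2 - h 93 2 - h 933 2
  | _, _ => 0

/-- The product `G_1(s,8) * G_1(s+4,8)`, for `s = 1, 2`, calculated from the values
`h l t = G_l(t,4)`. -/
noncomputable def prod14 (h : ℕ → ℕ → ℝ) (s : ℕ) : ℝ :=
  match s with
  | 1 => (h 1 1 ^ 2 - h 1 2) / 2 - 4 - h 1025 4
  | 2 => (h 1 2 ^ 2 - h 1 3) / 2 - 4 - h 1025 1
  | _ => 0

/-- The product `p_1 * p_256`, calculated from the values `h t = G_1(t,8)`. -/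
noncomputable def prod15 (h : ℕ → ℝ) : ℝ := (h 1 ^ 2 - h 2) / 2 - 2

/-! ### The explicit expression by successive square roots

The following real numbers are built from integers by the four operations and square roots only.
Values which the chain does not calculate are set to `0`. -/

/-- The larger root of `x ^ 2 - s x + q = 0` if `first` holds, and the smaller root otherwise. -/
noncomputable def root (first : Prop) [Decidable first] (s q : ℝ) : ℝ :=
  if first then (s + Real.sqrt (s ^ 2 - 4 * q)) / 2 else (s - Real.sqrt (s ^ 2 - 4 * q)) / 2

/-- From the values `v j` of the level `2 ^ (m - 1)` to the values of the level `2 ^ m`. -/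
noncomputable def radStep (m : ℕ) (v : ℕ → ℝ) (i : ℕ) : ℝ :=
  if i ≤ 2 ^ (m - 1) then root (i ∈ larger m) (v i) (prodF m v i)
  else root (i - 2 ^ (m - 1) ∉ larger m) (v (i - 2 ^ (m - 1))) (prodF m v (i - 2 ^ (m - 1)))

/-- Result of steps `1, …, m`, for `m ≤ 9`. -/
noncomputable def radF : ℕ → ℕ → ℝ
  | 0 => fun _ => -1
  | m + 1 => radStep (m + 1) (radF m)

/-- Result of step `10`: only the values in `needed11` are calculated. -/
noncomputable def radF10 (i : ℕ) : ℝ := if i ∈ needed11 then radStep 10 (radF 9) i else 0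

/-- Result of step `11`: only the values in `split11` are split. -/
noncomputable def radG (i : ℕ) : ℝ := if rho i 1024 ∈ split11 then radStep 11 radF10 i else 0

/-- Result of step `12`, the values of `G_k(s,2)` for `k ∈ split12` and `s = 1, 2`. -/
noncomputable def radHalf (k s : ℕ) : ℝ :=
  if k ∈ split12 then
    if s = 1 then root (k = 1) (radG k) (prod12 radG k) else root (k ≠ 1) (radG k) (prod12 radG k)
  else 0

/-- Result of step `13`, the values of `G_k(s,4)` for `k = 1, 1025` and `1 ≤ s ≤ 4`. -/
noncomputable def radQuarter (k s : ℕ) : ℝ :=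
  if k = 1 ∨ k = 1025 then
    if s ≤ 2 then root (¬ (k = 1025 ∧ s = 2)) (radHalf k s) (prod13 radHalf k s)
    else root (k = 1025 ∧ s - 2 = 2) (radHalf k (s - 2)) (prod13 radHalf k (s - 2))
  else 0

/-- Result of step `14`, the values of `G_1(s,8)` for `s = 1, 2`. -/
noncomputable def radEighth (s : ℕ) : ℝ := root True (radQuarter 1 s) (prod14 radQuarter s)

/-- Result of step `15`. -/
noncomputable def radP1 : ℝ := root True (radEighth 1) (prod15 radEighth)

/-! ### Compass and straightedge -/

/-- The points of the plane that can be constructed with compass and straightedge from the points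
`0` and `1`: one may intersect two different lines through constructed points, a line with a
circle, or two circles with different centres, where the centre of a circle is a constructed point
and its radius is the distance of two constructed points. -/
inductive IsConstructible : ℂ → Prop
  | zero : IsConstructible 0
  | one : IsConstructible 1
  | line_line {a b c d x : ℂ} : IsConstructible a → IsConstructible b → IsConstructible c →
      IsConstructible d → a ≠ b → c ≠ d → line[ℝ, a, b] ≠ line[ℝ, c, d] →
      x ∈ line[ℝ, a, b] → x ∈ line[ℝ, c, d] → IsConstructible x
  | line_circle {a b c d e x : ℂ} : IsConstructible a → IsConstructible b → IsConstructible c →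
      IsConstructible d → IsConstructible e → a ≠ b → x ∈ line[ℝ, a, b] →
      dist x c = dist d e → IsConstructible x
  | circle_circle {a b c d e f x : ℂ} : IsConstructible a → IsConstructible b →
      IsConstructible c → IsConstructible d → IsConstructible e → IsConstructible f → a ≠ d →
      dist x a = dist b c → dist x d = dist e f → IsConstructible x

end Gon65537

open Gon65537

/-!
The nonzero residues modulo the Fermat prime `65537` form a cyclic group with the generator `3`. Its
subgroup of order `32` is generated by `2`, because `2 ^ 16 = -1` and `3 ^ 2048 = 2 ^ 19`. Hence the
invariant sets `G_k` are the Gaussian periods of the cosets `3 ^ (k - 1) ⟨2⟩`, the numbers `G_k(j, M)`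
are the periods `eta M` of the cosets of `⟨2 ^ M⟩`, and the `F(j, M)` are sums of periods; everything
about them follows from the fact that the additive character `psi` turns a product of two periods into
a sum of periods (`eta_mul_eta`).

* Products of the `F(j, M)`. A product of two periods `G_a G_{a+q}` depends on `a` only through a
  translation of all indices. In the product of the two parts of `F(j, M)` the differences `q` and
  `2048 - q` contribute equally (`sum_mul_sum_of_periodic`), which gives the coefficients `μ(k, M)` in
  `F_mul_F`. A residue lies in a coset belonging to `F(k, M)` if and only if its power with exponent
  `65536 / M` has a prescribed value (`exists_mem_degSet_iff`), so that the `μ(k, M)` are found by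
  modular exponentiations (`mu_eq_muCount`). In the first steps a multiple of the sum `-1` of all
  `F(k, M)` is subtracted.

* Products of parts of invariant sets. If `A` and `B` are the halves of a period, then
  `A B = ((A + B) ^ 2 - (A ^ 2 + B ^ 2)) / 2`, where `A ^ 2 + B ^ 2` is a sum of periods of the size of
  `A + B` (`eta_half_mul`); these are identified by power residues as well (`eta_eq_of_pow_eq`).

* Comparison of the two parts. For `v = 2 - 2 cos θ` the doubling of `θ` is the map `v ↦ v (4 - v)`.
  From `θ = 2πr / (65537 * 2 ^ 32)`, where `v` is `θ ^ 2` up to a tiny error, the iteration of this map in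
  fixed-point arithmetic yields all the pairs of an invariant set, with an error that is at most
  quadrupled in each doubling, plus one unit of rounding (`Approx.double`). Adding up the approximations
  along the binary tree of the `F(j, 2 ^ m)`, all comparisons are made with a safe margin
  (`checkedValue_spec`, `partsOrdered`).

* The chain. The two parts are the roots of a quadratic equation, and the comparison tells which root is
  which; so the explicit radical expressions agree with the periods step by step (`radF_eq`, …,
  `radP1_eq`).

* Compass and straightedge. The constructible real numbers are closed under the four operations and
  square roots, hence they contain all numbers of the chain, and `cos (2π / 65537)` and
  `sin (2π / 65537)` give all the vertices by the addition theorems (`IsConstructible.vertex`).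
-/

namespace Gon65537

/-! ### The invariant sets as cosets in the integers modulo 65537 -/

/-- `65537` is a Fermat prime; hence the integers modulo `65537` form a field. -/
instance fact_prime : Fact (Nat.Prime 65537) := ⟨by norm_num⟩

theorem natCast_eq_iff (a b : ℕ) : (a : ZMod 65537) = b ↔ a % 65537 = b % 65537 :=
  ZMod.natCast_eq_natCast_iff a b 65537

theorem two_pow_sixteen : (2 : ZMod 65537) ^ 16 = -1 := by
  have h : ((2 ^ 16 + 1 : ℕ) : ZMod 65537) = ((0 : ℕ) : ZMod 65537) := by
    rw [natCast_eq_iff]; norm_num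
  push_cast at h
  exact eq_neg_of_add_eq_zero_left h

theorem two_pow_thirtytwo : (2 : ZMod 65537) ^ 32 = 1 := by
  rw [show 32 = 16 * 2 from rfl, pow_mul, two_pow_sixteen]; ring

theorem two_ne_zero' : (2 : ZMod 65537) ≠ 0 := by
  intro h
  have := two_pow_thirtytwo
  rw [h] at this
  simp at this

theorem orderOf_two : orderOf (2 : ZMod 65537) = 32 := by
  refine orderOf_eq_prime_pow (p := 2) (n := 4) ?_ ?_
  · rw [show 2 ^ 4 = 16 from rfl, two_pow_sixteen]
    intro h
    have : ((2 : ℕ) : ZMod 65537) = ((0 : ℕ) : ZMod 65537) := by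
      push_cast; linear_combination -h
    rw [natCast_eq_iff] at this; norm_num at this
  · exact two_pow_thirtytwo

set_option exponentiation.threshold 70000 in
theorem orderOf_three : orderOf (3 : ZMod 65537) = 65536 := by
  have key : (3 : ZMod 65537) ^ 2 ^ 15 = ((65536 : ℕ) : ZMod 65537) := by
    have : ((3 ^ 2 ^ 15 : ℕ) : ZMod 65537) = ((65536 : ℕ) : ZMod 65537) := by
      rw [natCast_eq_iff]; decide +kernel
    exact_mod_cast this
  refine orderOf_eq_prime_pow (p := 2) (n := 15) ?_ ?_
  · rw [key]
    intro h
    have : ((65536 : ℕ) : ZMod 65537) = ((1 : ℕ) : ZMod 65537) := by simpa using h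
    rw [natCast_eq_iff] at this; norm_num at this
  · rw [pow_succ, pow_mul, key]
    have : ((65536 ^ 2 : ℕ) : ZMod 65537) = ((1 : ℕ) : ZMod 65537) := by
      rw [natCast_eq_iff]; norm_num
    exact_mod_cast this

theorem three_ne_zero' : (3 : ZMod 65537) ≠ 0 := by
  intro h
  have := orderOf_three
  rw [h, orderOf_zero] at this
  simp at this

theorem pow_eq_pow_iff_of_ne_zero {x : ZMod 65537} (hx : x ≠ 0) (a b : ℕ) :
    x ^ a = x ^ b ↔ a ≡ b [MOD orderOf x] := by
  lift x to (ZMod 65537)ˣ using hx.isUnit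
  rw [← Units.val_pow_eq_pow_val, ← Units.val_pow_eq_pow_val, Units.val_inj, orderOf_units]
  exact pow_eq_pow_iff_modEq

theorem three_pow_eq_iff (a b : ℕ) : (3 : ZMod 65537) ^ a = 3 ^ b ↔ a ≡ b [MOD 65536] := by
  rw [pow_eq_pow_iff_of_ne_zero three_ne_zero', orderOf_three]

set_option exponentiation.threshold 70000 in
/-- The subgroup of index `2048` is generated by `2` as well as by `3 ^ 2048`. -/
theorem three_pow_2048 : (3 : ZMod 65537) ^ 2048 = 2 ^ 19 := by
  have : ((3 ^ 2048 : ℕ) : ZMod 65537) = ((2 ^ 19 : ℕ) : ZMod 65537) := by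
    rw [natCast_eq_iff]; decide +kernel
  exact_mod_cast this

/-- `3` is a primitive root. -/
theorem exists_three_pow {x : ZMod 65537} (hx : x ≠ 0) : ∃ a < 65536, 3 ^ a = x := by
  have hinj : Set.InjOn (fun a : ℕ => (3 : ZMod 65537) ^ a) (Finset.range 65536) := by
    intro a ha b hb h
    have h' := (three_pow_eq_iff a b).1 h
    simp only [Finset.coe_range, Set.mem_Iio] at ha hb
    rwa [Nat.ModEq, Nat.mod_eq_of_lt ha, Nat.mod_eq_of_lt hb] at h'
  have himg : (Finset.range 65536).image (fun a : ℕ => (3 : ZMod 65537) ^ a) =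
      Finset.univ.erase 0 := by
    refine Finset.eq_of_subset_of_card_le ?_ ?_
    · intro y hy
      obtain ⟨a, -, rfl⟩ := Finset.mem_image.1 hy
      simp [three_ne_zero']
    · rw [Finset.card_image_of_injOn hinj, Finset.card_erase_of_mem (Finset.mem_univ _),
        Finset.card_univ, ZMod.card, Finset.card_range]
  have : x ∈ (Finset.range 65536).image (fun a : ℕ => (3 : ZMod 65537) ^ a) := by
    rw [himg]; simp [hx]
  obtain ⟨a, ha, h⟩ := Finset.mem_image.1 this
  exact ⟨a, Finset.mem_range.1 ha, h⟩

/-- Every nonzero residue is `3 ^ l * 2 ^ i` with `l < 2048` and `i < 32`. -/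
theorem exists_class {x : ZMod 65537} (hx : x ≠ 0) :
    ∃ l < 2048, ∃ i < 32, x = 3 ^ l * 2 ^ i := by
  obtain ⟨a, -, rfl⟩ := exists_three_pow hx
  refine ⟨a % 2048, Nat.mod_lt _ (by norm_num), 19 * (a / 2048) % 32,
    Nat.mod_lt _ (by norm_num), ?_⟩
  conv_lhs => rw [← Nat.mod_add_div a 2048, pow_add, pow_mul, three_pow_2048, ← pow_mul]
  rw [← pow_mod_orderOf (2 : ZMod 65537) (19 * (a / 2048)), orderOf_two]

theorem natCast_deg (k i : ℕ) : (deg k i : ZMod 65537) = 3 ^ (k - 1) * 2 ^ (i - 1) := by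
  simp [deg, ZMod.natCast_mod]

theorem deg_lt (k i : ℕ) : deg k i < 65537 := Nat.mod_lt _ (by norm_num)

theorem deg_pos (k i : ℕ) : 0 < deg k i := by
  rcases Nat.eq_zero_or_pos (deg k i) with h | h
  · have := natCast_deg k i
    rw [h, Nat.cast_zero] at this
    exact absurd this.symm
      (mul_ne_zero (pow_ne_zero _ three_ne_zero') (pow_ne_zero _ two_ne_zero'))
  · exact h

theorem eq_of_natCast_eq {a b : ℕ} (ha : a < 65537) (hb : b < 65537)
    (h : (a : ZMod 65537) = b) : a = b := by
  rwa [natCast_eq_iff, Nat.mod_eq_of_lt ha, Nat.mod_eq_of_lt hb] at h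

theorem deg_injOn (k : ℕ) : Set.InjOn (deg k) (Finset.Icc 1 32) := by
  intro i hi j hj h
  simp only [Finset.coe_Icc, Set.mem_Icc] at hi hj
  have h' : (deg k i : ZMod 65537) = deg k j := by rw [h]
  rw [natCast_deg, natCast_deg] at h'
  have h2 := mul_left_cancel₀ (pow_ne_zero _ three_ne_zero') h'
  rw [pow_eq_pow_iff_of_ne_zero two_ne_zero', orderOf_two, Nat.ModEq] at h2
  omega

theorem card_degSet (k : ℕ) : (degSet k).card = 32 := by
  rw [degSet, Finset.card_image_of_injOn (deg_injOn k)]; simp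

theorem mem_degSet_iff_exists {k d : ℕ} (hd : d < 65537) :
    d ∈ degSet k ↔ ∃ i < 32, (d : ZMod 65537) = 3 ^ (k - 1) * 2 ^ i := by
  simp only [degSet, Finset.mem_image, Finset.mem_Icc]
  constructor
  · rintro ⟨i, hi, rfl⟩
    exact ⟨i - 1, by omega, natCast_deg k i⟩
  · rintro ⟨i, hi, h⟩
    refine ⟨i + 1, by omega, eq_of_natCast_eq (deg_lt _ _) hd ?_⟩
    rw [natCast_deg, h, Nat.add_sub_cancel]

/-- The `32`-nd power characterises the invariant set which contains a given degree. -/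
theorem mem_degSet_iff {k d : ℕ} (hk : k ∈ Finset.Icc 1 2048) (hd : d < 65537) :
    d ∈ degSet k ↔ (d : ZMod 65537) ^ 32 = 3 ^ (32 * (k - 1)) := by
  rw [mem_degSet_iff_exists hd]
  rw [Finset.mem_Icc] at hk
  constructor
  · rintro ⟨i, -, h⟩
    rw [h, mul_pow, ← pow_mul 2, mul_comm i, pow_mul 2, two_pow_thirtytwo, one_pow, mul_one,
      ← pow_mul, mul_comm]
  · intro h
    have h0 : (d : ZMod 65537) ≠ 0 := by
      intro h0
      rw [h0, zero_pow (by norm_num)] at h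
      exact pow_ne_zero _ three_ne_zero' h.symm
    obtain ⟨l, hl, i, hi, h1⟩ := exists_class h0
    refine ⟨i, hi, ?_⟩
    rw [h1, mul_pow, ← pow_mul 2, mul_comm i, pow_mul 2, two_pow_thirtytwo, one_pow, mul_one,
      ← pow_mul, three_pow_eq_iff, Nat.ModEq] at h
    rw [h1, show l = k - 1 by omega]

theorem rho_eq_iff {l k M : ℕ} (hk : k ∈ Finset.Icc 1 M) :
    rho l M = k ↔ l ≡ k [MOD M] := by
  rw [Finset.mem_Icc] at hk
  rw [rho, Nat.ModEq]
  rcases hk.2.lt_or_eq with h | rfl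
  · rw [Nat.mod_eq_of_lt h]
    split_ifs with hd
    · rw [Nat.mod_eq_zero_of_dvd hd]; omega
    · rfl
  · rw [Nat.mod_self]
    split_ifs with hd
    · simp [Nat.mod_eq_zero_of_dvd hd]
    · have : l % k ≠ 0 := fun h => hd (Nat.dvd_of_mod_eq_zero h)
      have h3 := Nat.mod_lt l (show k > 0 by omega)
      constructor <;> intro h <;> omega

theorem rho_mem (l : ℕ) {M : ℕ} (hM : 0 < M) : rho l M ∈ Finset.Icc 1 M := by
  rw [Finset.mem_Icc, rho]
  split_ifs with hd
  · omega
  · have : l % M ≠ 0 := fun h => hd (Nat.dvd_of_mod_eq_zero h)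
    have h3 := Nat.mod_lt l hM
    omega

theorem rho_eq_self {k M : ℕ} (hk : k ∈ Finset.Icc 1 M) : rho k M = k :=
  (rho_eq_iff hk).2 rfl

theorem rho_modEq (l : ℕ) (M : ℕ) : rho l M ≡ l [MOD M] := by
  rw [rho, Nat.ModEq]
  split_ifs with hd
  · rw [Nat.mod_self, Nat.mod_eq_zero_of_dvd hd]
  · exact Nat.mod_mod _ _

/-- The union of the invariant sets which belong to `F(k, M)` is a coset of the group of `M`-th
powers, hence is characterised by the power with exponent `65536 / M`. -/
theorem exists_mem_degSet_iff {M k x : ℕ} (hM : M ∣ 2048) (hk : k ∈ Finset.Icc 1 M) :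
    (∃ l ∈ Finset.Icc 1 2048, rho l M = k ∧ x % 65537 ∈ degSet l) ↔
      (x : ZMod 65537) ^ (65536 / M) = 3 ^ (65536 / M * (k - 1)) := by
  have hk' := Finset.mem_Icc.1 hk
  obtain ⟨K, hK⟩ := hM
  have hM0 : 0 < M := by omega
  have hdiv : 65536 / M = 32 * K := by
    rw [show 65536 = M * (32 * K) by linarith, Nat.mul_div_cancel_left _ hM0]
  have hK0 : 0 < K := by
    rcases Nat.eq_zero_or_pos K with h | h
    · simp [h] at hK
    · exact h
  have hdvd : ∀ l, 1 ≤ l → (32 * K * (l - 1) ≡ 32 * K * (k - 1) [MOD 65536] ↔ l ≡ k [MOD M]) := by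
    intro l hl
    rw [show 65536 = 32 * K * M by linarith]
    rw [Nat.ModEq.mul_left_cancel_iff' (by omega)]
    obtain ⟨l, rfl⟩ := Nat.exists_eq_add_of_le' hl
    obtain ⟨k, rfl⟩ := Nat.exists_eq_add_of_le' hk'.1
    simp only [Nat.add_sub_cancel]
    exact ⟨fun h => h.add_right 1, fun h => Nat.ModEq.add_right_cancel' 1 h⟩
  rw [hdiv]
  constructor
  · rintro ⟨l, hl, hr, hx⟩
    rw [mem_degSet_iff hl (Nat.mod_lt _ (by norm_num)), ZMod.natCast_mod] at hx
    rw [rho_eq_iff hk] at hr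
    rw [pow_mul, hx, ← pow_mul, three_pow_eq_iff, mul_right_comm]
    exact (hdvd l (Finset.mem_Icc.1 hl).1).2 hr
  · intro h
    have h0 : (x : ZMod 65537) ≠ 0 := by
      intro h0
      rw [h0, zero_pow (by omega)] at h
      exact pow_ne_zero _ three_ne_zero' h.symm
    obtain ⟨l, hl, i, hi, h1⟩ := exists_class h0
    refine ⟨l + 1, Finset.mem_Icc.2 ⟨by omega, by omega⟩, ?_, ?_⟩
    · rw [rho_eq_iff hk, ← hdvd _ (by omega), ← three_pow_eq_iff, ← h, h1,
        Nat.add_sub_cancel, mul_pow, ← pow_mul 2, show i * (32 * K) = 32 * (i * K) by ring,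
        pow_mul 2, two_pow_thirtytwo, one_pow, mul_one, ← pow_mul, mul_comm l]
    · rw [mem_degSet_iff_exists (Nat.mod_lt _ (by norm_num)), ZMod.natCast_mod]
      exact ⟨i, hi, by rw [h1, Nat.add_sub_cancel]⟩

theorem existsUnique_mem_degSet {d : ℕ} (hd : d ∈ Finset.Icc 1 65536) :
    ∃! k : ℕ, k ∈ Finset.Icc 1 2048 ∧ d ∈ degSet k := by
  rw [Finset.mem_Icc] at hd
  have hlt : d < 65537 := by omega
  have h0 : (d : ZMod 65537) ≠ 0 := by
    intro h
    have := eq_of_natCast_eq hlt (by norm_num) (h.trans Nat.cast_zero.symm)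
    omega
  obtain ⟨l, hl, i, hi, h1⟩ := exists_class h0
  refine ⟨l + 1, ⟨Finset.mem_Icc.2 ⟨by omega, by omega⟩, ?_⟩, ?_⟩
  · rw [mem_degSet_iff_exists hlt]
    exact ⟨i, hi, by rw [h1, Nat.add_sub_cancel]⟩
  · rintro k ⟨hk, hdk⟩
    rw [mem_degSet_iff hk hlt, h1, mul_pow, ← pow_mul 2, mul_comm i, pow_mul 2, two_pow_thirtytwo,
      one_pow, mul_one, ← pow_mul, three_pow_eq_iff, Nat.ModEq] at hdk
    rw [Finset.mem_Icc] at hk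
    omega

/-! ### Periods and their products -/

theorem sum_Icc_one {A : Type*} [AddCommMonoid A] (f : ℕ → A) (n : ℕ) :
    ∑ i ∈ Finset.Icc 1 n, f i = ∑ i ∈ Finset.range n, f (i + 1) := by
  induction n with
  | zero => rfl
  | succ n ih => rw [Finset.sum_Icc_succ_top (by omega), ih, Finset.sum_range_succ]

theorem sum_range_mul {A : Type*} [AddCommMonoid A] (f : ℕ → A) (M K : ℕ) :
    ∑ i ∈ Finset.range (M * K), f i =
      ∑ s ∈ Finset.range K, ∑ k ∈ Finset.range M, f (k + s * M) := by
  induction K with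
  | zero => simp
  | succ K ih =>
    rw [Finset.sum_range_succ, ← ih, Nat.mul_succ, Finset.sum_range_add]
    congr 1
    exact Finset.sum_congr rfl fun k _ => by congr 1; ring

/-- The sum of a function with period `K` over a full period does not depend on where it begins. -/
theorem sum_range_shift {A : Type*} [AddCommMonoid A] {f : ℕ → A} {K : ℕ}
    (hf : ∀ i, f (i + K) = f i) (a : ℕ) :
    ∑ i ∈ Finset.range K, f (i + a) = ∑ i ∈ Finset.range K, f i := by
  induction a with
  | zero => rfl
  | succ a ih =>
    rw [← ih]
    cases K with
    | zero => simp
    | succ K =>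
      rw [Finset.sum_range_succ, Finset.sum_range_succ']
      congr 1
      · exact Finset.sum_congr rfl fun i _ => by congr 1; ring
      · rw [← hf (0 + a)]; congr 1; ring

/-- The additive character `x ↦ z ^ x` of the integers modulo `65537`. -/
@[irreducible]
noncomputable def psi (x : ZMod 65537) : ℂ := ZMod.stdAddChar x

theorem psi_add (x y : ZMod 65537) : psi (x + y) = psi x * psi y := by
  unfold psi; exact AddChar.map_add_eq_mul _ _ _

theorem psi_zero : psi 0 = 1 := by
  unfold psi; exact AddChar.map_zero_eq_one _

theorem psi_natCast (k : ℕ) : psi k = Complex.exp (2 * Real.pi * Complex.I * k / 65537) := by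
  have := ZMod.stdAddChar_coe (N := 65537) k
  push_cast at this
  unfold psi
  exact this

theorem psi_natCast_eq_pow (k : ℕ) : psi k = z ^ k := by
  rw [psi_natCast, z, ← Complex.exp_nat_mul]
  congr 1
  ring

theorem ofReal_p (k : ℕ) : ((p k : ℝ) : ℂ) = psi k + psi (-k) := by
  have h : psi (-(k : ZMod 65537)) = Complex.exp (-(2 * Real.pi * Complex.I * k / 65537)) := by
    have h1 : psi k * psi (-(k : ZMod 65537)) = 1 := by rw [← psi_add, add_neg_cancel, psi_zero]
    rw [psi_natCast] at h1
    rw [Complex.exp_neg]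
    exact eq_inv_of_mul_eq_one_right h1
  rw [h, psi_natCast, p]
  push_cast
  rw [Complex.two_cos]
  congr 2 <;> ring

theorem ofReal_p_eq (k : ℕ) (hk : k ∈ Finset.Icc 1 65536) :
    ((p k : ℝ) : ℂ) = z ^ k + z ^ (65537 - k) := by
  rw [Finset.mem_Icc] at hk
  rw [ofReal_p, ← psi_natCast_eq_pow, ← psi_natCast_eq_pow]
  congr 2
  rw [Nat.cast_sub (by omega), ZMod.natCast_self, zero_sub]

theorem ofReal_p_pairNo (k i : ℕ) : ((p (pairNo k i) : ℝ) : ℂ) =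
    psi (3 ^ (k - 1) * 2 ^ (i - 1)) + psi (-(3 ^ (k - 1) * 2 ^ (i - 1))) := by
  rw [ofReal_p, ← natCast_deg, pairNo]
  rcases min_choice (deg k i) (65537 - deg k i) with h | h
  · rw [h]
  · rw [h, Nat.cast_sub (deg_lt k i).le, ZMod.natCast_self, zero_sub, neg_neg, add_comm]

/-- The period of the subgroup generated by `2 ^ M`, for `M ∣ 32`: the sum of `z ^ y` over `y` in the
coset of `x`. For `x = 0` the sum consists of `32 / M` terms `1`. -/
noncomputable def eta (M : ℕ) (x : ZMod 65537) : ℂ :=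
  ∑ i ∈ Finset.range (32 / M), psi (x * 2 ^ (M * i))

theorem eta_zero (M : ℕ) : eta M 0 = (32 / M : ℕ) := by
  simp [eta, psi_zero]

theorem psi_term_periodic {M : ℕ} (hM : M ∣ 32) (x y : ZMod 65537) (i : ℕ) :
    psi (y + x * 2 ^ (M * (i + 32 / M))) = psi (y + x * 2 ^ (M * i)) := by
  rw [mul_add, Nat.mul_div_cancel' hM, pow_add, two_pow_thirtytwo, mul_one]

theorem eta_mul_two_pow {M : ℕ} (hM : M ∣ 32) (x : ZMod 65537) (a : ℕ) :
    eta M (x * 2 ^ (M * a)) = eta M x := by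
  have := sum_range_shift (f := fun i => psi (0 + x * 2 ^ (M * i))) (psi_term_periodic hM x 0) a
  simp only [zero_add] at this
  rw [eta, eta, ← this]
  refine Finset.sum_congr rfl fun i _ => ?_
  rw [mul_assoc, ← pow_add, ← mul_add, add_comm a]

/-- The product of two periods is a sum of periods. -/
theorem eta_mul_eta {M : ℕ} (hM : M ∣ 32) (x y : ZMod 65537) :
    eta M x * eta M y = ∑ i ∈ Finset.range (32 / M), eta M (x + y * 2 ^ (M * i)) := by
  have key : ∀ a, psi (x * 2 ^ (M * a)) * eta M y =
      ∑ i ∈ Finset.range (32 / M), psi ((x + y * 2 ^ (M * i)) * 2 ^ (M * a)) := by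
    intro a
    have h1 : psi (x * 2 ^ (M * a)) * eta M y =
        ∑ i ∈ Finset.range (32 / M), psi (x * 2 ^ (M * a) + y * 2 ^ (M * i)) := by
      rw [eta, Finset.mul_sum]
      exact Finset.sum_congr rfl fun i _ => (psi_add _ _).symm
    rw [h1, ← sum_range_shift (f := fun i => psi (x * 2 ^ (M * a) + y * 2 ^ (M * i)))
      (psi_term_periodic hM y _) a]
    refine Finset.sum_congr rfl fun i _ => ?_
    rw [add_mul, mul_assoc y, ← pow_add, ← mul_add]
  calc eta M x * eta M y = ∑ a ∈ Finset.range (32 / M), psi (x * 2 ^ (M * a)) * eta M y := by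
        rw [← Finset.sum_mul]; rfl
    _ = ∑ a ∈ Finset.range (32 / M), ∑ i ∈ Finset.range (32 / M),
          psi ((x + y * 2 ^ (M * i)) * 2 ^ (M * a)) := Finset.sum_congr rfl fun a _ => key a
    _ = _ := Finset.sum_comm

theorem pos_of_dvd_thirtytwo {M : ℕ} (hM : M ∣ 32) : 0 < M := Nat.pos_of_dvd_of_pos hM (by norm_num)

theorem eta_split {M : ℕ} (hM : 2 * M ∣ 32) (x : ZMod 65537) :
    eta (2 * M) x + eta (2 * M) (x * 2 ^ M) = eta M x := by
  have hM0 := pos_of_dvd_thirtytwo hM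
  obtain ⟨K, hK⟩ := hM
  have h1 : 32 / (2 * M) = K := by rw [hK]; exact Nat.mul_div_cancel_left _ (by omega)
  have h2 : 32 / M = 2 * K := by
    rw [hK, show 2 * M * K = M * (2 * K) by ring]; exact Nat.mul_div_cancel_left _ (by omega)
  simp only [eta, h1, h2]
  rw [sum_range_mul, ← Finset.sum_add_distrib]
  refine Finset.sum_congr rfl fun s _ => ?_
  rw [Finset.sum_range_succ, Finset.sum_range_one, mul_assoc x, ← pow_add]
  congr 3
  · congr 1; ring
  · congr 1; ring

/-- The product of the two halves of a period: `A B = ((A + B) ^ 2 - (A ^ 2 + B ^ 2)) / 2`, where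
`A ^ 2 + B ^ 2` is a sum of periods of `A + B`. -/
theorem eta_half_mul {M : ℕ} (hM : 2 * M ∣ 32) (x : ZMod 65537) :
    eta (2 * M) x * eta (2 * M) (x * 2 ^ M) =
      (eta M x ^ 2 - ∑ i ∈ Finset.range (32 / (2 * M)), eta M (x * (1 + 2 ^ (2 * M * i)))) / 2 := by
  have h1 := eta_mul_eta hM x x
  have h2 := eta_mul_eta hM (x * 2 ^ M) (x * 2 ^ M)
  have h3 : ∑ i ∈ Finset.range (32 / (2 * M)), eta M (x * (1 + 2 ^ (2 * M * i))) =
      ∑ i ∈ Finset.range (32 / (2 * M)), eta (2 * M) (x + x * 2 ^ (2 * M * i)) +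
      ∑ i ∈ Finset.range (32 / (2 * M)),
        eta (2 * M) (x * 2 ^ M + x * 2 ^ M * 2 ^ (2 * M * i)) := by
    rw [← Finset.sum_add_distrib]
    refine Finset.sum_congr rfl fun i _ => ?_
    rw [← eta_split hM]
    congr 2 <;> ring
  rw [h3, ← h1, ← h2, ← eta_split hM]
  ring

/-- The sums `G_k(j, M)` are periods. -/
theorem ofReal_Gpart {M : ℕ} (hM : M ∣ 16) (k j : ℕ) (hj : 1 ≤ j) :
    ((Gpart k j M : ℝ) : ℂ) = eta M (3 ^ (k - 1) * 2 ^ (j - 1)) := by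
  have hM0 : 0 < M := Nat.pos_of_dvd_of_pos hM (by norm_num)
  have hd : 32 / M = 16 / M + 16 / M := by
    obtain ⟨K, hK⟩ := hM
    rw [show 32 = M * (2 * K) by linarith, hK, Nat.mul_div_cancel_left _ hM0,
      Nat.mul_div_cancel_left _ hM0]
    ring
  rw [Gpart, eta, hd, Finset.sum_range_add, ← Finset.sum_add_distrib, Complex.ofReal_sum]
  refine Finset.sum_congr rfl fun t _ => ?_
  rw [ofReal_p_pairNo, mul_assoc, ← pow_add, mul_add M, Nat.mul_div_cancel' hM, pow_add 2 16,
    two_pow_sixteen, show j + t * M - 1 = j - 1 + M * t by rw [mul_comm t]; omega]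
  congr 2
  ring

theorem G_eq_Gpart (k : ℕ) : G k = Gpart k 1 1 := by
  rw [G, Gpart, Nat.div_one, sum_Icc_one]
  exact Finset.sum_congr rfl fun i _ => by rw [mul_one, add_comm]

theorem ofReal_G (k : ℕ) : ((G k : ℝ) : ℂ) = eta 1 (3 ^ (k - 1)) := by
  rw [G_eq_Gpart, ofReal_Gpart (by norm_num) k 1 le_rfl]
  simp

theorem ofReal_G_succ (a : ℕ) : ((G (a + 1) : ℝ) : ℂ) = eta 1 (3 ^ a) := ofReal_G (a + 1)

theorem eta_one_mul_two_pow (x : ZMod 65537) (a : ℕ) : eta 1 (x * 2 ^ a) = eta 1 x := by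
  simpa using eta_mul_two_pow (M := 1) (by norm_num) x a

theorem G_periodic (a : ℕ) : G (a + 2048 + 1) = G (a + 1) := by
  have : ((G (a + 2048 + 1) : ℝ) : ℂ) = (G (a + 1) : ℝ) := by
    rw [ofReal_G_succ, ofReal_G_succ, pow_add, three_pow_2048, eta_one_mul_two_pow]
  exact_mod_cast this

theorem ofReal_G_eq_sum (k : ℕ) : ((G k : ℝ) : ℂ) = ∑ d ∈ degSet k, z ^ d := by
  rw [degSet, Finset.sum_image (deg_injOn k), ofReal_G, eta, Nat.div_one, sum_Icc_one]
  refine Finset.sum_congr rfl fun i _ => ?_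
  rw [← psi_natCast_eq_pow, natCast_deg, one_mul, Nat.add_sub_cancel]

theorem z_pow_eq_one : z ^ 65537 = 1 := by
  rw [← psi_natCast_eq_pow, ZMod.natCast_self, psi_zero]

theorem F_level_top (j : ℕ) : F j 2048 = G j := by
  simp [F]

theorem F_one_eq_sum : ((F 1 1 : ℝ) : ℂ) = ∑ k ∈ Finset.Icc (1 : ℕ) 65536, z ^ k := by
  have hU : Finset.Icc 1 65536 = (Finset.Icc 1 2048).biUnion degSet := by
    ext d
    rw [Finset.mem_biUnion]
    constructor
    · intro hd
      obtain ⟨k, hk, -⟩ := existsUnique_mem_degSet hd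
      exact ⟨k, hk⟩
    · rintro ⟨k, -, hd⟩
      rw [degSet, Finset.mem_image] at hd
      obtain ⟨i, -, rfl⟩ := hd
      have h1 := deg_lt k i
      have h2 := deg_pos k i
      rw [Finset.mem_Icc]
      omega
  have hsub : ∀ k, ∀ d ∈ degSet k, d ∈ Finset.Icc 1 65536 := by
    intro k d hd
    rw [degSet, Finset.mem_image] at hd
    obtain ⟨i, -, rfl⟩ := hd
    have h1 := deg_lt k i
    have h2 := deg_pos k i
    rw [Finset.mem_Icc]
    omega
  rw [hU, Finset.sum_biUnion]
  · rw [F, Nat.div_one, Complex.ofReal_sum]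
    rw [sum_Icc_one]
    refine Finset.sum_congr rfl fun i _ => ?_
    rw [mul_one, add_comm, ofReal_G_eq_sum]
  · intro k hk l hl hkl
    rw [Function.onFun, Finset.disjoint_left]
    intro d hd hd'
    exact hkl ((existsUnique_mem_degSet (hsub k d hd)).unique ⟨hk, hd⟩ ⟨hl, hd'⟩)

theorem F_one : F 1 1 = -1 := by
  have hz : z ≠ 1 := by
    intro h
    have h1 : Function.Injective (ZMod.stdAddChar (N := 65537)) := ZMod.injective_stdAddChar
    have h2 : psi ((1 : ℕ) : ZMod 65537) = psi 0 := by
      rw [psi_natCast_eq_pow, psi_zero, pow_one, h]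
    have h3 : ((1 : ℕ) : ZMod 65537) = 0 := by
      unfold psi at h2; exact h1 h2
    simp at h3
  have h := geom_sum_eq hz 65537
  rw [z_pow_eq_one, sub_self, zero_div, Finset.sum_range_eq_add_Ico _ (by norm_num), pow_zero] at h
  have h4 : ((F 1 1 : ℝ) : ℂ) = (-1 : ℝ) := by
    rw [F_one_eq_sum]
    have : Finset.Icc 1 65536 = Finset.Ico 1 65537 := by ext; simp [Nat.lt_succ_iff]
    rw [this]
    push_cast
    linear_combination h
  exact_mod_cast h4

/-! ### Sums and products of the values `F(j, M)` -/

theorem sum_range_shift_mul {A : Type*} [AddCommMonoid A] {f : ℕ → A} {K D : ℕ}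
    (hf : ∀ x, f (x + K * D) = f x) (b m : ℕ) :
    ∑ t ∈ Finset.range K, f (b + m * D + t * D) = ∑ t ∈ Finset.range K, f (b + t * D) := by
  rw [← sum_range_shift (f := fun t => f (b + t * D)) (K := K) _ m]
  · refine Finset.sum_congr rfl fun t _ => ?_
    congr 1; ring
  · intro i
    rw [← hf (b + i * D)]
    congr 1; ring

theorem rho_succ (b : ℕ) {M : ℕ} (hM : 0 < M) : rho (b + 1) M = b % M + 1 := by
  have h := Nat.mod_lt b hM
  rw [rho_eq_iff (Finset.mem_Icc.2 ⟨by omega, by omega⟩)]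
  exact (Nat.mod_modEq b M).symm.add_right 1

theorem pos_of_dvd_2048 {M : ℕ} (hM : M ∣ 2048) : 0 < M := Nat.pos_of_dvd_of_pos hM (by norm_num)

theorem F_eq_sum {M : ℕ} (hM : M ∣ 2048) (b : ℕ) :
    ∑ s ∈ Finset.range (2048 / M), G (b + s * M + 1) = F (rho (b + 1) M) M := by
  have hf : ∀ x, G (x + 2048 / M * M + 1) = G (x + 1) := by
    intro x
    rw [Nat.div_mul_cancel hM, G_periodic]
  rw [rho_succ b (pos_of_dvd_2048 hM), F]
  have := sum_range_shift_mul (f := fun x => G (x + 1)) hf (b % M) (b / M)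
  rw [show b % M + b / M * M = b by rw [mul_comm]; exact Nat.mod_add_div b M] at this
  rw [this]
  refine Finset.sum_congr rfl fun s _ => ?_
  congr 1
  ring

theorem F_add_F {M : ℕ} (hM : 2 * M ∣ 2048) (j : ℕ) :
    F j (2 * M) + F (j + M) (2 * M) = F j M := by
  have hM0 := pos_of_dvd_2048 hM
  obtain ⟨K, hK⟩ := hM
  have h1 : 2048 / (2 * M) = K := by rw [hK]; exact Nat.mul_div_cancel_left _ (by omega)
  have h2 : 2048 / M = 2 * K := by
    rw [hK, show 2 * M * K = M * (2 * K) by ring]; exact Nat.mul_div_cancel_left _ (by omega)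
  simp only [F, h1, h2]
  rw [sum_range_mul, ← Finset.sum_add_distrib]
  refine Finset.sum_congr rfl fun s _ => ?_
  rw [Finset.sum_range_succ, Finset.sum_range_one]
  congr 2 <;> ring

/-- The sum of all `F(k, M)` is `F(1, 1)`. -/
theorem sum_F {M : ℕ} (hM : M ∣ 2048) (j : ℕ) (hj : 1 ≤ j) :
    ∑ k ∈ Finset.Icc 1 M, F (rho (k + j - 1) M) M = -1 := by
  have h1 : ∑ k ∈ Finset.Icc 1 M, F (rho (k + j - 1) M) M =
      ∑ k ∈ Finset.range M, F (rho (k + (j - 1) + 1) M) M := by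
    rw [sum_Icc_one]
    refine Finset.sum_congr rfl fun k _ => ?_
    congr 2
    omega
  rw [h1]
  simp only [← F_eq_sum hM]
  have h2 := F_eq_sum (M := 1) (one_dvd _) (j - 1)
  rw [show rho (j - 1 + 1) 1 = 1 by simp [rho], F_one, Nat.div_one,
    ← Nat.mul_div_cancel' hM, sum_range_mul] at h2
  rw [Finset.sum_comm, ← h2]
  refine Finset.sum_congr rfl fun s _ => Finset.sum_congr rfl fun k _ => ?_
  congr 1
  ring

/-- The index `lam x` of the coset of a nonzero residue `x`, counted from `0`. -/
theorem exists_class_index : ∃ lam : ℕ → ℕ, ∀ x : ℕ, (x : ZMod 65537) ≠ 0 →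
    x % 65537 ∈ degSet (lam x + 1) ∧ lam x < 2048 ∧
      ∀ y : ZMod 65537, eta 1 (y * x) = eta 1 (y * 3 ^ lam x) := by
  have : ∀ x : ℕ, ∃ l, (x : ZMod 65537) ≠ 0 → x % 65537 ∈ degSet (l + 1) ∧ l < 2048 ∧
      ∀ y : ZMod 65537, eta 1 (y * x) = eta 1 (y * 3 ^ l) := by
    intro x
    by_cases hx : (x : ZMod 65537) = 0
    · exact ⟨0, fun h => absurd hx h⟩
    · obtain ⟨l, hl, i, hi, h⟩ := exists_class hx
      refine ⟨l, fun _ => ⟨?_, hl, fun y => ?_⟩⟩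
      · rw [mem_degSet_iff_exists (Nat.mod_lt _ (by norm_num)), ZMod.natCast_mod]
        exact ⟨i, hi, h⟩
      · rw [h, ← mul_assoc, eta_one_mul_two_pow]
  choose lam h using this
  exact ⟨lam, h⟩

/-- The sum of the products `G_a G_{a+q}` over the `a` congruent to `j` modulo `M`. The product
`G_1 G_{q+1}` is the sum of the invariant sets which contain the degrees `1 + d`, and `G_a G_{a+q}`
results from it by a translation of all indices. -/
theorem sum_G_mul_G {M : ℕ} (hM : M ∣ 2048) {j q : ℕ} (hj : 1 ≤ j) (hq : 1 ≤ q) (hq' : q < 2048) :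
    ∑ s ∈ Finset.range (2048 / M), G (j - 1 + s * M + 1) * G (j - 1 + s * M + q + 1) =
      ∑ k ∈ Finset.Icc 1 M, (prodCount (q + 1) k M : ℝ) * F (rho (k + j - 1) M) M := by
  obtain ⟨lam, hlam⟩ := exists_class_index
  have hM0 := pos_of_dvd_2048 hM
  have hne : ∀ d ∈ degSet (q + 1), ((1 + d : ℕ) : ZMod 65537) ≠ 0 := by
    intro d hd h
    have hlt : d < 65537 := by
      rw [degSet, Finset.mem_image] at hd
      obtain ⟨i, -, rfl⟩ := hd
      exact deg_lt _ _
    rw [mem_degSet_iff (Finset.mem_Icc.2 ⟨by omega, by omega⟩) hlt] at hd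
    push_cast at h
    rw [eq_neg_of_add_eq_zero_right h, Nat.add_sub_cancel, ← pow_zero 3] at hd
    have h2 : (3 : ZMod 65537) ^ 0 = 3 ^ (32 * q) := by rw [← hd]; ring
    rw [three_pow_eq_iff, Nat.ModEq] at h2
    omega
  have hprod : ∀ a, G (a + 1) * G (a + q + 1) = ∑ d ∈ degSet (q + 1), G (a + lam (1 + d) + 1) := by
    intro a
    have : ((G (a + 1) * G (a + q + 1) : ℝ) : ℂ) =
        (∑ d ∈ degSet (q + 1), G (a + lam (1 + d) + 1) : ℝ) := by
      push_cast
      rw [ofReal_G_succ, ofReal_G_succ, eta_mul_eta (by norm_num), degSet,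
        Finset.sum_image (deg_injOn _), sum_Icc_one]
      refine Finset.sum_congr rfl fun i hi => ?_
      have hi' : i + 1 ∈ Finset.Icc 1 32 :=
        Finset.mem_Icc.2 ⟨by omega, by have := Finset.mem_range.1 hi; omega⟩
      rw [ofReal_G_succ, pow_add 3 a (lam _), ← (hlam _ (hne _ (Finset.mem_image_of_mem _ hi'))).2.2]
      push_cast
      rw [natCast_deg, Nat.add_sub_cancel, Nat.add_sub_cancel, one_mul]
      congr 1
      ring
    exact_mod_cast this
  have hcount : ∀ k ∈ Finset.Icc 1 M, (prodCount (q + 1) k M : ℝ) =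
      ∑ d ∈ degSet (q + 1), if rho (lam (1 + d) + 1) M = k then 1 else 0 := by
    intro k hk
    rw [prodCount, Finset.card_filter]
    push_cast
    refine Finset.sum_congr rfl fun d hd => ?_
    obtain ⟨h1, h2, -⟩ := hlam _ (hne d hd)
    refine if_congr ⟨?_, fun h => ⟨_, Finset.mem_Icc.2 ⟨by omega, by omega⟩, h, h1⟩⟩ rfl rfl
    rintro ⟨l, hl, hr, hmem⟩
    have hx : (1 + d) % 65537 ∈ Finset.Icc 1 65536 := by
      have h3 : (1 + d) % 65537 ≠ 0 := by
        intro h3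
        have := hne d hd
        rw [← ZMod.natCast_mod, h3, Nat.cast_zero] at this
        exact this rfl
      rw [Finset.mem_Icc]; omega
    rw [← (existsUnique_mem_degSet hx).unique ⟨hl, hmem⟩
      ⟨Finset.mem_Icc.2 ⟨by omega, by omega⟩, h1⟩]
    exact hr
  have hF : ∀ d, F (rho (rho (lam (1 + d) + 1) M + j - 1) M) M =
      ∑ s ∈ Finset.range (2048 / M), G (j - 1 + s * M + lam (1 + d) + 1) := by
    intro d
    have h4 : rho (rho (lam (1 + d) + 1) M + j - 1) M = rho (j - 1 + lam (1 + d) + 1) M := by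
      rw [rho_eq_iff (rho_mem _ hM0)]
      refine Nat.ModEq.trans ?_ (rho_modEq _ _).symm
      rw [Nat.add_sub_assoc hj, show j - 1 + lam (1 + d) + 1 = lam (1 + d) + 1 + (j - 1) by ring]
      exact (rho_modEq _ _).add_right _
    rw [h4, ← F_eq_sum hM (j - 1 + lam (1 + d))]
    refine Finset.sum_congr rfl fun s _ => ?_
    rw [show j - 1 + lam (1 + d) + s * M = j - 1 + s * M + lam (1 + d) by ring]
  calc ∑ s ∈ Finset.range (2048 / M), G (j - 1 + s * M + 1) * G (j - 1 + s * M + q + 1)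
      = ∑ s ∈ Finset.range (2048 / M), ∑ d ∈ degSet (q + 1),
          G (j - 1 + s * M + lam (1 + d) + 1) := Finset.sum_congr rfl fun s _ => hprod _
    _ = ∑ d ∈ degSet (q + 1), F (rho (rho (lam (1 + d) + 1) M + j - 1) M) M := by
        rw [Finset.sum_comm]
        exact Finset.sum_congr rfl fun d _ => (hF d).symm
    _ = ∑ d ∈ degSet (q + 1), ∑ k ∈ Finset.Icc 1 M,
          (if rho (lam (1 + d) + 1) M = k then 1 else 0) * F (rho (k + j - 1) M) M := by
        refine Finset.sum_congr rfl fun d _ => ?_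
        simp only [ite_mul, one_mul, zero_mul]
        rw [Finset.sum_ite_eq, if_pos (rho_mem _ hM0)]
    _ = _ := by
        rw [Finset.sum_comm]
        refine Finset.sum_congr rfl fun k hk => ?_
        rw [hcount k hk, Finset.sum_mul]

/-- The product of the sums of a function of period `N = 4 K M` over the classes of `b` and of `b + M`
modulo `2 M`. The products `g a * g (a + q)` with `q` an odd multiple of `M` are grouped in pairs
`q`, `N - q`; then `a` runs through a full residue class modulo `M`. -/
theorem sum_mul_sum_of_periodic {g : ℕ → ℝ} {K M N : ℕ} (hN : (K + K) * (2 * M) = N)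
    (hg : ∀ x, g (x + N) = g x) (b : ℕ) :
    (∑ s ∈ Finset.range (K + K), g (b + s * (2 * M))) *
        ∑ t ∈ Finset.range (K + K), g (b + M + t * (2 * M)) =
      ∑ t ∈ Finset.range K, ∑ s ∈ Finset.range (2 * (K + K)),
        g (b + s * M) * g (b + s * M + (M + t * (2 * M))) := by
  set P : ℕ → ℕ → ℝ := fun a q => g a * g (a + q) with hP
  have hPper : ∀ q x, P (x + (K + K) * (2 * M)) q = P x q := by
    intro q x
    simp only [hP]
    rw [hN, hg, show x + N + q = x + q + N by ring, hg]
  have hL : (∑ s ∈ Finset.range (K + K), g (b + s * (2 * M))) *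
        ∑ t ∈ Finset.range (K + K), g (b + M + t * (2 * M)) = ∑ t ∈ Finset.range (K + K),
      ∑ s ∈ Finset.range (K + K), P (b + s * (2 * M)) (M + t * (2 * M)) := by
    rw [Finset.sum_mul, Finset.sum_comm]
    refine Finset.sum_congr rfl fun s _ => ?_
    simp only [hP]
    rw [← Finset.mul_sum, ← sum_range_shift_mul (f := g) (K := K + K) (D := 2 * M)
      (by intro x; rw [hN, hg]) (b + M) s]
    congr 1
    refine Finset.sum_congr rfl fun t _ => ?_
    congr 1
    ring
  -- the offset `N - q`
  have hrefl : ∀ t < K, ∑ s ∈ Finset.range (K + K),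
      P (b + s * (2 * M)) (M + (K + K - 1 - t) * (2 * M)) =
      ∑ s ∈ Finset.range (K + K), P (b + M + s * (2 * M)) (M + t * (2 * M)) := by
    intro t ht
    obtain ⟨u, hu⟩ : ∃ u, K + K = u + 1 + t := ⟨K + K - 1 - t, by omega⟩
    rw [show K + K - 1 - t = u by omega]
    have h1 : ∀ a, P a (M + u * (2 * M)) = P (a + M + u * (2 * M)) (M + t * (2 * M)) := by
      intro a
      have h3 : g a = g (a + M + u * (2 * M) + (M + t * (2 * M))) := by
        rw [← hg a, ← hN, hu]
        congr 1
        ring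
      simp only [hP]
      rw [← h3, mul_comm, add_assoc]
    rw [← sum_range_shift_mul (f := fun x => P x (M + t * (2 * M))) (K := K + K)
      (D := 2 * M) (hPper _) (b + M) u]
    refine Finset.sum_congr rfl fun s _ => ?_
    rw [h1]
    congr 1
    ring
  have h5 : ∑ t ∈ Finset.range K, ∑ s ∈ Finset.range (K + K),
        P (b + s * (2 * M)) (M + (K + t) * (2 * M)) =
      ∑ t ∈ Finset.range K, ∑ s ∈ Finset.range (K + K),
        P (b + M + s * (2 * M)) (M + t * (2 * M)) := by
    rw [← Finset.sum_range_reflect]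
    refine Finset.sum_congr rfl fun t ht => ?_
    rw [Finset.mem_range] at ht
    rw [← hrefl t ht, show K + (K - 1 - t) = K + K - 1 - t by omega]
  rw [hL, Finset.sum_range_add, h5, ← Finset.sum_add_distrib]
  refine Finset.sum_congr rfl fun t _ => ?_
  rw [sum_range_mul, ← Finset.sum_add_distrib]
  refine Finset.sum_congr rfl fun s _ => ?_
  rw [Finset.sum_range_succ, Finset.sum_range_one]
  simp only [hP]
  rw [show b + s * (2 * M) = b + (0 + s * 2) * M by ring,
    show b + M + s * (2 * M) = b + (1 + s * 2) * M by ring]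

/-- The product of the two parts of `F(j, M)` is a sum of values `F(k, M)`. -/
theorem F_mul_F {M : ℕ} (hM : M ∣ 512) {j : ℕ} (hj : 1 ≤ j) :
    F j (2 * M) * F (j + M) (2 * M) =
      ∑ k ∈ Finset.Icc 1 M, (mu k M : ℝ) * F (rho (k + j - 1) M) M := by
  obtain ⟨K, hK⟩ := hM
  have hM0 : 0 < M := by
    rcases Nat.eq_zero_or_pos M with h | h
    · simp [h] at hK
    · exact h
  have hK1 : 512 / M = K := by rw [hK]; exact Nat.mul_div_cancel_left _ hM0
  have hK2 : 2048 / (2 * M) = K + K := by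
    rw [show 2048 = 2 * M * (K + K) by linarith]; exact Nat.mul_div_cancel_left _ (by omega)
  have hK4 : 2048 / M = 2 * (K + K) := by
    rw [show 2048 = M * (2 * (K + K)) by linarith]; exact Nat.mul_div_cancel_left _ hM0
  have hR : ∀ t < K, ∑ s ∈ Finset.range (2 * (K + K)),
      G (j - 1 + s * M + 1) * G (j - 1 + s * M + (M + t * (2 * M)) + 1) =
      ∑ k ∈ Finset.Icc 1 M, (prodCount (1 + M + t * (2 * M)) k M : ℝ) * F (rho (k + j - 1) M) M := by
    intro t ht
    have hq : M + t * (2 * M) < 2048 := by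
      have : t * (2 * M) ≤ (K - 1) * (2 * M) := Nat.mul_le_mul_right _ (by omega)
      have h3 : (K - 1) * (2 * M) + 2 * M = K * (2 * M) := by
        rw [← Nat.succ_mul]; congr 1; omega
      have h4 : K * (2 * M) = 1024 := by linarith
      omega
    have h1 := sum_G_mul_G (M := M) (j := j) (q := M + t * (2 * M))
      ⟨2 * (K + K), by linarith⟩ hj (by omega) hq
    rw [show 1 + M + t * (2 * M) = M + t * (2 * M) + 1 by ring, ← h1, hK4]
  have hL := sum_mul_sum_of_periodic (g := fun x => G (x + 1)) (K := K) (M := M)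
    (show (K + K) * (2 * M) = 2048 by linarith) G_periodic (j - 1)
  have h1 : F j (2 * M) = ∑ s ∈ Finset.range (K + K), G (j - 1 + s * (2 * M) + 1) := by
    rw [F, hK2]
    refine Finset.sum_congr rfl fun s _ => ?_
    rw [show j + s * (2 * M) = j - 1 + s * (2 * M) + 1 by omega]
  have h2 : F (j + M) (2 * M) =
      ∑ s ∈ Finset.range (K + K), G (j - 1 + M + s * (2 * M) + 1) := by
    rw [F, hK2]
    refine Finset.sum_congr rfl fun s _ => ?_
    rw [show j + M + s * (2 * M) = j - 1 + M + s * (2 * M) + 1 by omega]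
  rw [h1, h2]
  refine hL.trans ?_
  calc _ = ∑ t ∈ Finset.range K, ∑ k ∈ Finset.Icc 1 M,
        (prodCount (1 + M + t * (2 * M)) k M : ℝ) * F (rho (k + j - 1) M) M :=
        Finset.sum_congr rfl fun t ht => hR t (Finset.mem_range.1 ht)
    _ = _ := by
        rw [Finset.sum_comm]
        refine Finset.sum_congr rfl fun k _ => ?_
        rw [mu, hK1, Nat.cast_sum, Finset.sum_mul]

theorem G_one_mul_G {q : ℕ} (hq : q ∈ Finset.Icc 2 2048) :
    G 1 * G q = ∑ k ∈ Finset.Icc (1 : ℕ) 2048, (prodCount q k 2048 : ℝ) * G k := by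
  rw [Finset.mem_Icc] at hq
  have h := sum_G_mul_G (M := 2048) dvd_rfl (j := 1) (q := q - 1) le_rfl (by omega) (by omega)
  rw [Nat.div_self (by norm_num), Finset.sum_range_one, Nat.sub_add_cancel (by omega : 1 ≤ q)] at h
  rw [show 1 - 1 + 0 * 2048 + 1 = 1 from rfl,
    show 1 - 1 + 0 * 2048 + (q - 1) + 1 = q by omega] at h
  rw [h]
  refine Finset.sum_congr rfl fun k hk => ?_
  rw [Nat.add_sub_cancel, rho_eq_self hk, F_level_top]

/-- The product of the two invariant sets into which `F(j, 1024)` is split, with twice its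
coefficients. -/
theorem two_mul_G_mul_G {j : ℕ} (hj : 1 ≤ j) :
    2 * (G j * G (j + 1024)) =
      ∑ k ∈ Finset.Icc (1 : ℕ) 1024, (prodCount 1025 k 1024 : ℝ) * F (rho (k + j - 1) 1024) 1024 := by
  have h := sum_G_mul_G (M := 1024) (by norm_num) (j := j) (q := 1024) hj (by norm_num) (by norm_num)
  rw [← h, show 2048 / 1024 = 2 from rfl, Finset.sum_range_succ, Finset.sum_range_one,
    show j - 1 + 0 * 1024 + 1 = j by omega, show j - 1 + 0 * 1024 + 1024 + 1 = j + 1024 by omega,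
    show j - 1 + 1 * 1024 + 1024 + 1 = j - 1 + 2048 + 1 by omega, G_periodic (j - 1),
    show j - 1 + 1 = j by omega]
  ring

/-! ### Evaluation of the coefficients `μ(k, M)` -/

/-- `eval n f` is `f n`. The kernel has to reduce the first argument to a numeral in order to reduce the
recursor, hence `n` is evaluated before it is handed over to `f`. -/
def eval {α : Type} (n : ℕ) (f : ℕ → α) : α :=
  Nat.rec (f 0) (fun k _ => f k) (Nat.add n 1)

theorem eval_eq {α : Type} (n : ℕ) (f : ℕ → α) : eval n f = f n := rfl

/-- The number of the `i < s` for which the power of `1 + 2 ^ i * d` with exponent `e₁ * e₂` is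
congruent to `w`. The two exponents are applied one after the other, with a reduction in between, to
keep the powers small. -/
def countRow (w e₁ e₂ s : ℕ) : ℕ → ℕ :=
  Nat.rec (fun _ => 0) (fun _ ih d =>
    Nat.add
      (cond (Nat.beq (Nat.mod (Nat.pow (Nat.mod (Nat.pow (Nat.add 1 d) e₁) 65537) e₂) 65537) w) 1 0)
      (eval (Nat.mod (Nat.mul 2 d) 65537) ih)) s

/-- The number `μ(k, M)`, where `e₁ * e₂ * M = 65536`, in a form suited to evaluation. -/
def muCount (M e₁ e₂ k : ℕ) : ℕ :=
  eval (3 ^ (e₁ * e₂ * (k - 1)) % 65537) fun w =>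
    Nat.rec 0 (fun t ih => Nat.add ih (eval (3 ^ (M + t * (2 * M)) % 65537) (countRow w e₁ e₂ 32)))
      (512 / M)

theorem countRow_eq (w e₁ e₂ s d : ℕ) (hd : d < 65537) : countRow w e₁ e₂ s d =
    ∑ i ∈ Finset.range s,
      if ((1 + d * 2 ^ i % 65537) ^ e₁ % 65537) ^ e₂ % 65537 = w then 1 else 0 := by
  induction s generalizing d with
  | zero => rfl
  | succ s ih =>
    have h : countRow w e₁ e₂ (s + 1) d =
      (cond (Nat.beq (((1 + d) ^ e₁ % 65537) ^ e₂ % 65537) w) 1 0) +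
        countRow w e₁ e₂ s (2 * d % 65537) := rfl
    rw [h, ih _ (Nat.mod_lt _ (by norm_num)), Finset.sum_range_succ', add_comm]
    congr 1
    · refine Finset.sum_congr rfl fun i _ => ?_
      rw [Nat.mod_mul_mod, pow_succ', show 2 * d * 2 ^ i = d * (2 * 2 ^ i) by ring]
    · rw [pow_zero, mul_one, Nat.mod_eq_of_lt hd]
      by_cases hw : ((1 + d) ^ e₁ % 65537) ^ e₂ % 65537 = w
      · rw [if_pos hw, Nat.beq_eq.mpr hw]; rfl
      · rw [if_neg hw, Bool.eq_false_iff.2 fun h => hw (Nat.beq_eq.mp h)]; rfl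

theorem prodCount_eq_countRow {M e₁ e₂ k : ℕ} (hM : M ∣ 2048) (he : e₁ * e₂ * M = 65536)
    (hk : k ∈ Finset.Icc 1 M) (q : ℕ) : prodCount (1 + q) k M =
      countRow (3 ^ (e₁ * e₂ * (k - 1)) % 65537) e₁ e₂ 32 (3 ^ q % 65537) := by
  have hdiv : 65536 / M = e₁ * e₂ := by
    rw [← he]; exact Nat.mul_div_cancel _ (pos_of_dvd_2048 hM)
  rw [countRow_eq _ _ _ _ _ (Nat.mod_lt _ (by norm_num)), prodCount, Finset.card_filter, degSet,
    Finset.sum_image (deg_injOn _), sum_Icc_one]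
  refine Finset.sum_congr rfl fun i _ => if_congr ?_ rfl rfl
  rw [exists_mem_degSet_iff hM hk, hdiv, Nat.mod_mul_mod, ← Nat.pow_mod, ← pow_mul,
    ← natCast_eq_iff, deg, Nat.add_sub_cancel_left, Nat.add_sub_cancel]
  push_cast
  rfl

theorem mu_eq_muCount {M e₁ e₂ k : ℕ} (hM : M ∣ 512) (he : e₁ * e₂ * M = 65536)
    (hk : k ∈ Finset.Icc 1 M) : mu k M = muCount M e₁ e₂ k := by
  have key : ∀ (w T : ℕ), (Nat.rec 0 (fun t ih => Nat.add ih
      (eval (3 ^ (M + t * (2 * M)) % 65537) (countRow w e₁ e₂ 32))) T : ℕ) =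
      ∑ t ∈ Finset.range T, countRow w e₁ e₂ 32 (3 ^ (M + t * (2 * M)) % 65537) := by
    intro w T
    induction T with
    | zero => rfl
    | succ T ih => rw [Finset.sum_range_succ, ← ih]; rfl
  rw [muCount, eval_eq, key, mu]
  refine Finset.sum_congr rfl fun t _ => ?_
  rw [add_assoc, prodCount_eq_countRow (hM.trans (by norm_num)) he hk]

/-- The coefficient `μ(k, M)` as it is given by the lists `K m` of the `k` with `μ(k, M) = m`. -/
def multiplicity (K : ℕ → List ℕ) (N k : ℕ) : ℕ := ∑ m ∈ Finset.Icc 1 N, m * (K m).count k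

theorem muCount_two : ∀ k ∈ Finset.Icc 1 2, muCount 2 256 128 k = 4096 := by decide +kernel

theorem muCount_four : ∀ k ∈ Finset.Icc 1 4,
    muCount 4 256 64 k = [992, 1040, 1024, 1040].getD (k - 1) 0 := by decide +kernel

theorem muCount_eight : ∀ k ∈ Finset.Icc 1 8, muCount 8 256 32 k =
    [284, 237, 272, 237, 256, 269, 256, 237].getD (k - 1) 0 := by decide +kernel

theorem muCount_sixteen : ∀ k ∈ Finset.Icc 1 16, muCount 16 256 16 k =
    [80, 62, 60, 64, 57, 60, 61, 60, 68, 64, 64, 58, 65, 70, 61, 70].getD (k - 1) 0 := by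
  decide +kernel

theorem muCount_thirtytwo : ∀ k ∈ Finset.Icc 1 32, muCount 32 256 8 k = mu32.getD (k - 1) 0 := by
  decide +kernel

theorem muCount_64 : ∀ k ∈ Finset.Icc 1 64, muCount 64 256 4 k = multiplicity K64 10 k := by
  decide +kernel

theorem muCount_128 : ∀ k ∈ Finset.Icc 1 128, muCount 128 256 2 k = multiplicity K128 5 k := by
  decide +kernel

theorem muCount_256 : ∀ k ∈ Finset.Icc 1 256, muCount 256 256 1 k = multiplicity K256 3 k := by
  decide +kernel

theorem muCount_512 : ∀ k ∈ Finset.Icc 1 512, muCount 512 128 1 k = multiplicity K512 2 k := by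
  decide +kernel

/-- The coefficients of the product of `G_1` and `G_1025` agree with those in `terms11`. Each term is
counted twice, as `G_j` and `G_{j+1024}` are interchanged by a translation. -/
theorem countRow_1025 : ∀ k ∈ Finset.Icc 1 1024,
    countRow (3 ^ (64 * 1 * (k - 1)) % 65537) 64 1 32 (3 ^ 1024 % 65537) =
      2 * (terms11.map fun t => if t.2 = k then t.1 else 0).sum := by
  decide +kernel

/-! ### The products in the steps with the values `F(j, M)` -/

theorem mu_two {k : ℕ} (hk : k ∈ Finset.Icc 1 2) : mu k 2 = 4096 :=
  (mu_eq_muCount (by norm_num) (by norm_num) hk).trans (muCount_two k hk)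

theorem mu_four {k : ℕ} (hk : k ∈ Finset.Icc 1 4) :
    mu k 4 = [992, 1040, 1024, 1040].getD (k - 1) 0 :=
  (mu_eq_muCount (by norm_num) (by norm_num) hk).trans (muCount_four k hk)

theorem mu_eight {k : ℕ} (hk : k ∈ Finset.Icc 1 8) :
    mu k 8 = [284, 237, 272, 237, 256, 269, 256, 237].getD (k - 1) 0 :=
  (mu_eq_muCount (by norm_num) (by norm_num) hk).trans (muCount_eight k hk)

theorem mu_sixteen {k : ℕ} (hk : k ∈ Finset.Icc 1 16) : mu k 16 =
    [80, 62, 60, 64, 57, 60, 61, 60, 68, 64, 64, 58, 65, 70, 61, 70].getD (k - 1) 0 :=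
  (mu_eq_muCount (by norm_num) (by norm_num) hk).trans (muCount_sixteen k hk)

theorem mu_thirtytwo {k : ℕ} (hk : k ∈ Finset.Icc 1 32) : mu k 32 = mu32.getD (k - 1) 0 :=
  (mu_eq_muCount (by norm_num) (by norm_num) hk).trans (muCount_thirtytwo k hk)

theorem mu_64 {k : ℕ} (hk : k ∈ Finset.Icc 1 64) : mu k 64 = multiplicity K64 10 k :=
  (mu_eq_muCount (by norm_num) (by norm_num) hk).trans (muCount_64 k hk)

theorem mu_128 {k : ℕ} (hk : k ∈ Finset.Icc 1 128) : mu k 128 = multiplicity K128 5 k :=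
  (mu_eq_muCount (by norm_num) (by norm_num) hk).trans (muCount_128 k hk)

theorem mu_256 {k : ℕ} (hk : k ∈ Finset.Icc 1 256) : mu k 256 = multiplicity K256 3 k :=
  (mu_eq_muCount (by norm_num) (by norm_num) hk).trans (muCount_256 k hk)

theorem mu_512 {k : ℕ} (hk : k ∈ Finset.Icc 1 512) : mu k 512 = multiplicity K512 2 k :=
  (mu_eq_muCount (by norm_num) (by norm_num) hk).trans (muCount_512 k hk)

theorem mu_table {M : ℕ} {l : List ℕ} (hl : l.length = M)
    (h : ∀ k ∈ Finset.Icc 1 M, mu k M = l.getD (k - 1) 0) :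
    (List.range M).map (fun k => mu (k + 1) M) = l := by
  refine List.ext_getElem (by simp [hl]) fun i h1 h2 => ?_
  rw [List.getElem_map, List.getElem_range, h _ (Finset.mem_Icc.2 ⟨by omega, by omega⟩),
    Nat.add_sub_cancel, List.getD_eq_getElem _ _ h2]

theorem mu_64_table : ∀ k ∈ Finset.Icc 1 64,
    mu k 64 ≤ 10 ∧ ∀ m ∈ Finset.Icc 1 10, mu k 64 = m ↔ k ∈ K64 m := by
  have h : ∀ k ∈ Finset.Icc 1 64, multiplicity K64 10 k ≤ 10 ∧
      ∀ m ∈ Finset.Icc 1 10, multiplicity K64 10 k = m ↔ k ∈ K64 m := by decide +kernel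
  intro k hk
  rw [mu_64 hk]
  exact h k hk

theorem mu_128_table : ∀ k ∈ Finset.Icc 1 128,
    mu k 128 ≤ 5 ∧ ∀ m ∈ Finset.Icc 1 5, mu k 128 = m ↔ k ∈ K128 m := by
  have h : ∀ k ∈ Finset.Icc 1 128, multiplicity K128 5 k ≤ 5 ∧
      ∀ m ∈ Finset.Icc 1 5, multiplicity K128 5 k = m ↔ k ∈ K128 m := by decide +kernel
  intro k hk
  rw [mu_128 hk]
  exact h k hk

theorem mu_256_table : ∀ k ∈ Finset.Icc 1 256,
    mu k 256 ≤ 3 ∧ ∀ m ∈ Finset.Icc 1 3, mu k 256 = m ↔ k ∈ K256 m := by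
  have h : ∀ k ∈ Finset.Icc 1 256, multiplicity K256 3 k ≤ 3 ∧
      ∀ m ∈ Finset.Icc 1 3, multiplicity K256 3 k = m ↔ k ∈ K256 m := by decide +kernel
  intro k hk
  rw [mu_256 hk]
  exact h k hk

theorem mu_512_table : ∀ k ∈ Finset.Icc 1 512,
    mu k 512 ≤ 2 ∧ ∀ m ∈ Finset.Icc 1 2, mu k 512 = m ↔ k ∈ K512 m := by
  have h : ∀ k ∈ Finset.Icc 1 512, multiplicity K512 2 k ≤ 2 ∧
      ∀ m ∈ Finset.Icc 1 2, multiplicity K512 2 k = m ↔ k ∈ K512 m := by decide +kernel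
  intro k hk
  rw [mu_512 hk]
  exact h k hk

theorem sum_map_eq_sum_count {M : ℕ} {L : List ℕ} (hL : ∀ k ∈ L, k ∈ Finset.Icc 1 M) (f : ℕ → ℝ) :
    (L.map f).sum = ∑ k ∈ Finset.Icc 1 M, (L.count k : ℝ) * f k := by
  induction L with
  | nil => simp
  | cons a L ih =>
    rw [List.map_cons, List.sum_cons, ih fun k hk => hL k (List.mem_cons_of_mem _ hk)]
    have ha := hL a List.mem_cons_self
    simp only [List.count_cons, Nat.cast_add, add_mul, Finset.sum_add_distrib]
    rw [add_comm]
    congr 1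
    rw [Finset.sum_eq_single_of_mem a ha]
    · simp
    · intro b _ hb
      simp [Ne.symm hb]

theorem sum_multiplicity {K : ℕ → List ℕ} {M N : ℕ}
    (hK : ∀ m ∈ Finset.Icc 1 N, ∀ k ∈ K m, k ∈ Finset.Icc 1 M) (f : ℕ → ℝ) :
    ∑ k ∈ Finset.Icc 1 M, (multiplicity K N k : ℝ) * f k =
      ∑ m ∈ Finset.Icc 1 N, (m : ℝ) * ((K m).map f).sum := by
  have h : ∀ m ∈ Finset.Icc 1 N, (m : ℝ) * ((K m).map f).sum =
      ∑ k ∈ Finset.Icc 1 M, ((m * (K m).count k : ℕ) : ℝ) * f k := by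
    intro m hm
    rw [sum_map_eq_sum_count (hK m hm), Finset.mul_sum]
    refine Finset.sum_congr rfl fun k _ => ?_
    push_cast
    ring
  rw [Finset.sum_congr rfl h, Finset.sum_comm]
  refine Finset.sum_congr rfl fun k _ => ?_
  rw [multiplicity, Nat.cast_sum, Finset.sum_mul]

theorem F_mul_F_of_mu {M : ℕ} (hM : M ∣ 512) {j : ℕ} (hj : 1 ≤ j) {c : ℕ → ℕ}
    (hc : ∀ k ∈ Finset.Icc 1 M, mu k M = c k) :
    F j (2 * M) * F (j + M) (2 * M) =
      ∑ k ∈ Finset.Icc 1 M, (c k : ℝ) * F (rho (k + j - 1) M) M := by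
  rw [F_mul_F hM hj]
  exact Finset.sum_congr rfl fun k hk => by rw [hc k hk]

/-- The sum of all `F(k, M)` being `-1`, a constant may be subtracted from all coefficients. -/
theorem F_mul_F_reduced {M : ℕ} (hM : M ∣ 512) {j : ℕ} (hj : 1 ≤ j) {c : ℕ → ℕ}
    (hc : ∀ k ∈ Finset.Icc 1 M, mu k M = c k) :
    F j (2 * M) * F (j + M) (2 * M) =
      ∑ k ∈ Finset.range M, (c (k + 1) : ℝ) * F (rho (k + j) M) M ∧
    ∑ k ∈ Finset.range M, F (rho (k + j) M) M = -1 := by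
  have h := sum_F (hM.trans (by norm_num)) j hj
  rw [F_mul_F_of_mu hM hj hc]
  rw [sum_Icc_one] at h ⊢
  have e : ∀ k, k + 1 + j - 1 = k + j := by omega
  simp only [e] at h ⊢
  exact ⟨trivial, h⟩

theorem sum_list_pairs {M : ℕ} {L : List (ℕ × ℕ)} (hL : ∀ t ∈ L, t.2 ∈ Finset.Icc 1 M)
    (f : ℕ → ℝ) :
    ∑ k ∈ Finset.Icc 1 M, ((L.map fun t => if t.2 = k then t.1 else 0).sum : ℕ) * f k =
      (L.map fun t => (t.1 : ℝ) * f t.2).sum := by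
  induction L with
  | nil => simp
  | cons a L ih =>
    simp only [List.map_cons, List.sum_cons, Nat.cast_add, add_mul, Finset.sum_add_distrib]
    rw [ih fun t ht => hL t (List.mem_cons_of_mem _ ht)]
    congr 1
    rw [Finset.sum_eq_single_of_mem a.2 (hL a List.mem_cons_self)]
    · simp
    · intro b _ hb
      simp [Ne.symm hb]

theorem G_mul_G_add_1024 {j : ℕ} (hj : 1 ≤ j) :
    G j * G (j + 1024) =
      (terms11.map fun t => (t.1 : ℝ) * F (rho (t.2 + j - 1) 1024) 1024).sum := by
  have h := two_mul_G_mul_G hj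
  have hc : ∀ k ∈ Finset.Icc 1 1024, prodCount 1025 k 1024 =
      2 * (terms11.map fun t => if t.2 = k then t.1 else 0).sum := fun k hk =>
    (prodCount_eq_countRow (by norm_num) (by norm_num) hk 1024).trans (countRow_1025 k hk)
  rw [← sum_list_pairs (M := 1024) (by decide +kernel) fun k => F (rho (k + j - 1) 1024) 1024]
  refine mul_left_cancel₀ two_ne_zero (h.trans ?_)
  rw [Finset.mul_sum]
  refine Finset.sum_congr rfl fun k hk => ?_
  rw [hc k hk]
  push_cast
  ring

theorem F_mul_F_eq_prodF {m : ℕ} (hm : m ∈ Finset.Icc 1 11) {j : ℕ}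
    (hj : j ∈ Finset.Icc 1 (2 ^ (m - 1))) :
    F j (2 ^ m) * F (j + 2 ^ (m - 1)) (2 ^ m) = prodF m (fun k => F k (2 ^ (m - 1))) j := by
  have hr := rho_eq_self hj
  have hj1 := (Finset.mem_Icc.1 hj).1
  rw [Finset.mem_Icc] at hm
  obtain ⟨hm1, hm2⟩ := hm
  interval_cases m
  · have hmu : ∀ k ∈ Finset.Icc 1 1, mu k 1 = 16384 := by
      intro k hk
      rw [mu_eq_muCount (e₁ := 256) (e₂ := 256) (by norm_num) (by norm_num) hk]
      revert k
      decide +kernel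
    obtain ⟨h1, h2⟩ := F_mul_F_reduced (M := 1) (by norm_num) hj1 hmu
    rw [Finset.sum_range_one] at h1 h2
    rw [h2] at h1
    norm_num [prodF] at h1 ⊢
    exact h1
  · obtain ⟨h1, h2⟩ := F_mul_F_reduced (M := 2) (by norm_num) hj1 @mu_two
    rw [← Finset.mul_sum, h2] at h1
    norm_num [prodF] at h1 ⊢
    exact h1
  · obtain ⟨h1, h2⟩ := F_mul_F_reduced (M := 4) (by norm_num) hj1 @mu_four
    simp only [Finset.sum_range_succ, Finset.sum_range_zero, zero_add] at h1 h2
    norm_num [prodF] at h1 h2 hr ⊢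
    rw [hr] at h1 h2
    linear_combination h1 + 1040 * h2
  · obtain ⟨h1, h2⟩ := F_mul_F_reduced (M := 8) (by norm_num) hj1 @mu_eight
    simp only [Finset.sum_range_succ, Finset.sum_range_zero, zero_add] at h1 h2
    norm_num [prodF] at h1 h2 hr ⊢
    rw [hr] at h1 h2
    linear_combination h1 + 237 * h2
  · obtain ⟨h1, h2⟩ := F_mul_F_reduced (M := 16) (by norm_num) hj1 @mu_sixteen
    simp only [Finset.sum_range_succ, Finset.sum_range_zero, zero_add] at h1 h2
    norm_num [prodF] at h1 h2 hr ⊢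
    rw [hr] at h1 h2
    linear_combination h1 + 60 * h2
  · exact F_mul_F_of_mu (M := 32) (by norm_num) hj1 @mu_thirtytwo
  · refine (F_mul_F_of_mu (M := 64) (by norm_num) hj1 @mu_64).trans ?_
    exact sum_multiplicity (M := 64) (by decide +kernel) fun k => F (rho (k + j - 1) 64) 64
  · refine (F_mul_F_of_mu (M := 128) (by norm_num) hj1 @mu_128).trans ?_
    exact sum_multiplicity (M := 128) (by decide +kernel) fun k => F (rho (k + j - 1) 128) 128
  · refine (F_mul_F_of_mu (M := 256) (by norm_num) hj1 @mu_256).trans ?_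
    exact sum_multiplicity (M := 256) (by decide +kernel) fun k => F (rho (k + j - 1) 256) 256
  · refine (F_mul_F_of_mu (M := 512) (by norm_num) hj1 @mu_512).trans ?_
    exact sum_multiplicity (M := 512) (by decide +kernel) fun k => F (rho (k + j - 1) 512) 512
  · norm_num [F_level_top, prodF]
    exact G_mul_G_add_1024 hj1

theorem F_1024 (j : ℕ) : F j 1024 = G j + G (j + 1024) := by
  rw [F, show 2048 / 1024 = 2 from rfl, Finset.sum_range_succ, Finset.sum_range_one, zero_mul,
    one_mul, add_zero]

theorem G_one_mul_G_1025 :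
    G 1 * G 1025 = 2 * (G 1 + G 1025) + (G 24 + G 1048) + 2 * (G 155 + G 1179)
      + (G 185 + G 1209) + (G 309 + G 1333) + (G 360 + G 1384) + (G 531 + G 1555)
      + (G 667 + G 1691) + (G 719 + G 1743) + (G 734 + G 1758) + 2 * (G 778 + G 1802)
      + (G 841 + G 1865) + (G 946 + G 1970) := by
  rw [G_mul_G_add_1024 le_rfl]
  norm_num [terms11, rho, F_1024]
  ring

/-! ### The products of parts of invariant sets -/

/-- Two nonzero residues belong to the same coset of the group generated by `2 ^ M` as soon as their
powers with exponent `32 / M` agree. -/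
theorem eta_eq_of_pow_eq {M : ℕ} (hM : M ∣ 32) {x y : ZMod 65537} (hx : x ≠ 0)
    (h : y ^ (32 / M) = x ^ (32 / M)) : eta M y = eta M x := by
  have hM0 := pos_of_dvd_thirtytwo hM
  obtain ⟨K, hK⟩ := hM
  have hK1 : 32 / M = K := by rw [hK]; exact Nat.mul_div_cancel_left _ hM0
  have hK0 : K ≠ 0 := by rintro rfl; simp at hK
  rw [hK1] at h
  have hy : y ≠ 0 := by
    rintro rfl
    rw [zero_pow hK0] at h
    exact pow_ne_zero _ hx h.symm
  obtain ⟨l, hl, i, -, h1⟩ := exists_class (div_ne_zero hy hx)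
  have h2 : (y / x) ^ K = 1 := by rw [div_pow, h, div_self (pow_ne_zero _ hx)]
  have h3 : (y / x) ^ 32 = 1 := by rw [hK, mul_comm, pow_mul, h2, one_pow]
  have hl0 : l = 0 := by
    rw [h1, mul_pow, ← pow_mul 2, mul_comm i, pow_mul 2, two_pow_thirtytwo, one_pow, mul_one,
      ← pow_mul, ← pow_zero (3 : ZMod 65537), three_pow_eq_iff, Nat.ModEq] at h3
    omega
  rw [h1, hl0, pow_zero, one_mul, ← pow_mul, ← pow_zero (2 : ZMod 65537),
    pow_eq_pow_iff_of_ne_zero two_ne_zero', orderOf_two, Nat.modEq_zero_iff_dvd, hK] at h2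
  obtain ⟨a, rfl⟩ := Nat.dvd_of_mul_dvd_mul_right (Nat.pos_of_ne_zero hK0) h2
  rw [← eta_mul_two_pow ⟨K, hK⟩ x a]
  congr 1
  rw [hl0, pow_zero, one_mul] at h1
  rw [← h1, mul_div_cancel₀ _ hx]

/-- The degrees `3 ^ (k - 1) * 2 ^ (s - 1) * c` and `3 ^ (l - 1) * 2 ^ (t - 1)` belong to the same
period `G_l(t, M)`. -/
def SameCoset (M k s c l t : ℕ) : Prop :=
  (3 ^ (k - 1) * 2 ^ (s - 1) * c) ^ (32 / M) % 65537 =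
    (3 ^ (l - 1) * 2 ^ (t - 1)) ^ (32 / M) % 65537

instance (M k s c l t : ℕ) : Decidable (SameCoset M k s c l t) :=
  inferInstanceAs (Decidable (_ = _))

theorem SameCoset.eta_eq {M k s c l t : ℕ} (h : SameCoset M k s c l t) (hM : M ∣ 16) (ht : 1 ≤ t) :
    eta M (3 ^ (k - 1) * 2 ^ (s - 1) * c) = (Gpart l t M : ℝ) := by
  rw [SameCoset, ← natCast_eq_iff] at h
  push_cast at h
  rw [ofReal_Gpart hM l t ht]
  exact eta_eq_of_pow_eq (hM.trans (by norm_num))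
    (mul_ne_zero (pow_ne_zero _ three_ne_zero') (pow_ne_zero _ two_ne_zero')) h

theorem sum_range_getD {A : Type*} (L : List A) (d : A) (f : A → ℝ) :
    ∑ i ∈ Finset.range L.length, f (L.getD i d) = (L.map f).sum := by
  induction L with
  | nil => simp
  | cons a L ih =>
    rw [List.length_cons, Finset.sum_range_succ', List.map_cons, List.sum_cons, ← ih, add_comm]
    simp

theorem eta_mul_one_add {M N a : ℕ} (hM : M ∣ N) (hN : N ∣ 32) (x : ZMod 65537)
    (ha : a * N ≤ 32) :
    eta M (x * (1 + 2 ^ (32 - a * N))) = eta M (x * (1 + 2 ^ (N * a))) := by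
  obtain ⟨u, rfl⟩ := hM
  rw [← eta_mul_two_pow ((Dvd.intro u rfl).trans hN) _ (u * a)]
  congr 1
  rw [mul_assoc, add_mul, ← pow_add, show M * (u * a) = a * (M * u) by ring,
    Nat.sub_add_cancel ha, two_pow_thirtytwo]
  ring

/-- In the sum of the periods of `1 + 2 ^ (N i)` the index `32 / N - i` gives the same value as `i`,
and `i = 16 / N` gives the period of `0`. -/
theorem sum_eta_one_add {M N K : ℕ} (hM : M ∣ N) (hK : N * K = 16) (x : ZMod 65537) :
    ∑ i ∈ Finset.range (32 / N), eta M (x * (1 + 2 ^ (N * i))) =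
      eta M (x * 2) + (32 / M : ℕ) +
        2 * ∑ i ∈ Finset.range (K - 1), eta M (x * (1 + 2 ^ (N * (i + 1)))) := by
  have hN0 : 0 < N := by
    rcases Nat.eq_zero_or_pos N with h | h
    · simp [h] at hK
    · exact h
  obtain ⟨u, rfl⟩ : ∃ u, K = u + 1 := by
    refine ⟨K - 1, ?_⟩
    rcases Nat.eq_zero_or_pos K with h | h
    · simp [h] at hK
    · omega
  have hd : N ∣ 32 := ⟨2 * (u + 1), by linarith⟩
  have h1 : 32 / N = (u + 1) + (u + 1) := by
    rw [show 32 = N * ((u + 1) + (u + 1)) by linarith]; exact Nat.mul_div_cancel_left _ hN0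
  have h3 : ∑ i ∈ Finset.range u, eta M (x * (1 + 2 ^ (N * (u + 1 + (i + 1))))) =
      ∑ i ∈ Finset.range u, eta M (x * (1 + 2 ^ (N * (i + 1)))) := by
    rw [← Finset.sum_range_reflect]
    refine Finset.sum_congr rfl fun i hi => ?_
    rw [Finset.mem_range] at hi
    have h5 : (i + 1) * N ≤ (u + 1) * N := Nat.mul_le_mul_right _ (by omega)
    rw [← eta_mul_one_add hM hd x (a := i + 1) (by linarith)]
    congr 4
    obtain ⟨v, rfl⟩ : ∃ v, u = i + 1 + v := ⟨u - i - 1, by omega⟩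
    rw [show i + 1 + v - 1 - i = v by omega]
    exact Nat.eq_sub_of_add_eq (by linarith)
  have h4 : eta M (x * (1 + 2 ^ (N * (u + 1 + 0)))) = (32 / M : ℕ) := by
    rw [add_zero, hK, two_pow_sixteen, add_neg_cancel, mul_zero, eta_zero]
  rw [h1, Finset.sum_range_add, Finset.sum_range_succ', Finset.sum_range_succ', h3, h4,
    Nat.add_sub_cancel]
  rw [mul_zero, pow_zero, one_add_one_eq_two]
  ring

/-- The list `L` names the periods `G_l(t, M)` which contain the residues
`3 ^ (k - 1) * 2 ^ (s - 1) * (1 + 2 ^ (N i))` for `0 < i < 16 / N`, and `e` names the period which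
contains the double of `3 ^ (k - 1) * 2 ^ (s - 1)`. -/
def IsProductTable (M N k s : ℕ) (e : ℕ × ℕ) (L : List (ℕ × ℕ)) : Prop :=
  M ∣ 16 ∧ M ∣ N ∧ N * (L.length + 1) = 16 ∧ SameCoset M k s 2 e.1 e.2 ∧ 1 ≤ e.2 ∧ 1 ≤ s ∧
    ∀ i ∈ Finset.range L.length, 1 ≤ (L.getD i (0, 0)).2 ∧
      SameCoset M k s (1 + 2 ^ (N * (i + 1))) (L.getD i (0, 0)).1 (L.getD i (0, 0)).2

instance (M N k s : ℕ) (e : ℕ × ℕ) (L : List (ℕ × ℕ)) : Decidable (IsProductTable M N k s e L) :=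
  inferInstanceAs (Decidable (_ ∧ _))

theorem IsProductTable.sum_eta_eq {M N k s : ℕ} {e : ℕ × ℕ} {L : List (ℕ × ℕ)}
    (h : IsProductTable M N k s e L) :
    ∑ i ∈ Finset.range (32 / N), eta M (3 ^ (k - 1) * 2 ^ (s - 1) * (1 + 2 ^ (N * i))) =
      (Gpart e.1 e.2 M + (32 / M : ℕ) + 2 * (L.map fun t => Gpart t.1 t.2 M).sum : ℝ) := by
  obtain ⟨hM, hMN, hN, he, he1, -, hL⟩ := h
  rw [sum_eta_one_add hMN hN, Nat.add_sub_cancel, ← sum_range_getD L (0, 0)]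
  have h2 := he.eta_eq hM he1
  push_cast at h2 ⊢
  rw [h2]
  congr 2
  refine Finset.sum_congr rfl fun i hi => ?_
  have h3 := (hL i hi).2.eta_eq hM (hL i hi).1
  push_cast at h3
  exact h3

theorem IsProductTable.Gpart_sq {M k s : ℕ} {e : ℕ × ℕ} {L : List (ℕ × ℕ)}
    (h : IsProductTable M M k s e L) :
    Gpart k s M ^ 2 =
      Gpart e.1 e.2 M + (32 / M : ℕ) + 2 * (L.map fun t => Gpart t.1 t.2 M).sum := by
  have h1 := h.sum_eta_eq
  obtain ⟨hM, -, -, -, -, hs, -⟩ := h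
  have h2 : ((Gpart k s M ^ 2 : ℝ) : ℂ) =
      (Gpart e.1 e.2 M + (32 / M : ℕ) + 2 * (L.map fun t => Gpart t.1 t.2 M).sum : ℝ) := by
    rw [← h1, Complex.ofReal_pow, ofReal_Gpart hM k s hs, sq, eta_mul_eta (hM.trans (by norm_num))]
    exact Finset.sum_congr rfl fun i _ => by rw [mul_add, mul_one]
  exact_mod_cast h2

theorem Gpart_add_Gpart {M : ℕ} (hM : 2 * M ∣ 16) (k : ℕ) {s : ℕ} (hs : 1 ≤ s) :
    Gpart k s (2 * M) + Gpart k (s + M) (2 * M) = Gpart k s M := by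
  have h : ((Gpart k s (2 * M) + Gpart k (s + M) (2 * M) : ℝ) : ℂ) = (Gpart k s M : ℝ) := by
    rw [Complex.ofReal_add, ofReal_Gpart hM k s hs, ofReal_Gpart hM k (s + M) (by omega),
      ofReal_Gpart ((Dvd.intro_left 2 rfl).trans hM) k s hs,
      ← eta_split (hM.trans (by norm_num)), mul_assoc, ← pow_add,
      show s - 1 + M = s + M - 1 by omega]
  exact_mod_cast h

/-- The product of the two halves of `G_k(s, M)`. -/
theorem IsProductTable.Gpart_mul_Gpart {M k s : ℕ} {e : ℕ × ℕ} {L : List (ℕ × ℕ)}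
    (h : IsProductTable M (2 * M) k s e L) :
    Gpart k s (2 * M) * Gpart k (s + M) (2 * M) = (Gpart k s M ^ 2 - Gpart e.1 e.2 M) / 2
      - (32 / M : ℕ) / 2 - (L.map fun t => Gpart t.1 t.2 M).sum := by
  have h1 := h.sum_eta_eq
  obtain ⟨hM, -, hN, -, -, hs, -⟩ := h
  have hN' : 2 * M ∣ 16 := ⟨_, hN.symm⟩
  have h2 : ((Gpart k s (2 * M) * Gpart k (s + M) (2 * M) : ℝ) : ℂ) =
      ((Gpart k s M ^ 2 - (Gpart e.1 e.2 M + (32 / M : ℕ) +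
        2 * (L.map fun t => Gpart t.1 t.2 M).sum)) / 2 : ℝ) := by
    have h3 := eta_half_mul (hN'.trans (by norm_num)) (3 ^ (k - 1) * 2 ^ (s - 1))
    rw [h1] at h3
    rw [Complex.ofReal_mul, ofReal_Gpart hN' k s hs, ofReal_Gpart hN' k (s + M) (by omega),
      show s + M - 1 = s - 1 + M by omega, pow_add, ← mul_assoc, h3, ← ofReal_Gpart hM k s hs]
    push_cast
    ring
  have h4 : Gpart k s (2 * M) * Gpart k (s + M) (2 * M) =
      (Gpart k s M ^ 2 - (Gpart e.1 e.2 M + (32 / M : ℕ) +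
        2 * (L.map fun t => Gpart t.1 t.2 M).sum)) / 2 := by exact_mod_cast h2
  rw [h4]
  ring

theorem G_one_sq : G 1 ^ 2 = 32 + 3 * G 1 + 4 * G 2 + 2 * (G 3 + G 778 + G 801 + G 1025 + G 1100
    + G 1117 + G 1179 + G 1264 + G 1266 + G 1900 + G 1956 + G 1957) := by
  have h : IsProductTable 1 1 1 1 (1, 1) [(2, 1), (1956, 1), (3, 1), (1117, 1), (801, 1), (1900, 1),
      (1179, 1), (1025, 1), (778, 1), (1266, 1), (1100, 1), (1957, 1), (1264, 1), (2, 1), (1, 1)] := by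
    decide +kernel
  have h1 := h.Gpart_sq
  norm_num [← G_eq_Gpart] at h1
  rw [G_eq_Gpart 1] at h1 ⊢
  rw [h1]
  ring

theorem Gpart_mul_Gpart_eq_prod12 {k : ℕ} (hk : k ∈ split12) :
    Gpart k 1 2 * Gpart k 2 2 = prod12 G k := by
  have key : ∀ {k : ℕ} {L : List (ℕ × ℕ)}, IsProductTable 1 2 k 1 (k, 1) L →
      Gpart k 1 2 * Gpart k 2 2 = (G k ^ 2 - G k) / 2 - 16 -
        (L.map fun t => Gpart t.1 t.2 1).sum := by
    intro k L h
    have h1 := h.Gpart_mul_Gpart (M := 1)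
    norm_num [← G_eq_Gpart] at h1
    exact h1
  simp only [split12, List.mem_cons, List.not_mem_nil, or_false] at hk
  rcases hk with rfl | rfl | rfl | rfl | rfl | rfl
  · have h : IsProductTable 1 2 1 1 (1, 1) [(1956, 1), (1117, 1), (1900, 1), (1025, 1), (1266, 1),
      (1957, 1), (2, 1)] := by decide +kernel
    rw [key h]; norm_num [prod12, terms12, ← G_eq_Gpart]; ring
  · have h : IsProductTable 1 2 93 1 (93, 1) [(2048, 1), (1209, 1), (1992, 1), (1117, 1), (1358, 1),
      (1, 1), (94, 1)] := by decide +kernel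
    rw [key h]; norm_num [prod12, terms12, ← G_eq_Gpart]; ring
  · have h : IsProductTable 1 2 933 1 (933, 1) [(840, 1), (1, 1), (784, 1), (1957, 1), (150, 1),
      (841, 1), (934, 1)] := by decide +kernel
    rw [key h]; norm_num [prod12, terms12, ← G_eq_Gpart]; ring
  · have h : IsProductTable 1 2 1025 1 (1025, 1) [(932, 1), (93, 1), (876, 1), (1, 1), (242, 1),
      (933, 1), (1026, 1)] := by decide +kernel
    rw [key h]; norm_num [prod12, terms12, ← G_eq_Gpart]; ring
  · have h : IsProductTable 1 2 1117 1 (1117, 1) [(1024, 1), (185, 1), (968, 1), (93, 1), (334, 1),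
      (1025, 1), (1118, 1)] := by decide +kernel
    rw [key h]; norm_num [prod12, terms12, ← G_eq_Gpart]; ring
  · have h : IsProductTable 1 2 1957 1 (1957, 1) [(1864, 1), (1025, 1), (1808, 1), (933, 1),
      (1174, 1), (1865, 1), (1958, 1)] := by decide +kernel
    rw [key h]; norm_num [prod12, terms12, ← G_eq_Gpart]; ring

theorem Gpart_mul_Gpart_eq_prod13 {k s : ℕ} (hk : k ∈ [1, 1025]) (hs : s ∈ [1, 2]) :
    Gpart k s 4 * Gpart k (s + 2) 4 = prod13 (fun l t => Gpart l t 2) k s := by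
  simp only [List.mem_cons, List.not_mem_nil, or_false] at hk hs
  rcases hk with rfl | rfl <;> rcases hs with rfl | rfl
  · have h : IsProductTable 2 4 1 1 (1, 2) [(1117, 2), (1025, 2), (1957, 2)] := by decide +kernel
    have h1 := h.Gpart_mul_Gpart (M := 2)
    norm_num [prod13] at h1 ⊢
    linarith
  · have h : IsProductTable 2 4 1 2 (1, 1) [(1117, 1), (1025, 1), (1957, 1)] := by decide +kernel
    have h1 := h.Gpart_mul_Gpart (M := 2)
    norm_num [prod13] at h1 ⊢
    linarith
  · have h : IsProductTable 2 4 1025 1 (1025, 2) [(93, 1), (1, 1), (933, 1)] := by decide +kernel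
    have h1 := h.Gpart_mul_Gpart (M := 2)
    norm_num [prod13] at h1 ⊢
    linarith
  · have h : IsProductTable 2 4 1025 2 (1025, 1) [(93, 2), (1, 2), (933, 2)] := by decide +kernel
    have h1 := h.Gpart_mul_Gpart (M := 2)
    norm_num [prod13] at h1 ⊢
    linarith

theorem Gpart_mul_Gpart_eq_prod14 {s : ℕ} (hs : s ∈ [1, 2]) :
    Gpart 1 s 8 * Gpart 1 (s + 4) 8 = prod14 (fun l t => Gpart l t 4) s := by
  simp only [List.mem_cons, List.not_mem_nil, or_false] at hs
  rcases hs with rfl | rfl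
  · have h : IsProductTable 4 8 1 1 (1, 2) [(1025, 4)] := by decide +kernel
    have h1 := h.Gpart_mul_Gpart (M := 4)
    norm_num [prod14] at h1 ⊢
    linarith
  · have h : IsProductTable 4 8 1 2 (1, 3) [(1025, 1)] := by decide +kernel
    have h1 := h.Gpart_mul_Gpart (M := 4)
    norm_num [prod14] at h1 ⊢
    linarith

theorem Gpart_one_one_sixteen : Gpart 1 1 16 = p 1 := by
  have h : pairNo 1 1 = 1 := by decide
  simp [Gpart, h]

theorem Gpart_one_nine_sixteen : Gpart 1 9 16 = p 256 := by
  have h : pairNo 1 9 = 256 := by decide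
  simp [Gpart, h]

theorem p_mul_p_eq_prod15 : p 1 * p 256 = prod15 (fun t => Gpart 1 t 8) := by
  have h : IsProductTable 8 16 1 1 (1, 2) [] := by decide +kernel
  have h1 := h.Gpart_mul_Gpart (M := 8)
  norm_num [prod15, Gpart_one_one_sixteen, Gpart_one_nine_sixteen] at h1 ⊢
  linarith

theorem Gpart_one_eq :
    (G 1 = ∑ i ∈ Finset.range 16, p (2 ^ i) ∧
      Gpart 1 1 2 = p 1 + p 4 + p 16 + p 64 + p 256 + p 1024 + p 4096 + p 16384 ∧
      Gpart 1 2 2 = p 2 + p 8 + p 32 + p 128 + p 512 + p 2048 + p 8192 + p 32768 ∧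
      Gpart 1 1 4 = p 1 + p 16 + p 256 + p 4096 ∧ Gpart 1 3 4 = p 4 + p 64 + p 1024 + p 16384 ∧
      Gpart 1 1 8 = p 1 + p 256 ∧ Gpart 1 5 8 = p 16 + p 4096) := by
  have h : ∀ i ∈ Finset.range 16, pairNo 1 (i + 1) = 2 ^ i := by decide
  refine ⟨?_, ?_, ?_, ?_, ?_, ?_, ?_⟩
  · rw [G, sum_Icc_one]
    exact Finset.sum_congr rfl fun i hi => by rw [h i hi]
  all_goals
    simp only [Gpart, Nat.reduceDiv, Finset.sum_range_succ, Finset.sum_range_zero, zero_add]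
    norm_num [h, pairNo, deg]

/-! ### Cosines in fixed-point arithmetic -/

/-- The doubling map `v ↦ v (4 - v)` for `v = 2 - 2 cos θ`, in fixed-point arithmetic with the
unit `2 ^ 128`. -/
def double (V : ℕ) : ℕ :=
  Nat.div (Nat.mul V (Nat.sub 1361129467683753853853498429727072845824 V))
    340282366920938463463374607431768211456

/-- The `t`-fold iteration of the doubling map. -/
def doubles (t : ℕ) : ℕ → ℕ := Nat.rec (fun V => V) (fun _ ih V => eval (double V) ih) t

/-- The sum of the first `t` elements of an orbit of the doubling map. -/
def orbitSum (t : ℕ) : ℕ → ℕ :=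
  Nat.rec (fun _ => 0) (fun _ ih V => Nat.add V (eval (double V) ih)) t

/-- The approximation `θ ^ 2` of `2 - 2 cos θ` for `θ = 2πr / (65537 * 2 ^ 32)`. -/
def seed (r : ℕ) : ℕ :=
  Nat.div (Nat.mul (4 * 314159265358979323846 ^ 2 * 2 ^ 64) (Nat.mul r r)) (65537 ^ 2 * 10 ^ 40)

/-- `V` approximates `2 - 2 cos θ` with an error which results from `n` doublings. The error `ε` becomes
at most `4 ε + 1` in each of them. -/
def Approx (V : ℕ) (θ : ℝ) (n : ℕ) : Prop :=
  V ≤ 4 * 2 ^ 128 ∧ |(V : ℝ) - 2 ^ 128 * (2 - 2 * Real.cos θ)| ≤ 4 ^ n * 500 - 1 / 3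

theorem double_eq (V : ℕ) : double V = V * (4 * 2 ^ 128 - V) / 2 ^ 128 := by
  change V * (1361129467683753853853498429727072845824 - V) /
    340282366920938463463374607431768211456 = _
  norm_num

theorem Approx.double {V n : ℕ} {θ : ℝ} (h : Approx V θ n) : Approx (double V) (2 * θ) (n + 1) := by
  obtain ⟨h1, h2⟩ := h
  have hSR : (2 : ℝ) ^ 128 = ((2 ^ 128 : ℕ) : ℝ) := by norm_num
  rw [Approx, double_eq, hSR]
  rw [hSR] at h2
  have hSpos : 0 < 2 ^ 128 := by positivity
  generalize 2 ^ 128 = S at *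
  have hS : (0 : ℝ) < S := by exact_mod_cast hSpos
  have hx4 : (V : ℝ) ≤ 4 * S := by exact_mod_cast h1
  refine ⟨?_, ?_⟩
  · refine Nat.div_le_of_le_mul ?_
    zify [h1]
    nlinarith [sq_nonneg ((V : ℤ) - 2 * S)]
  · set v : ℝ := 2 - 2 * Real.cos θ with hv
    have hv0 : 0 ≤ v := by linarith [Real.cos_le_one θ]
    have hv4 : v ≤ 4 := by linarith [Real.neg_one_le_cos θ]
    have hv2 : 2 - 2 * Real.cos (2 * θ) = v * (4 - v) := by
      rw [Real.cos_two_mul, hv]; ring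
    set Q : ℝ := ((V * (4 * S - V) / S : ℕ) : ℝ) with hQ
    have hcast : ((V * (4 * S - V) : ℕ) : ℝ) = V * (4 * S - V) := by
      rw [Nat.cast_mul, Nat.cast_sub h1]; push_cast; ring
    have hQ1 : Q ≤ V * (4 * S - V) / S := by
      rw [← hcast]; exact Nat.cast_div_le
    have hQ2 : V * (4 * S - V) / S < Q + 1 := by
      rw [div_lt_iff₀ hS, ← hcast]
      have := Nat.lt_div_mul_add (a := V * (4 * S - V)) hSpos
      have h3 : ((V * (4 * S - V) : ℕ) : ℝ) < ((V * (4 * S - V) / S * S + S : ℕ) : ℝ) := by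
        exact_mod_cast this
      rw [Nat.cast_add, Nat.cast_mul (V * (4 * S - V) / S)] at h3
      linarith
    have hfac : V * (4 * S - V) / S - S * (v * (4 - v)) = (V - S * v) * (4 - V / S - v) := by
      field_simp
      ring
    have hVS : (V : ℝ) / S ≤ 4 := by rw [div_le_iff₀ hS]; linarith
    have hVS0 : (0 : ℝ) ≤ V / S := by positivity
    have hb : |4 - V / S - v| ≤ 4 := by rw [abs_le]; constructor <;> linarith
    have hm : |V * (4 * S - V) / S - S * (v * (4 - v))| ≤ (4 ^ n * 500 - 1 / 3) * 4 := by
      rw [hfac, abs_mul]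
      exact mul_le_mul h2 hb (abs_nonneg _) ((abs_nonneg _).trans h2)
    rw [hv2]
    rw [abs_le] at hm ⊢
    rw [pow_succ]
    constructor <;> linarith [hm.1, hm.2]

theorem Approx.doubles {n : ℕ} (t : ℕ) {V : ℕ} {θ : ℝ} (h : Approx V θ n) :
    Approx (doubles t V) (2 ^ t * θ) (n + t) := by
  induction t generalizing V θ n with
  | zero => simpa [Gon65537.doubles] using h
  | succ t ih =>
    have h1 := ih h.double
    rw [show n + (t + 1) = n + 1 + t by ring, show (2 : ℝ) ^ (t + 1) * θ = 2 ^ t * (2 * θ) by ring]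
    exact h1

theorem Approx.orbitSum {n : ℕ} (t : ℕ) {V : ℕ} {θ : ℝ} (h : Approx V θ n) :
    |(orbitSum t V : ℝ) - 2 ^ 128 * ∑ i ∈ Finset.range t, (2 - 2 * Real.cos (2 ^ i * θ))| ≤
      (4 ^ (n + t) - 4 ^ n) * 200 := by
  induction t generalizing V θ n with
  | zero => simp [Gon65537.orbitSum]
  | succ t ih =>
    have h1 := ih h.double
    have h2 : (Gon65537.orbitSum (t + 1) V : ℝ) = V + Gon65537.orbitSum t (Gon65537.double V) := by
      rw [← Nat.cast_add]; rfl
    rw [h2, Finset.sum_range_succ']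
    have h3 : ∀ i, (2 : ℝ) ^ (i + 1) * θ = 2 ^ i * (2 * θ) := fun i => by ring
    simp only [h3, pow_zero, one_mul]
    have h4 := h.2
    have h5 : (0 : ℝ) ≤ 4 ^ n := by positivity
    rw [show n + 1 + t = n + (t + 1) by ring, pow_succ 4 n] at h1
    rw [abs_le] at h1 h4 ⊢
    constructor <;> linarith [h1.1, h1.2, h4.1, h4.2]

theorem approx_seed {r : ℕ} (hr : r ≤ 65537) :
    Approx (seed r) (2 * Real.pi * r / 65537 / 2 ^ 32) 0 := by
  have hseed : seed r =
      4 * 314159265358979323846 ^ 2 * 2 ^ 64 * (r * r) / (65537 ^ 2 * 10 ^ 40) := rfl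
  set u : ℝ := r / 65537 with hu
  have hu0 : 0 ≤ u := by positivity
  have hu1 : u ≤ 1 := by
    rw [hu, div_le_one (by norm_num)]; exact_mod_cast hr
  set ϖ : ℝ := 3.14159265358979323846 with hϖ
  have hp1 := Real.pi_gt_d20
  have hp2 := Real.pi_lt_d20
  set θ : ℝ := 2 * Real.pi * r / 65537 / 2 ^ 32 with hθ
  have hθu : θ = 2 * Real.pi / 2 ^ 32 * u := by rw [hθ, hu]; ring
  have hθ0 : 0 ≤ θ := by rw [hθu]; positivity
  have hθ1 : θ ≤ 7 / 2 ^ 32 := by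
    rw [hθu]
    calc 2 * Real.pi / 2 ^ 32 * u ≤ 2 * Real.pi / 2 ^ 32 * 1 := by gcongr
      _ ≤ 7 / 2 ^ 32 := by rw [mul_one]; gcongr; linarith
  -- the exact rational number of which the seed is the integral part
  set q : ℝ := 4 * ϖ ^ 2 * 2 ^ 64 * u ^ 2 with hq
  have hq' : q = ((4 * 314159265358979323846 ^ 2 * 2 ^ 64 * (r * r) : ℕ) : ℝ) /
      ((65537 ^ 2 * 10 ^ 40 : ℕ) : ℝ) := by
    rw [hq, hu, hϖ]; push_cast; ring
  have hs1 : (seed r : ℝ) ≤ q := by rw [hq', hseed]; exact Nat.cast_div_le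
  have hs2 : q < seed r + 1 := by
    rw [hq', hseed, div_lt_iff₀ (by positivity)]
    have := Nat.lt_div_mul_add (a := 4 * 314159265358979323846 ^ 2 * 2 ^ 64 * (r * r))
      (b := 65537 ^ 2 * 10 ^ 40) (by positivity)
    rw [add_mul, one_mul]
    exact_mod_cast this
  have hu2 : u ^ 2 ≤ 1 := pow_le_one₀ hu0 hu1
  have hq4 : q ≤ 1000 * 2 ^ 64 := by
    have : ϖ ^ 2 ≤ 10 := by rw [hϖ]; norm_num
    calc q ≤ 4 * 10 * 2 ^ 64 * 1 := by rw [hq]; gcongr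
      _ ≤ _ := by norm_num
  refine ⟨?_, ?_⟩
  · have : (seed r : ℝ) ≤ ((4 * 2 ^ 128 : ℕ) : ℝ) := by
      refine (hs1.trans hq4).trans ?_
      push_cast
      norm_num
    exact_mod_cast this
  · have hcos := Real.cos_bound (x := θ) (by
      rw [abs_of_nonneg hθ0]; refine hθ1.trans ?_; norm_num)
    rw [abs_of_nonneg hθ0] at hcos
    have h4 : θ ^ 4 ≤ (7 / 2 ^ 32) ^ 4 := by gcongr
    have h4' : 2 ^ 128 * (θ ^ 4 * (5 / 96)) ≤ 2401 * (5 / 96) := by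
      calc 2 ^ 128 * (θ ^ 4 * (5 / 96)) ≤ 2 ^ 128 * ((7 / 2 ^ 32) ^ 4 * (5 / 96)) := by gcongr
        _ = _ := by norm_num
    have hsq : 2 ^ 128 * θ ^ 2 = 4 * Real.pi ^ 2 * 2 ^ 64 * u ^ 2 := by
      rw [hθu]; ring
    have hpq : |2 ^ 128 * θ ^ 2 - q| ≤ 10 := by
      have h1 : 2 ^ 128 * θ ^ 2 - q =
          (Real.pi - ϖ) * (4 * 2 ^ 64 * (Real.pi + ϖ)) * u ^ 2 := by rw [hsq, hq]; ring
      have h2 : 0 ≤ Real.pi - ϖ := sub_nonneg.2 hp1.le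
      have h3 : Real.pi - ϖ ≤ 1 / 10 ^ 20 := by
        rw [hϖ]; norm_num; norm_num at hp2; linarith
      have h5 : 0 ≤ 4 * 2 ^ 64 * (Real.pi + ϖ) := by positivity
      have h6 : 4 * 2 ^ 64 * (Real.pi + ϖ) ≤ 4 * 2 ^ 64 * (4 + 4) := by
        have : ϖ ≤ 4 := by rw [hϖ]; norm_num
        gcongr
        exact Real.pi_le_four
      rw [h1, abs_of_nonneg (by positivity)]
      calc (Real.pi - ϖ) * (4 * 2 ^ 64 * (Real.pi + ϖ)) * u ^ 2
          ≤ 1 / 10 ^ 20 * (4 * 2 ^ 64 * (4 + 4)) * 1 := by gcongr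
        _ ≤ 10 := by norm_num
    rw [abs_le] at hcos hpq ⊢
    have e1 := mul_le_mul_of_nonneg_left hcos.1 (show (0 : ℝ) ≤ 2 ^ 128 by positivity)
    have e2 := mul_le_mul_of_nonneg_left hcos.2 (show (0 : ℝ) ≤ 2 ^ 128 by positivity)
    rw [pow_zero]
    constructor <;> linarith [hpq.1, hpq.2]

/-! ### Which part is the larger one -/

theorem p_pairNo_eq {k i : ℕ} :
    p (pairNo k (i + 1)) =
      2 * Real.cos (2 ^ i * (2 * Real.pi * (3 ^ (k - 1) % 65537 : ℕ) / 65537)) := by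
  have h : ((p (pairNo k (i + 1)) : ℝ) : ℂ) = (p (3 ^ (k - 1) % 65537 * 2 ^ i) : ℝ) := by
    rw [ofReal_p_pairNo, ofReal_p]
    push_cast
    rw [ZMod.natCast_mod]
    push_cast
    rfl
  have h' : p (pairNo k (i + 1)) = p (3 ^ (k - 1) % 65537 * 2 ^ i) := by exact_mod_cast h
  rw [h', p]
  push_cast
  congr 2
  ring

/-- The approximation of `2` minus the `i`-th pair of `G_k`. The first `32` doublings lead from the
seed to `2` minus the first pair. -/
def pairValue (k i : ℕ) : ℕ := doubles (31 + i) (seed (3 ^ (k - 1) % 65537))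

/-- The approximation of `32 / M` minus `G_k(s, M)`. -/
def partValue (k s M : ℕ) : ℕ := ∑ t ∈ Finset.range (16 / M), pairValue k (s + t * M)

/-- The approximation of `32 - G_j`. -/
def periodValue (j : ℕ) : ℕ :=
  eval (seed (3 ^ (j - 1) % 65537)) fun V => eval (doubles 32 V) (orbitSum 16)

theorem mod_le (a : ℕ) : a % 65537 ≤ 65537 := (Nat.mod_lt _ (by norm_num)).le

theorem abs_pairValue_sub_le {k i : ℕ} (hi : 1 ≤ i) (hi' : i ≤ 16) :
    |(pairValue k i : ℝ) - 2 ^ 128 * (2 - p (pairNo k i))| ≤ 2 ^ 103 := by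
  obtain ⟨i, rfl⟩ := Nat.exists_eq_add_of_le' hi
  have h := ((approx_seed (mod_le (3 ^ (k - 1)))).doubles (31 + (i + 1))).2
  rw [show (2 : ℝ) ^ (31 + (i + 1)) * (2 * Real.pi * (3 ^ (k - 1) % 65537 : ℕ) / 65537 / 2 ^ 32) =
    2 ^ i * (2 * Real.pi * (3 ^ (k - 1) % 65537 : ℕ) / 65537) by
      rw [show 31 + (i + 1) = 32 + i by ring, pow_add]; ring, ← p_pairNo_eq] at h
  refine h.trans ?_
  have h5 : (4 : ℝ) ^ (0 + (31 + (i + 1))) ≤ 4 ^ 47 := pow_le_pow_right₀ (by norm_num) (by omega)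
  calc (4 : ℝ) ^ (0 + (31 + (i + 1))) * 500 - 1 / 3 ≤ 4 ^ 47 * 500 - 1 / 3 := by gcongr
    _ ≤ _ := by norm_num

theorem abs_partValue_sub_le {k s M : ℕ} (hM : M ∣ 16) (hs : s ∈ Finset.Icc 1 M) :
    |(partValue k s M : ℝ) - 2 ^ 128 * (32 / M - Gpart k s M)| ≤ 2 ^ 107 := by
  rw [Finset.mem_Icc] at hs
  obtain ⟨K, hK⟩ := hM
  have hM0 : 0 < M := by omega
  have hK1 : 16 / M = K := by rw [hK]; exact Nat.mul_div_cancel_left _ hM0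
  have hK2 : (32 / M : ℝ) = ∑ t ∈ Finset.range K, 2 := by
    have : (16 : ℝ) = M * K := by exact_mod_cast hK
    have hMR : (M : ℝ) ≠ 0 := by exact_mod_cast hM0.ne'
    rw [Finset.sum_const, Finset.card_range, nsmul_eq_mul, div_eq_iff hMR]
    linarith
  rw [partValue, Gpart, hK1, hK2, ← Finset.sum_sub_distrib, Finset.mul_sum, Nat.cast_sum,
    ← Finset.sum_sub_distrib]
  refine (Finset.abs_sum_le_sum_abs _ _).trans ?_
  calc ∑ t ∈ Finset.range K,
        |(pairValue k (s + t * M) : ℝ) - 2 ^ 128 * (2 - p (pairNo k (s + t * M)))|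
      ≤ ∑ t ∈ Finset.range K, (2 : ℝ) ^ 103 := by
        refine Finset.sum_le_sum fun t ht => abs_pairValue_sub_le (by omega) ?_
        rw [Finset.mem_range] at ht
        have : t * M ≤ (K - 1) * M := Nat.mul_le_mul_right _ (by omega)
        have h3 : (K - 1) * M + M = K * M := by rw [← Nat.succ_mul]; congr 1; omega
        have : K * M = 16 := by rw [hK, mul_comm]
        omega
    _ = K * 2 ^ 103 := by rw [Finset.sum_const, Finset.card_range, nsmul_eq_mul]
    _ ≤ 16 * 2 ^ 103 := by
        have : K ≤ 16 := by rw [hK]; exact Nat.le_mul_of_pos_left _ hM0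
        gcongr
        exact_mod_cast this
    _ = 2 ^ 107 := by norm_num

/-- A comparison of two parts of invariant sets by means of their approximations. Note that the
approximations decrease with the parts. -/
theorem Gpart_lt_Gpart {k s l t M : ℕ} (hM : M ∣ 16) (hs : s ∈ Finset.Icc 1 M)
    (ht : t ∈ Finset.Icc 1 M) (h : partValue k s M + 2 ^ 109 ≤ partValue l t M) :
    Gpart l t M < Gpart k s M := by
  have h1 := abs_partValue_sub_le (k := k) hM hs
  have h2 := abs_partValue_sub_le (k := l) hM ht
  have h3 : (partValue k s M : ℝ) + 2 ^ 109 ≤ partValue l t M := by exact_mod_cast h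
  rw [abs_le] at h1 h2
  have h4 : (0 : ℝ) < 2 ^ 128 * (Gpart k s M - Gpart l t M) := by linarith [h1.1, h1.2, h2.1, h2.2]
  linarith [pos_of_mul_pos_right h4 (by positivity)]

theorem abs_periodValue_sub_le {j : ℕ} :
    |(periodValue j : ℝ) - 2 ^ 128 * (32 - G j)| ≤ 2 ^ 107 := by
  have h := ((approx_seed (mod_le (3 ^ (j - 1)))).doubles 32).orbitSum 16
  have h1 : ∀ i, (2 : ℝ) ^ i *
      (2 ^ 32 * (2 * Real.pi * (3 ^ (j - 1) % 65537 : ℕ) / 65537 / 2 ^ 32)) =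
    2 ^ i * (2 * Real.pi * (3 ^ (j - 1) % 65537 : ℕ) / 65537) := by intro i; ring
  have h2 : ∑ i ∈ Finset.range 16, (2 - 2 * Real.cos (2 ^ i *
      (2 ^ 32 * (2 * Real.pi * (3 ^ (j - 1) % 65537 : ℕ) / 65537 / 2 ^ 32)))) = 32 - G j := by
    simp only [h1]
    rw [G, sum_Icc_one, Finset.sum_sub_distrib]
    congr 1
    · norm_num
    · exact Finset.sum_congr rfl fun i _ => p_pairNo_eq.symm
  rw [h2] at h
  refine h.trans ?_
  norm_num

/-- Membership in a list of natural numbers, in a form suited to evaluation. -/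
def memb (j : ℕ) (l : List ℕ) : Bool :=
  eval j fun j => List.rec false (fun a _ ih => cond (Nat.beq j a) true ih) l

theorem memb_eq_true_iff {j : ℕ} {l : List ℕ} : memb j l = true ↔ j ∈ l := by
  induction l with
  | nil => simp [memb, eval_eq]
  | cons a l ih =>
    have h : memb j (a :: l) = cond (Nat.beq j a) true (memb j l) := rfl
    rw [h, List.mem_cons, ← ih, ← Nat.beq_eq]
    cases Nat.beq j a <;> simp

/-- The indices `j` of the values `F(j, 2 ^ m)` which are split in step `m + 1`. -/
def IsSplit (m j : ℕ) : Prop := m ≤ 8 ∨ (m = 9 ∧ j ∈ split10) ∨ (m = 10 ∧ j ∈ split11)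

/-- The information which of the two parts of `F(j, 2 ^ m)` is the larger one. -/
def PartsOrdered (m j : ℕ) : Prop :=
  (j ∈ larger (m + 1) → F (j + 2 ^ m) (2 ^ (m + 1)) < F j (2 ^ (m + 1))) ∧
  (j ∉ larger (m + 1) → IsSplit m j → F j (2 ^ (m + 1)) < F (j + 2 ^ m) (2 ^ (m + 1)))

/-- The margin `2 ^ 119` for the comparison of approximations. -/
def margin : ℕ := 664613997892457936451903530140172288

theorem margin_eq : margin = 2 ^ 119 := by norm_num [margin]

/-- The comparison of the approximations `a` and `b` which belong to the two parts of `F(j, 2 ^ m)`.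
The larger part has the smaller approximation. -/
def compareParts (m j a b : ℕ) : Bool :=
  cond (memb j (larger (m + 1))) (Nat.ble (Nat.add a margin) b)
    (cond (cond (Nat.ble m 8) true (memb j (cond (Nat.beq m 9) split10 split11)))
      (Nat.ble (Nat.add b margin) a) true)

/-- The approximation of `2 ^ (d + 5) - F(j, 2 ^ m)`, where `m + d = 11`, calculated from those of the
invariant sets, or `0` if one of the comparisons fails that are made on the way. -/
def checkedValue (d : ℕ) : ℕ → ℕ → ℕ :=
  Nat.rec (fun _ j => periodValue j)
    (fun _ ih m j => eval (ih (m + 1) j) fun a => eval (ih (m + 1) (j + 2 ^ m)) fun b =>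
      cond (compareParts m j a b)
        (cond (Nat.beq a 0) 0 (cond (Nat.beq b 0) 0 (Nat.add a b))) 0) d

theorem checkedValue_ne_zero : checkedValue 11 0 1 ≠ 0 := by decide +kernel

theorem compareParts_iff {m j a b : ℕ} (h : compareParts m j a b = true) :
    (j ∈ larger (m + 1) → a + margin ≤ b) ∧
    (j ∉ larger (m + 1) → IsSplit m j → b + margin ≤ a) := by
  rw [compareParts] at h
  generalize margin = W at h ⊢
  rw [← memb_eq_true_iff]
  by_cases h1 : memb j (larger (m + 1)) = true
  · rw [h1, Bool.cond_true] at h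
    rw [h1]
    exact ⟨fun _ => Nat.le_of_ble_eq_true h, fun h2 => absurd rfl h2⟩
  · refine ⟨fun h2 => absurd h2 h1, fun _ hs => ?_⟩
    rw [Bool.not_eq_true] at h1
    rw [h1] at h
    have h3 : (cond (Nat.ble m 8) true (memb j (cond (Nat.beq m 9) split10 split11))) = true := by
      rcases hs with hm | ⟨rfl, hm⟩ | ⟨rfl, hm⟩
      · rw [Nat.ble_eq_true_of_le hm]; rfl
      · rw [show Nat.ble 9 8 = false from rfl, Bool.cond_false, show Nat.beq 9 9 = true from rfl,
          Bool.cond_true, memb_eq_true_iff]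
        exact hm
      · rw [show Nat.ble 10 8 = false from rfl, Bool.cond_false,
          show Nat.beq 10 9 = false from rfl, Bool.cond_false, memb_eq_true_iff]
        exact hm
    rw [h3, Bool.cond_false, Bool.cond_true] at h
    exact Nat.le_of_ble_eq_true h

theorem F_add_F_pow {m : ℕ} (hm : m ≤ 10) (j : ℕ) :
    F j (2 ^ (m + 1)) + F (j + 2 ^ m) (2 ^ (m + 1)) = F j (2 ^ m) := by
  rw [pow_succ']
  refine F_add_F ?_ j
  rw [← pow_succ', show 2048 = 2 ^ 11 by norm_num]
  exact pow_dvd_pow 2 (by omega)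

/-- A value other than `0` is a good approximation, and it witnesses that all comparisons succeed which
belong to the descendants `F(j + 2 ^ m * i, 2 ^ (m + e))` of `F(j, 2 ^ m)`. -/
theorem checkedValue_spec (d : ℕ) {m j : ℕ} (hd : m + d = 11) (h : checkedValue d m j ≠ 0) :
    |(checkedValue d m j : ℝ) - 2 ^ 128 * (32 * 2 ^ d - F j (2 ^ m))| ≤ 2 ^ d * 2 ^ 107 ∧
      ∀ e < d, ∀ i < 2 ^ e, PartsOrdered (m + e) (j + 2 ^ m * i) := by
  induction d generalizing m j with
  | zero =>
    obtain rfl : m = 11 := hd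
    refine ⟨?_, fun e he => absurd he (Nat.not_lt_zero e)⟩
    rw [show 2 ^ 11 = 2048 by norm_num, F_level_top, pow_zero, mul_one, one_mul]
    exact abs_periodValue_sub_le
  | succ d ih =>
    set a := checkedValue d (m + 1) j with ha
    set b := checkedValue d (m + 1) (j + 2 ^ m) with hb
    have hval : checkedValue (d + 1) m j = cond (compareParts m j a b)
        (cond (Nat.beq a 0) 0 (cond (Nat.beq b 0) 0 (Nat.add a b))) 0 := rfl
    rw [hval] at h ⊢
    have h1 : compareParts m j a b = true := by
      by_contra hc
      rw [Bool.not_eq_true] at hc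
      rw [hc] at h
      exact h rfl
    rw [h1] at h ⊢
    have h2 : a ≠ 0 := by
      intro h0
      rw [h0] at h
      exact h rfl
    have h3 : b ≠ 0 := by
      intro h0
      rw [h0] at h
      cases hab : Nat.beq a 0 <;> rw [hab] at h <;> exact h rfl
    have h4 : Nat.beq a 0 = false := Bool.eq_false_iff.2 fun h0 => h2 (Nat.beq_eq.mp h0)
    have h5 : Nat.beq b 0 = false := Bool.eq_false_iff.2 fun h0 => h3 (Nat.beq_eq.mp h0)
    rw [h4, h5]
    obtain ⟨ia, ga⟩ := ih (m := m + 1) (by omega) h2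
    obtain ⟨ib, gb⟩ := ih (m := m + 1) (by omega) h3
    rw [← ha] at ia
    rw [← hb] at ib
    rw [abs_le] at ia ib
    have hcast : ((cond true (cond false 0 (cond false 0 (Nat.add a b))) 0 : ℕ) : ℝ) = a + b := by
      rw [← Nat.cast_add]; rfl
    refine ⟨?_, ?_⟩
    · rw [hcast, ← F_add_F_pow (by omega : m ≤ 10) j, abs_le, pow_succ]
      constructor <;> linarith [ia.1, ia.2, ib.1, ib.2]
    · have hdle : (2 : ℝ) ^ d ≤ 2 ^ 10 := pow_le_pow_right₀ (by norm_num) (by omega)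
      intro e he i hi
      cases e with
      | zero =>
        obtain rfl : i = 0 := by simpa using hi
        obtain ⟨c1, c2⟩ := compareParts_iff h1
        rw [margin_eq] at c1 c2
        rw [add_zero, mul_zero, add_zero]
        refine ⟨fun hj => ?_, fun hj hs => ?_⟩
        · have h6 : (a : ℝ) + 2 ^ 119 ≤ b := by exact_mod_cast c1 hj
          have h7 : (0 : ℝ) < 2 ^ 128 * (F j (2 ^ (m + 1)) - F (j + 2 ^ m) (2 ^ (m + 1))) := by
            linarith [ia.1, ia.2, ib.1, ib.2]
          linarith [pos_of_mul_pos_right h7 (by positivity)]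
        · have h6 : (b : ℝ) + 2 ^ 119 ≤ a := by exact_mod_cast c2 hj hs
          have h7 : (0 : ℝ) < 2 ^ 128 * (F (j + 2 ^ m) (2 ^ (m + 1)) - F j (2 ^ (m + 1))) := by
            linarith [ia.1, ia.2, ib.1, ib.2]
          linarith [pos_of_mul_pos_right h7 (by positivity)]
      | succ e =>
        rw [pow_succ] at hi
        rw [show m + (e + 1) = m + 1 + e by ring]
        rcases Nat.mod_two_eq_zero_or_one i with h0 | h0
        · have := ga e (by omega) (i / 2) (by omega)
          rwa [show j + 2 ^ (m + 1) * (i / 2) = j + 2 ^ m * i by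
            rw [pow_succ, mul_assoc]; congr 2; omega] at this
        · have := gb e (by omega) (i / 2) (by omega)
          rwa [show j + 2 ^ m + 2 ^ (m + 1) * (i / 2) = j + 2 ^ m * i by
            rw [pow_succ, mul_assoc, add_assoc, ← mul_one_add]; congr 2; omega] at this

theorem partsOrdered {m j : ℕ} (hm : m ≤ 10) (hj : j ∈ Finset.Icc 1 (2 ^ m)) : PartsOrdered m j := by
  rw [Finset.mem_Icc] at hj
  have h := (checkedValue_spec 11 (m := 0) (j := 1) (by norm_num) checkedValue_ne_zero).2 m
    (by omega) (j - 1) (by omega)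
  rwa [zero_add, pow_zero, one_mul, show 1 + (j - 1) = j by omega] at h

theorem splits_of {s q a b : ℝ} (hs : a + b = s) (hq : a * b = q) (h : b < a) : Splits s q a b := by
  have h1 : Real.sqrt (s ^ 2 - 4 * q) = a - b := by
    rw [← hs, ← hq, show (a + b) ^ 2 - 4 * (a * b) = (a - b) ^ 2 by ring,
      Real.sqrt_sq (by linarith)]
  refine ⟨hs, hq, h, ?_, ?_⟩ <;> rw [h1, ← hs] <;> ring

theorem splitsBy_of {first : Prop} {s q a b : ℝ} (hs : a + b = s) (hq : a * b = q)
    (h1 : first → b < a) (h2 : ¬ first → a < b) : SplitsBy first s q a b :=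
  ⟨fun h => splits_of hs hq (h1 h),
    fun h => splits_of (by rw [add_comm, hs]) (by rw [mul_comm, hq]) (h2 h)⟩

theorem splitsBy_F {m : ℕ} (hm : m ≤ 10) {j : ℕ} (hj : j ∈ Finset.Icc 1 (2 ^ m))
    (hs : IsSplit m j) : SplitsBy (j ∈ larger (m + 1)) (F j (2 ^ m))
      (prodF (m + 1) (fun k => F k (2 ^ m)) j) (F j (2 ^ (m + 1))) (F (j + 2 ^ m) (2 ^ (m + 1))) :=
  splitsBy_of (F_add_F_pow hm j)
    (F_mul_F_eq_prodF (m := m + 1) (Finset.mem_Icc.2 ⟨by omega, by omega⟩) hj)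
    (partsOrdered hm hj).1 fun h => (partsOrdered hm hj).2 h hs

theorem splitsBy_half {k : ℕ} (hk : k ∈ split12) :
    SplitsBy (k = 1) (G k) (prod12 G k) (Gpart k 1 2) (Gpart k 2 2) := by
  have h1 : ∀ k ∈ split12, k = 1 → partValue k 1 2 + 2 ^ 109 ≤ partValue k 2 2 := by decide +kernel
  have h2 : ∀ k ∈ split12, k ≠ 1 → partValue k 2 2 + 2 ^ 109 ≤ partValue k 1 2 := by decide +kernel
  refine splitsBy_of ?_ (Gpart_mul_Gpart_eq_prod12 hk)
    (fun h => Gpart_lt_Gpart (by norm_num) (by simp) (by simp) (h1 k hk h))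
    (fun h => Gpart_lt_Gpart (by norm_num) (by simp) (by simp) (h2 k hk h))
  rw [G_eq_Gpart]
  exact Gpart_add_Gpart (M := 1) (by norm_num) k le_rfl

theorem splitsBy_quarter {k s : ℕ} (hk : k ∈ [1, 1025]) (hs : s ∈ [1, 2]) :
    SplitsBy (¬ (k = 1025 ∧ s = 2)) (Gpart k s 2)
      (prod13 (fun l t => Gpart l t 2) k s) (Gpart k s 4) (Gpart k (s + 2) 4) := by
  have hcheck : (∀ k ∈ [1, 1025], ∀ s ∈ [1, 2], ¬ (k = 1025 ∧ s = 2) →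
      partValue k s 4 + 2 ^ 109 ≤ partValue k (s + 2) 4) ∧
      partValue 1025 (2 + 2) 4 + 2 ^ 109 ≤ partValue 1025 2 4 := by decide +kernel
  have hs' : 1 ≤ s ∧ s ≤ 2 := by
    simp only [List.mem_cons, List.not_mem_nil, or_false] at hs
    omega
  have hs1 : s ∈ Finset.Icc 1 4 := Finset.mem_Icc.2 ⟨hs'.1, by linarith [hs'.2]⟩
  have hs2 : s + 2 ∈ Finset.Icc 1 4 := Finset.mem_Icc.2 ⟨by linarith [hs'.1], by linarith [hs'.2]⟩
  refine splitsBy_of (Gpart_add_Gpart (M := 2) (by norm_num) k hs'.1)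
    (Gpart_mul_Gpart_eq_prod13 hk hs) (fun h => ?_) (fun h => ?_)
  · exact Gpart_lt_Gpart (by norm_num) hs1 hs2 (hcheck.1 k hk s hs h)
  · obtain ⟨rfl, rfl⟩ := not_not.1 h
    exact Gpart_lt_Gpart (by norm_num) (by simp) (by simp) hcheck.2

theorem splits_eighth {s : ℕ} (hs : s ∈ [1, 2]) :
    Splits (Gpart 1 s 4) (prod14 (fun l t => Gpart l t 4) s) (Gpart 1 s 8) (Gpart 1 (s + 4) 8) := by
  have h1 : ∀ s ∈ [1, 2], partValue 1 s 8 + 2 ^ 109 ≤ partValue 1 (s + 4) 8 := by decide +kernel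
  have hs' : 1 ≤ s ∧ s ≤ 2 := by
    simp only [List.mem_cons, List.not_mem_nil, or_false] at hs
    omega
  exact splits_of (Gpart_add_Gpart (M := 4) (by norm_num) 1 hs'.1) (Gpart_mul_Gpart_eq_prod14 hs)
    (Gpart_lt_Gpart (by norm_num) (Finset.mem_Icc.2 ⟨hs'.1, by linarith [hs'.2]⟩)
      (Finset.mem_Icc.2 ⟨by linarith [hs'.1], by linarith [hs'.2]⟩) (h1 s hs))

theorem splits_pair :
    Splits (Gpart 1 1 8) (prod15 (fun t => Gpart 1 t 8)) (p 1) (p 256) := by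
  have h1 : partValue 1 1 16 + 2 ^ 109 ≤ partValue 1 9 16 := by decide +kernel
  have h2 := Gpart_add_Gpart (M := 8) (by norm_num) 1 (s := 1) le_rfl
  have h3 : Gpart 1 9 16 < Gpart 1 1 16 :=
    Gpart_lt_Gpart (by norm_num) (by simp) (by simp) h1
  rw [Gpart_one_nine_sixteen, Gpart_one_one_sixteen] at h3
  norm_num [Gpart_one_nine_sixteen, Gpart_one_one_sixteen] at h2
  exact splits_of h2 p_mul_p_eq_prod15 h3

/-! ### The chain of square roots -/

theorem SplitsBy.root_eq {first : Prop} [Decidable first] {s q a b : ℝ} (h : SplitsBy first s q a b) :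
    root first s q = a := by
  rw [root]
  split_ifs with hf
  · exact (h.1 hf).2.2.2.1.symm
  · exact (h.2 hf).2.2.2.2.symm

theorem SplitsBy.root_not_eq {first second : Prop} [Decidable second] {s q a b : ℝ}
    (h : SplitsBy first s q a b) (h2 : second ↔ ¬ first) : root second s q = b := by
  rw [root]
  split_ifs with hf
  · exact (h.2 (h2.1 hf)).2.2.2.1.symm
  · exact (h.1 (not_not.1 fun hn => hf (h2.2 hn))).2.2.2.2.symm

theorem Splits.splitsBy {s q a b : ℝ} (h : Splits s q a b) : SplitsBy True s q a b :=
  ⟨fun _ => h, fun hn => absurd trivial hn⟩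

theorem prodF_congr {m : ℕ} (hm : m ∈ Finset.Icc 1 10) {v w : ℕ → ℝ}
    (h : ∀ k ∈ Finset.Icc 1 (2 ^ (m - 1)), v k = w k) {j : ℕ} (hj : j ∈ Finset.Icc 1 (2 ^ (m - 1))) :
    prodF m v j = prodF m w j := by
  have h' : ∀ k, v (rho k (2 ^ (m - 1))) = w (rho k (2 ^ (m - 1))) :=
    fun k => h _ (rho_mem _ (by positivity))
  have h0 := h j hj
  rw [Finset.mem_Icc] at hm
  obtain ⟨hm1, hm2⟩ := hm
  interval_cases m <;> norm_num [prodF] at h' ⊢ <;> simp only [h', h0]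

theorem radStep_eq {m : ℕ} (hm : m ≤ 10) {v : ℕ → ℝ} {j : ℕ} (hj : j ∈ Finset.Icc 1 (2 ^ m))
    (hs : IsSplit m j) (hv : v j = F j (2 ^ m))
    (hp : prodF (m + 1) v j = prodF (m + 1) (fun k => F k (2 ^ m)) j) :
    radStep (m + 1) v j = F j (2 ^ (m + 1)) ∧
      radStep (m + 1) v (j + 2 ^ m) = F (j + 2 ^ m) (2 ^ (m + 1)) := by
  have h := splitsBy_F hm hj hs
  rw [Finset.mem_Icc] at hj
  constructor
  · rw [radStep, Nat.add_sub_cancel, if_pos hj.2, hv, hp]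
    exact h.root_eq
  · rw [radStep, Nat.add_sub_cancel, if_neg (by omega), Nat.add_sub_cancel, hv, hp]
    exact h.root_not_eq Iff.rfl

theorem radF_eq {m : ℕ} (hm : m ≤ 9) {j : ℕ} (hj : j ∈ Finset.Icc 1 (2 ^ m)) :
    radF m j = F j (2 ^ m) := by
  induction m generalizing j with
  | zero =>
    obtain rfl : j = 1 := by simpa using hj
    rw [pow_zero, F_one, radF]
  | succ m ih =>
    have key : ∀ i ∈ Finset.Icc 1 (2 ^ m), radStep (m + 1) (radF m) i = F i (2 ^ (m + 1)) ∧
        radStep (m + 1) (radF m) (i + 2 ^ m) = F (i + 2 ^ m) (2 ^ (m + 1)) := by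
      intro i hi
      refine radStep_eq (by omega) hi (Or.inl (by omega)) (ih (by omega) hi) ?_
      exact prodF_congr (Finset.mem_Icc.2 ⟨by omega, by omega⟩) (fun k hk => ih (by omega) hk) hi
    change radStep (m + 1) (radF m) j = _
    rw [Finset.mem_Icc, pow_succ] at hj
    rcases le_or_gt j (2 ^ m) with h | h
    · exact (key j (Finset.mem_Icc.2 ⟨hj.1, h⟩)).1
    · have := (key (j - 2 ^ m) (Finset.mem_Icc.2 ⟨by omega, by omega⟩)).2
      rwa [Nat.sub_add_cancel h.le] at this

theorem needed11_subset : ∀ i ∈ needed11, 1 ≤ i ∧ i ≤ 1024 := by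
  have h : (needed11.all fun i => Nat.ble 1 i && Nat.ble i 1024) = true := by decide +kernel
  simpa only [List.all_eq_true, Bool.and_eq_true, Nat.ble_eq] using h

theorem mem_split10_iff (i : ℕ) :
    i ∈ split10 ↔ i ∈ Finset.Icc 1 512 ∧ (i ∈ needed11 ∨ i + 512 ∈ needed11) := by
  have h1 : (split10.all fun i => (Nat.ble 1 i && Nat.ble i 512) &&
      (memb i needed11 || memb (i + 512) needed11)) = true := by decide +kernel
  have h2 : (needed11.all fun i => memb i split10 || !Nat.ble i 512) = true := by decide +kernel
  have h3 : (needed11.all fun i => memb (i - 512) split10 || Nat.ble i 512) = true := by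
    decide +kernel
  simp only [List.all_eq_true, Bool.and_eq_true, Bool.or_eq_true, Nat.ble_eq, memb_eq_true_iff,
    Bool.not_eq_true', ← Bool.not_eq_true] at h1 h2 h3
  rw [Finset.mem_Icc]
  refine ⟨h1 i, ?_⟩
  rintro ⟨⟨hi, hi'⟩, h | h⟩
  · exact (h2 i h).resolve_right (by simpa using hi')
  · have h4 := h3 _ h
    rw [Nat.add_sub_cancel] at h4
    exact h4.resolve_right (Nat.not_le.2 (Nat.lt_add_of_pos_left hi))

theorem mem_both10_iff (i : ℕ) :
    i ∈ both10 ↔ i ∈ Finset.Icc 1 512 ∧ i ∈ needed11 ∧ i + 512 ∈ needed11 := by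
  have h1 : (both10.all fun i => (Nat.ble 1 i && Nat.ble i 512) &&
      (memb i needed11 && memb (i + 512) needed11)) = true := by decide +kernel
  have h2 : (needed11.all fun i => memb i both10 || !memb (i + 512) needed11) = true := by
    decide +kernel
  simp only [List.all_eq_true, Bool.and_eq_true, Bool.or_eq_true, Nat.ble_eq, memb_eq_true_iff,
    Bool.not_eq_true', ← Bool.not_eq_true] at h1 h2
  rw [Finset.mem_Icc]
  refine ⟨h1 i, ?_⟩
  rintro ⟨-, h, h'⟩
  exact (h2 i h).resolve_right (by simpa using h')

theorem rho_terms {j t : ℕ} (hj : 1 ≤ j) (ht : 1 ≤ t) :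
    rho (t + j - 1) 1024 = Nat.add (Nat.mod (Nat.sub (Nat.add t j) 2) 1024) 1 := by
  change _ = (t + j - 2) % 1024 + 1
  rw [← rho_succ _ (by norm_num)]
  congr 1
  omega

theorem split11_subset : ∀ i ∈ split11, i ∈ Finset.Icc 1 1024 := by decide +kernel

theorem mem_needed11_iff (i : ℕ) : i ∈ needed11 ↔
    i ∈ split11 ∨ ∃ j ∈ split11, ∃ t ∈ terms11, i = rho (t.2 + j - 1) 1024 := by
  have h1 : (needed11.all fun i => memb i split11 || memb i (split11.flatMap fun j =>
      terms11.map fun t => Nat.add (Nat.mod (Nat.sub (Nat.add t.2 j) 2) 1024) 1)) = true := by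
    decide +kernel
  have h2 : (split11.all fun i => memb i needed11) = true := by decide +kernel
  have h3 : (split11.all fun j => terms11.all fun t =>
      memb (Nat.add (Nat.mod (Nat.sub (Nat.add t.2 j) 2) 1024) 1) needed11) = true := by
    decide +kernel
  have h4 : ∀ t ∈ terms11, 1 ≤ t.2 := by decide
  have hr : ∀ j ∈ split11, ∀ t ∈ terms11, rho (t.2 + j - 1) 1024 =
      Nat.add (Nat.mod (Nat.sub (Nat.add t.2 j) 2) 1024) 1 := fun j hj t ht =>
    rho_terms (Finset.mem_Icc.1 (split11_subset j hj)).1 (h4 t ht)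
  simp only [List.all_eq_true, Bool.or_eq_true, memb_eq_true_iff, List.mem_flatMap,
    List.mem_map] at h1 h2 h3
  constructor
  · intro h
    rcases h1 i h with h' | ⟨j, hj, t, ht, rfl⟩
    · exact Or.inl h'
    · exact Or.inr ⟨j, hj, t, ht, (hr j hj t ht).symm⟩
  · rintro (h | ⟨j, hj, t, ht, rfl⟩)
    · exact h2 i h
    · rw [hr j hj t ht]
      exact h3 j hj t ht

theorem terms12_complete :
    ∀ k ∈ split12, rho k 1024 ∈ split11 ∧ ∀ l ∈ terms12 k, rho l 1024 ∈ split11 := by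
  simp only [← memb_eq_true_iff (l := split11)]
  decide +kernel

theorem radF10_eq {j : ℕ} (hj : j ∈ needed11) : radF10 j = F j 1024 := by
  have key : ∀ i ∈ split10, radStep 10 (radF 9) i = F i 1024 ∧
      radStep 10 (radF 9) (i + 512) = F (i + 512) 1024 := by
    intro i hi
    have hi' := ((mem_split10_iff i).1 hi).1
    exact radStep_eq (m := 9) (by norm_num) hi' (Or.inr (Or.inl ⟨rfl, hi⟩)) (radF_eq le_rfl hi')
      (prodF_congr (m := 10) (by simp) (fun k hk => radF_eq le_rfl hk) hi')
  rw [radF10, if_pos hj]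
  have hj' := needed11_subset j hj
  rcases le_or_gt j 512 with h | h
  · exact (key j ((mem_split10_iff j).2 ⟨Finset.mem_Icc.2 ⟨hj'.1, h⟩, Or.inl hj⟩)).1
  · have h1 : j - 512 + 512 = j := Nat.sub_add_cancel h.le
    have := (key (j - 512) ((mem_split10_iff _).2
      ⟨Finset.mem_Icc.2 ⟨by omega, by omega⟩, Or.inr (by rwa [h1])⟩)).2
    rwa [h1] at this

theorem rho_add_self (k M : ℕ) : rho (k + M) M = rho k M := by
  rw [rho, rho, Nat.add_mod_right]
  simp only [Nat.dvd_add_self_right]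

theorem radG_eq {j : ℕ} (hj : j ∈ split11) :
    radG j = G j ∧ radG (j + 1024) = G (j + 1024) := by
  have hj' := split11_subset j hj
  have h1 : rho j 1024 = j := rho_eq_self hj'
  have h2 : rho (j + 1024) 1024 = j := by rw [rho_add_self, h1]
  have h3 : prodF 11 radF10 j = prodF 11 (fun k => F k 1024) j := by
    simp only [prodF]
    refine congrArg List.sum (List.map_congr_left fun t ht => by
      rw [radF10_eq ((mem_needed11_iff _).2 (Or.inr ⟨j, hj, t, ht, rfl⟩))])
  have h := radStep_eq (m := 10) le_rfl hj' (Or.inr (Or.inr ⟨rfl, hj⟩))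
    (radF10_eq ((mem_needed11_iff j).2 (Or.inl hj))) h3
  rw [radG, radG, h1, h2, if_pos hj, if_pos hj, ← F_level_top, ← F_level_top]
  exact h

theorem radG_eq_of_rho {l : ℕ} (h1 : 1 ≤ l ∧ l ≤ 2048) (h : rho l 1024 ∈ split11) :
    radG l = G l := by
  rcases le_or_gt l 1024 with h2 | h2
  · rw [rho_eq_self (Finset.mem_Icc.2 ⟨h1.1, h2⟩)] at h
    exact (radG_eq h).1
  · have h3 : rho l 1024 = l - 1024 := by
      rw [rho_eq_iff (Finset.mem_Icc.2 ⟨by omega, by omega⟩), Nat.ModEq]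
      omega
    rw [h3] at h
    have := (radG_eq h).2
    rwa [Nat.sub_add_cancel h2.le] at this

theorem radHalf_eq {k s : ℕ} (hk : k ∈ split12) (hs : s ∈ [1, 2]) : radHalf k s = Gpart k s 2 := by
  have hsub : ∀ k ∈ split12, (1 ≤ k ∧ k ≤ 2048) ∧ ∀ l ∈ terms12 k, 1 ≤ l ∧ l ≤ 2048 := by
    decide +kernel
  have hG : radG k = G k := radG_eq_of_rho (hsub k hk).1 (terms12_complete k hk).1
  have hp : prod12 radG k = prod12 G k := by
    rw [prod12, prod12, hG]
    congr 2
    exact List.map_congr_left fun l hl =>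
      radG_eq_of_rho ((hsub k hk).2 l hl) ((terms12_complete k hk).2 l hl)
  simp only [List.mem_cons, List.not_mem_nil, or_false] at hs
  rw [radHalf, if_pos hk, hG, hp]
  rcases hs with rfl | rfl
  · rw [if_pos rfl]
    exact (splitsBy_half hk).root_eq
  · rw [if_neg (by norm_num)]
    exact (splitsBy_half hk).root_not_eq Iff.rfl

theorem radQuarter_eq {k s : ℕ} (hk : k ∈ [1, 1025]) (hs : s ∈ [1, 2, 3, 4]) :
    radQuarter k s = Gpart k s 4 := by
  have h1 : ∀ s ∈ [1, 2], ∀ k ∈ split12, radHalf k s = Gpart k s 2 :=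
    fun s hs k hk => radHalf_eq hk hs
  have hmem : ∀ k ∈ [1, 1025], k ∈ split12 := by decide
  have hk12 := hmem k hk
  have hp : ∀ s ∈ [1, 2], prod13 radHalf k s = prod13 (fun l t => Gpart l t 2) k s := by
    intro s hs
    simp only [split12, List.mem_cons, List.not_mem_nil, or_false, forall_eq_or_imp, forall_eq] at h1
    simp only [List.mem_cons, List.not_mem_nil, or_false] at hk hs
    rcases hk with rfl | rfl <;> rcases hs with rfl | rfl <;> simp only [prod13, h1]
  have hk' : k = 1 ∨ k = 1025 := by simpa using hk
  rw [radQuarter, if_pos hk']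
  have hs' : s ∈ [1, 2] ∨ ∃ t ∈ [1, 2], s = t + 2 := by
    revert s
    decide
  rcases hs' with h | ⟨t, h, rfl⟩
  · have : s ≤ 2 := by
      simp only [List.mem_cons, List.not_mem_nil, or_false] at h
      omega
    rw [if_pos this, hp s h, radHalf_eq hk12 h]
    exact (splitsBy_quarter hk h).root_eq
  · have : ¬ t + 2 ≤ 2 := by
      simp only [List.mem_cons, List.not_mem_nil, or_false] at h
      omega
    rw [if_neg this, Nat.add_sub_cancel, hp t h, radHalf_eq hk12 h]
    exact (splitsBy_quarter hk h).root_not_eq not_not.symm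

theorem radEighth_eq {s : ℕ} (hs : s ∈ [1, 2]) : radEighth s = Gpart 1 s 8 := by
  have h1 : ∀ s ∈ [1, 2, 3, 4], ∀ k ∈ [1, 1025], radQuarter k s = Gpart k s 4 :=
    fun s hs k hk => radQuarter_eq hk hs
  simp only [List.mem_cons, List.not_mem_nil, or_false, forall_eq_or_imp, forall_eq] at h1
  have hp : prod14 radQuarter s = prod14 (fun l t => Gpart l t 4) s := by
    simp only [List.mem_cons, List.not_mem_nil, or_false] at hs
    rcases hs with rfl | rfl <;> simp only [prod14, h1]
  have hq : radQuarter 1 s = Gpart 1 s 4 := by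
    simp only [List.mem_cons, List.not_mem_nil, or_false] at hs
    rcases hs with rfl | rfl <;> simp only [h1]
  rw [radEighth, hq, hp]
  exact (splits_eighth hs).splitsBy.root_eq

theorem radP1_eq : radP1 = p 1 := by
  have hp : prod15 radEighth = prod15 (fun t => Gpart 1 t 8) := by
    rw [prod15, prod15, radEighth_eq (by simp), radEighth_eq (by simp)]
  rw [radP1, radEighth_eq (by simp), hp]
  exact splits_pair.splitsBy.root_eq

/-! ### Compass and straightedge -/

namespace IsConstructible

theorem mem_line_of_eq {a b x : ℂ} (t : ℝ) (h : x = a + t * (b - a)) : x ∈ line[ℝ, a, b] := by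
  rw [h]
  have := AffineMap.lineMap_mem_affineSpan_pair t a b
  rw [AffineMap.lineMap_apply] at this
  simpa [add_comm] using this

theorem real_mem_line (x : ℝ) : (x : ℂ) ∈ line[ℝ, (0 : ℂ), 1] :=
  mem_line_of_eq x (by simp)

theorem im_eq_zero_of_mem_line {x : ℂ} (h : x ∈ line[ℝ, (0 : ℂ), 1]) : x.im = 0 := by
  obtain ⟨t, rfl⟩ := mem_affineSpan_pair_iff_exists_lineMap_eq.1 h
  simp [AffineMap.lineMap_apply]

theorem of_dist_eq {a b c d x : ℂ} (ha : IsConstructible a) (hb : IsConstructible b)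
    (hc : IsConstructible c) (hd : IsConstructible d) (hab : a ≠ b) (hx : x ∈ line[ℝ, a, b])
    (h : dist x c = dist d 0) : IsConstructible x :=
  .line_circle ha hb hc hd .zero hab hx h

/-- The circle around `a` with radius `|b|` meets the real axis in `a + b`. -/
theorem add_real {a b : ℝ} (ha : IsConstructible (a : ℂ)) (hb : IsConstructible (b : ℂ)) :
    IsConstructible ((a + b : ℝ) : ℂ) := by
  refine of_dist_eq .zero .one ha hb zero_ne_one (real_mem_line _) ?_
  simp

theorem sub_real {a b : ℝ} (ha : IsConstructible (a : ℂ)) (hb : IsConstructible (b : ℂ)) :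
    IsConstructible ((a - b : ℝ) : ℂ) := by
  refine of_dist_eq .zero .one ha hb zero_ne_one (real_mem_line _) ?_
  simp

theorem zero_real : IsConstructible ((0 : ℝ) : ℂ) := by simpa using zero

theorem one_real : IsConstructible ((1 : ℝ) : ℂ) := by simpa using one

theorem neg_real {a : ℝ} (ha : IsConstructible (a : ℂ)) : IsConstructible ((-a : ℝ) : ℂ) := by
  simpa using sub_real zero_real ha

/-- The circles around `1` and `-1` with radius `2` meet in a point of the imaginary axis. -/
theorem sqrt_three_mul_I : IsConstructible (Real.sqrt 3 * Complex.I) := by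
  have h1 := neg_real one_real
  have h2 : dist (Real.sqrt 3 * Complex.I) 1 = 2 ∧
      dist (Real.sqrt 3 * Complex.I) ((-1 : ℝ) : ℂ) = 2 := by
    have h3 : Real.sqrt 3 * Real.sqrt 3 = 3 := Real.mul_self_sqrt (by norm_num)
    constructor <;>
    · rw [Complex.dist_eq, Complex.norm_eq_sqrt_sq_add_sq, Real.sqrt_eq_iff_mul_self_eq] <;>
        simp <;> nlinarith
  have h4 : dist (1 : ℂ) ((-1 : ℝ) : ℂ) = 2 := by
    rw [Complex.dist_eq]; norm_num
  refine circle_circle one one h1 h1 one h1 ?_ (h2.1.trans h4.symm) (h2.2.trans h4.symm)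
  norm_num

theorem real_mul_I {b : ℝ} (hb : IsConstructible (b : ℂ)) : IsConstructible (b * Complex.I) := by
  have h0 : (Real.sqrt 3 : ℂ) ≠ 0 := by
    rw [Ne, Complex.ofReal_eq_zero]; positivity
  refine of_dist_eq zero sqrt_three_mul_I zero hb (mul_ne_zero h0 Complex.I_ne_zero).symm ?_ ?_
  · refine mem_line_of_eq (b / Real.sqrt 3) ?_
    push_cast
    field_simp
    ring
  · simp

/-- The point `a + b i` is a common point of the circle around `a` with radius `|b|` and the circle
around `b i` with radius `|a|`. -/
theorem mk_real {a b : ℝ} (ha : IsConstructible (a : ℂ)) (hb : IsConstructible (b : ℂ)) :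
    IsConstructible (a + b * Complex.I) := by
  by_cases h : (a : ℂ) = b * Complex.I
  · have h1 := congrArg Complex.re h
    simp at h1
    rw [h1, Complex.ofReal_zero, zero_add]
    exact real_mul_I hb
  · refine circle_circle ha hb zero (real_mul_I hb) ha zero h ?_ ?_ <;> simp

/-- The intersection of the real axis with the line through `c` and `d`. -/
theorem real_of_mem_line {c d : ℂ} {x : ℝ} (hc : IsConstructible c) (hd : IsConstructible d)
    (hcd : c ≠ d) (h0 : c.im ≠ 0) (hx : (x : ℂ) ∈ line[ℝ, c, d]) : IsConstructible (x : ℂ) := by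
  refine line_line .zero .one hc hd zero_ne_one hcd ?_ (real_mem_line x) hx
  intro h
  have h1 : c ∈ line[ℝ, (0 : ℂ), 1] := h ▸ left_mem_affineSpan_pair ℝ c d
  exact h0 (im_eq_zero_of_mem_line h1)

/-- The line through `b i` and `a + (b - 1) i` meets the real axis in `a b`. -/
theorem mul_real {a b : ℝ} (ha : IsConstructible (a : ℂ)) (hb : IsConstructible (b : ℂ)) :
    IsConstructible ((a * b : ℝ) : ℂ) := by
  by_cases h0 : b = 0
  · rw [h0, mul_zero]; exact zero_real
  · refine real_of_mem_line (mk_real zero_real hb) (mk_real ha (sub_real hb one_real)) ?_ ?_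
      (mem_line_of_eq b ?_)
    · intro h
      have := congrArg Complex.im h
      simp at this
      linarith
    · simpa using h0
    · push_cast
      ring

/-- The line through `i` and `1 + (1 - a) i` meets the real axis in `1 / a`. -/
theorem inv_real {a : ℝ} (ha : IsConstructible (a : ℂ)) : IsConstructible ((a⁻¹ : ℝ) : ℂ) := by
  by_cases h0 : a = 0
  · rw [h0, inv_zero]; exact zero_real
  · refine real_of_mem_line (mk_real zero_real one_real)
      (mk_real one_real (sub_real one_real ha)) ?_ ?_ (mem_line_of_eq a⁻¹ ?_)
    · intro h
      have := congrArg Complex.re h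
      simp at this
    · simp
    · have : (a : ℂ) ≠ 0 := by exact_mod_cast h0
      push_cast
      field_simp
      ring

theorem div_real {a b : ℝ} (ha : IsConstructible (a : ℂ)) (hb : IsConstructible (b : ℂ)) :
    IsConstructible ((a / b : ℝ) : ℂ) := by
  rw [div_eq_mul_inv]
  exact mul_real ha (inv_real hb)

theorem natCast_real (n : ℕ) : IsConstructible ((n : ℝ) : ℂ) := by
  induction n with
  | zero => simpa using zero
  | succ n ih =>
    have := add_real ih one_real
    push_cast at this ⊢
    exact this

theorem ofNat_real (n : ℕ) [n.AtLeastTwo] : IsConstructible ((OfNat.ofNat n : ℝ) : ℂ) := by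
  exact natCast_real n

/-- The circle with the diameter from `-1` to `a` meets the imaginary axis at height `√a`. -/
theorem sqrt_real {a : ℝ} (ha : IsConstructible (a : ℂ)) : IsConstructible ((Real.sqrt a : ℝ) : ℂ) := by
  rcases le_or_gt a 0 with h0 | h0
  · rw [Real.sqrt_eq_zero_of_nonpos h0]; exact zero_real
  · have hc := div_real (sub_real ha one_real) (ofNat_real 2)
    have hI : IsConstructible (Complex.I) := by simpa using real_mul_I one_real
    have hs : Real.sqrt a * Real.sqrt a = a := Real.mul_self_sqrt h0.le
    have h1 : IsConstructible (Real.sqrt a * Complex.I) := by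
      refine line_circle zero hI hc ha hc Complex.I_ne_zero.symm (mem_line_of_eq (Real.sqrt a) ?_) ?_
      · simp
      · have h2 : dist (a : ℂ) (((a - 1) / 2 : ℝ) : ℂ) = (a + 1) / 2 := by
          rw [Complex.dist_eq, ← Complex.ofReal_sub, Complex.norm_real, Real.norm_eq_abs,
            abs_of_nonneg (by linarith)]
          ring
        rw [h2, Complex.dist_eq, Complex.norm_eq_sqrt_sq_add_sq, Real.sqrt_eq_iff_mul_self_eq]
        · simp
          nlinarith
        · positivity
        · linarith
    refine of_dist_eq zero one zero h1 zero_ne_one (real_mem_line _) ?_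
    simp

theorem list_sum_real {A : Type*} {L : List A} {f : A → ℝ}
    (h : ∀ x ∈ L, IsConstructible ((f x : ℝ) : ℂ)) : IsConstructible (((L.map f).sum : ℝ) : ℂ) := by
  induction L with
  | nil => simpa using zero
  | cons a L ih =>
    rw [List.map_cons, List.sum_cons]
    exact add_real (h a List.mem_cons_self) (ih fun x hx => h x (List.mem_cons_of_mem _ hx))

theorem sum_real {A : Type*} {s : Finset A} {f : A → ℝ}
    (h : ∀ x ∈ s, IsConstructible ((f x : ℝ) : ℂ)) :
    IsConstructible ((∑ x ∈ s, f x : ℝ) : ℂ) := by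
  rw [← Finset.sum_map_toList]
  exact list_sum_real fun x hx => h x (Finset.mem_toList.1 hx)

/-- The two roots of a quadratic equation with constructible coefficients. -/
theorem of_add_mul {s q a b : ℝ} (hs : IsConstructible (s : ℂ)) (hq : IsConstructible (q : ℂ))
    (h1 : a + b = s) (h2 : a * b = q) : IsConstructible (a : ℂ) ∧ IsConstructible (b : ℂ) := by
  have key : ∀ {a b : ℝ}, a + b = s → a * b = q → b ≤ a →
      IsConstructible (a : ℂ) ∧ IsConstructible (b : ℂ) := by
    intro a b h1 h2 hba
    have hr := sqrt_real (sub_real (mul_real hs hs) (mul_real (ofNat_real 4) hq))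
    have h3 : Real.sqrt (s * s - 4 * q) = a - b := by
      rw [← h1, ← h2, show (a + b) * (a + b) - 4 * (a * b) = (a - b) ^ 2 by ring,
        Real.sqrt_sq (by linarith)]
    rw [h3] at hr
    have h4 := div_real (add_real hs hr) (ofNat_real 2)
    have h5 := div_real (sub_real hs hr) (ofNat_real 2)
    rw [← h1, show (a + b + (a - b)) / 2 = a by ring] at h4
    rw [← h1, show (a + b - (a - b)) / 2 = b by ring] at h5
    exact ⟨h4, h5⟩
  rcases le_total b a with h | h
  · exact key h1 h2 h
  · exact (key (by rw [add_comm, h1]) (by rw [mul_comm, h2]) h).symm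

theorem of_splitsBy {first : Prop} {s q a b : ℝ} (hs : IsConstructible (s : ℂ))
    (hq : IsConstructible (q : ℂ)) (h : SplitsBy first s q a b) :
    IsConstructible (a : ℂ) ∧ IsConstructible (b : ℂ) := by
  by_cases hf : first
  · exact of_add_mul hs hq (h.1 hf).1 (h.1 hf).2.1
  · exact (of_add_mul hs hq (h.2 hf).1 (h.2 hf).2.1).symm

theorem prodF {m : ℕ} (hm : m ∈ Finset.Icc 1 11) {v : ℕ → ℝ}
    (hv : ∀ k ∈ Finset.Icc 1 (2 ^ (m - 1)), IsConstructible ((v k : ℝ) : ℂ)) {j : ℕ}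
    (hj : j ∈ Finset.Icc 1 (2 ^ (m - 1))) : IsConstructible ((prodF m v j : ℝ) : ℂ) := by
  have h : ∀ k, IsConstructible ((v (rho k (2 ^ (m - 1))) : ℝ) : ℂ) :=
    fun k => hv _ (rho_mem _ (by positivity))
  have h0 := hv j hj
  rw [Finset.mem_Icc] at hm
  obtain ⟨hm1, hm2⟩ := hm
  have hsum : ∀ (M N : ℕ) (K : ℕ → List ℕ), 2 ^ (m - 1) = M →
      IsConstructible ((∑ i ∈ Finset.Icc (1 : ℕ) N,
        (i : ℝ) * ((K i).map fun k => v (rho (k + j - 1) M)).sum : ℝ) : ℂ) := by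
    rintro M N K rfl
    exact sum_real fun i _ => mul_real (natCast_real i) (list_sum_real fun k _ => h _)
  interval_cases m
  · exact neg_real (ofNat_real 16384)
  · exact neg_real (ofNat_real 4096)
  · exact sub_real (sub_real (neg_real (ofNat_real 1040)) (mul_real (ofNat_real 48) h0))
      (mul_real (ofNat_real 16) (h _))
  · exact add_real (add_real (add_real (add_real (add_real (neg_real (ofNat_real 237))
      (mul_real (ofNat_real 47) h0)) (mul_real (ofNat_real 35) (h _)))
      (mul_real (ofNat_real 19) (h _))) (mul_real (ofNat_real 32) (h _)))
      (mul_real (ofNat_real 19) (h _))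
  · simp only [Gon65537.prodF]
    have h' : ∀ k, IsConstructible ((v (rho k 16) : ℝ) : ℂ) := h
    repeat' first
      | exact h0
      | exact h' _
      | exact ofNat_real _
      | refine add_real ?_ ?_
      | refine sub_real ?_ ?_
      | refine mul_real ?_ ?_
      | refine neg_real ?_
  · exact sum_real fun k _ => mul_real (natCast_real _) (h _)
  · exact hsum 64 10 K64 rfl
  · exact hsum 128 5 K128 rfl
  · exact hsum 256 3 K256 rfl
  · exact hsum 512 2 K512 rfl
  · exact list_sum_real fun t _ => mul_real (natCast_real _) (h _)

theorem F {m : ℕ} (hm : m ≤ 11) {j : ℕ} (hj : j ∈ Finset.Icc 1 (2 ^ m)) :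
    IsConstructible ((F j (2 ^ m) : ℝ) : ℂ) := by
  induction m generalizing j with
  | zero =>
    obtain rfl : j = 1 := by simpa using hj
    rw [pow_zero, F_one]
    exact neg_real one_real
  | succ m ih =>
    have key : ∀ i ∈ Finset.Icc 1 (2 ^ m), IsConstructible ((Gon65537.F i (2 ^ (m + 1)) : ℝ) : ℂ) ∧
        IsConstructible ((Gon65537.F (i + 2 ^ m) (2 ^ (m + 1)) : ℝ) : ℂ) := by
      intro i hi
      have hm' : m + 1 ∈ Finset.Icc 1 11 := Finset.mem_Icc.2 ⟨by omega, by omega⟩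
      exact of_add_mul (ih (by omega) hi)
        (prodF (m := m + 1) hm' (fun k hk => ih (by omega) hk) hi)
        (F_add_F_pow (by omega) i) (F_mul_F_eq_prodF (m := m + 1) hm' hi)
    rw [Finset.mem_Icc, pow_succ] at hj
    rcases le_or_gt j (2 ^ m) with h | h
    · exact (key j (Finset.mem_Icc.2 ⟨hj.1, h⟩)).1
    · have := (key (j - 2 ^ m) (Finset.mem_Icc.2 ⟨by omega, by omega⟩)).2
      rwa [Nat.sub_add_cancel h.le] at this

theorem G {k : ℕ} (hk : 1 ≤ k ∧ k ≤ 2048) : IsConstructible ((G k : ℝ) : ℂ) := by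
  have := F (m := 11) le_rfl (j := k) (Finset.mem_Icc.2 (by norm_num; exact hk))
  rwa [show 2 ^ 11 = 2048 by norm_num, F_level_top] at this

theorem half {k s : ℕ} (hk : k ∈ split12) (hs : s ∈ [1, 2]) :
    IsConstructible ((Gpart k s 2 : ℝ) : ℂ) := by
  have hsub : ∀ k ∈ split12, (1 ≤ k ∧ k ≤ 2048) ∧ ∀ l ∈ terms12 k, 1 ≤ l ∧ l ≤ 2048 := by
    decide +kernel
  have hG := G (hsub k hk).1
  have hq : IsConstructible ((prod12 Gon65537.G k : ℝ) : ℂ) := by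
    rw [prod12, sq]
    exact sub_real (sub_real (div_real (sub_real (mul_real hG hG) hG) (ofNat_real 2))
      (ofNat_real 16)) (list_sum_real fun l hl => G ((hsub k hk).2 l hl))
  have h := of_splitsBy hG hq (splitsBy_half hk)
  simp only [List.mem_cons, List.not_mem_nil, or_false] at hs
  rcases hs with rfl | rfl
  · exact h.1
  · exact h.2

theorem quarter {k : ℕ} (hk : k ∈ [1, 1025]) {s : ℕ} (hs : s ∈ [1, 2]) :
    IsConstructible ((Gpart k s 4 : ℝ) : ℂ) ∧ IsConstructible ((Gpart k (s + 2) 4 : ℝ) : ℂ) := by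
  have h1 : ∀ s ∈ [1, 2], ∀ k ∈ split12, IsConstructible ((Gpart k s 2 : ℝ) : ℂ) :=
    fun s hs k hk => half hk hs
  have hmem : ∀ k ∈ [1, 1025], k ∈ split12 := by decide
  have hq : IsConstructible ((prod13 (fun l t => Gpart l t 2) k s : ℝ) : ℂ) := by
    have key : ∀ {a b c d e : ℝ}, IsConstructible (a : ℂ) → IsConstructible (b : ℂ) →
        IsConstructible (c : ℂ) → IsConstructible (d : ℂ) → IsConstructible (e : ℂ) →
        IsConstructible (((a ^ 2 - b) / 2 - 8 - c - d - e : ℝ) : ℂ) := by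
      intro a b c d e ha hb hc hd he
      rw [sq]
      exact sub_real (sub_real (sub_real (sub_real (div_real (sub_real (mul_real ha ha) hb)
        (ofNat_real 2)) (ofNat_real 8)) hc) hd) he
    simp only [List.mem_cons, List.not_mem_nil, or_false] at hk hs
    have mem : 1 ∈ split12 ∧ 93 ∈ split12 ∧ 933 ∈ split12 ∧ 1025 ∈ split12 ∧ 1117 ∈ split12 ∧
        1957 ∈ split12 := by decide
    obtain ⟨m1, m2, m3, m4, m5, m6⟩ := mem
    have s1 : 1 ∈ [1, 2] := List.mem_cons_self
    have s2 : 2 ∈ [1, 2] := List.mem_cons_of_mem _ List.mem_cons_self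
    rcases hk with rfl | rfl <;> rcases hs with rfl | rfl
    · exact key (h1 _ s1 _ m1) (h1 _ s2 _ m1) (h1 _ s2 _ m4) (h1 _ s2 _ m5) (h1 _ s2 _ m6)
    · exact key (h1 _ s2 _ m1) (h1 _ s1 _ m1) (h1 _ s1 _ m4) (h1 _ s1 _ m5) (h1 _ s1 _ m6)
    · exact key (h1 _ s1 _ m4) (h1 _ s2 _ m4) (h1 _ s1 _ m1) (h1 _ s1 _ m2) (h1 _ s1 _ m3)
    · exact key (h1 _ s2 _ m4) (h1 _ s1 _ m4) (h1 _ s2 _ m1) (h1 _ s2 _ m2) (h1 _ s2 _ m3)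
  exact of_splitsBy (half (hmem k hk) hs) hq (splitsBy_quarter hk hs)

theorem eighth {s : ℕ} (hs : s ∈ [1, 2]) : IsConstructible ((Gpart 1 s 8 : ℝ) : ℂ) := by
  have a1 := quarter (k := 1) (by simp) (s := 1) (by simp)
  have a2 := quarter (k := 1) (by simp) (s := 2) (by simp)
  have a3 := quarter (k := 1025) (by simp) (s := 1) (by simp)
  have a4 := quarter (k := 1025) (by simp) (s := 2) (by simp)
  have hs' : s = 1 ∨ s = 2 := by simpa using hs
  rcases hs' with rfl | rfl
  · refine (of_add_mul a1.1 (?_ : IsConstructible ((prod14 (fun l t => Gpart l t 4) 1 : ℝ) : ℂ))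
      (splits_eighth hs).1 (splits_eighth hs).2.1).1
    simp only [prod14, sq]
    exact sub_real (sub_real (div_real (sub_real (mul_real a1.1 a1.1) a2.1) (ofNat_real 2))
      (ofNat_real 4)) a4.2
  · refine (of_add_mul a2.1 (?_ : IsConstructible ((prod14 (fun l t => Gpart l t 4) 2 : ℝ) : ℂ))
      (splits_eighth hs).1 (splits_eighth hs).2.1).1
    simp only [prod14, sq]
    exact sub_real (sub_real (div_real (sub_real (mul_real a2.1 a2.1) a1.2) (ofNat_real 2))
      (ofNat_real 4)) a3.1

theorem p_one : IsConstructible ((p 1 : ℝ) : ℂ) := by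
  have a1 := eighth (s := 1) (by simp)
  have a2 := eighth (s := 2) (by simp)
  have hq : IsConstructible ((prod15 (fun t => Gpart 1 t 8) : ℝ) : ℂ) := by
    simp only [prod15, sq]
    exact sub_real (div_real (sub_real (mul_real a1 a1) a2) (ofNat_real 2)) (ofNat_real 2)
  exact (of_add_mul a1 hq splits_pair.1 splits_pair.2.1).1

theorem vertex (k : ℕ) :
    IsConstructible (Complex.exp (2 * Real.pi * Complex.I * k / 65537)) := by
  set θ : ℝ := 2 * Real.pi / 65537 with hθ
  have hc : IsConstructible ((Real.cos θ : ℝ) : ℂ) := by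
    have h := div_real p_one (ofNat_real 2)
    have h2 : p 1 / 2 = Real.cos θ := by
      rw [p, hθ, Nat.cast_one, mul_one]; ring
    rwa [h2] at h
  have hsin : IsConstructible ((Real.sin θ : ℝ) : ℂ) := by
    have hθ1 : 0 ≤ θ := by positivity
    have hθ2 : θ ≤ Real.pi := by
      rw [hθ, div_le_iff₀ (by norm_num)]
      nlinarith [Real.pi_pos]
    rw [Real.sin_eq_sqrt_one_sub_cos_sq hθ1 hθ2, sq]
    exact sqrt_real (sub_real one_real (mul_real hc hc))
  have hk : ∀ k : ℕ, IsConstructible ((Real.cos (k * θ) : ℝ) : ℂ) ∧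
      IsConstructible ((Real.sin (k * θ) : ℝ) : ℂ) := by
    intro k
    induction k with
    | zero => simpa using ⟨one, zero⟩
    | succ k ih =>
      rw [Nat.cast_add, Nat.cast_one, add_mul, one_mul, Real.cos_add, Real.sin_add]
      exact ⟨sub_real (mul_real ih.1 hc) (mul_real ih.2 hsin),
        add_real (mul_real ih.2 hc) (mul_real ih.1 hsin)⟩
  have h := mk_real (hk k).1 (hk k).2
  rw [Complex.ofReal_cos, Complex.ofReal_sin, ← Complex.exp_mul_I] at h
  convert h using 2
  rw [hθ]
  push_cast
  ring

end IsConstructible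

end Gon65537

theorem mainTheorem1 :
    -- the pairs, the invariant sets and their sum `S = F(1, 1) = -1`
    (∀ k ∈ Finset.Icc 1 65536, ((p k : ℝ) : ℂ) = z ^ k + z ^ (65537 - k)) ∧
    (∀ k ∈ Finset.Icc 1 2048, (degSet k).card = 32 ∧ ((G k : ℝ) : ℂ) = ∑ d ∈ degSet k, z ^ d) ∧
    (∀ d ∈ Finset.Icc 1 65536, ∃! k : ℕ, k ∈ Finset.Icc 1 2048 ∧ d ∈ degSet k) ∧
    ((F 1 1 : ℝ) : ℂ) = ∑ k ∈ Finset.Icc (1 : ℕ) 65536, z ^ k ∧ F 1 1 = -1 ∧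
    (∀ j ∈ Finset.Icc 1 2048, F j 2048 = G j) ∧
    -- the two basic products of invariant sets
    G 1 ^ 2 = 32 + 3 * G 1 + 4 * G 2 + 2 * (G 3 + G 778 + G 801 + G 1025 + G 1100 + G 1117
      + G 1179 + G 1264 + G 1266 + G 1900 + G 1956 + G 1957) ∧
    G 1 * G 1025 = 2 * (G 1 + G 1025) + (G 24 + G 1048) + 2 * (G 155 + G 1179)
      + (G 185 + G 1209) + (G 309 + G 1333) + (G 360 + G 1384) + (G 531 + G 1555)
      + (G 667 + G 1691) + (G 719 + G 1743) + (G 734 + G 1758) + 2 * (G 778 + G 1802)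
      + (G 841 + G 1865) + (G 946 + G 1970) ∧
    -- the products `G_1 * G_q` as sums of invariant sets
    (∀ q ∈ Finset.Icc 2 2048,
      G 1 * G q = ∑ k ∈ Finset.Icc (1 : ℕ) 2048, (prodCount q k 2048 : ℝ) * G k) ∧
    -- the tables of the coefficients `μ(k, M)`
    (List.range 2).map (fun k => mu (k + 1) 2) = [4096, 4096] ∧
    (List.range 4).map (fun k => mu (k + 1) 4) = [992, 1040, 1024, 1040] ∧
    (List.range 8).map (fun k => mu (k + 1) 8) = [284, 237, 272, 237, 256, 269, 256, 237] ∧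
    (List.range 16).map (fun k => mu (k + 1) 16) =
      [80, 62, 60, 64, 57, 60, 61, 60, 68, 64, 64, 58, 65, 70, 61, 70] ∧
    (List.range 32).map (fun k => mu (k + 1) 32) = mu32 ∧
    (∀ k ∈ Finset.Icc 1 64, mu k 64 ≤ 10 ∧ ∀ m ∈ Finset.Icc 1 10, mu k 64 = m ↔ k ∈ K64 m) ∧
    (∀ k ∈ Finset.Icc 1 128, mu k 128 ≤ 5 ∧ ∀ m ∈ Finset.Icc 1 5, mu k 128 = m ↔ k ∈ K128 m) ∧
    (∀ k ∈ Finset.Icc 1 256, mu k 256 ≤ 3 ∧ ∀ m ∈ Finset.Icc 1 3, mu k 256 = m ↔ k ∈ K256 m) ∧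
    (∀ k ∈ Finset.Icc 1 512, mu k 512 ≤ 2 ∧ ∀ m ∈ Finset.Icc 1 2, mu k 512 = m ↔ k ∈ K512 m) ∧
    -- the product formulas with the coefficients `μ(k, 2 ^ m)`
    (∀ m ∈ Finset.Icc 1 9, ∀ j ∈ Finset.Icc 1 (2 ^ m),
      F j (2 ^ (m + 1)) * F (j + 2 ^ m) (2 ^ (m + 1)) =
        ∑ k ∈ Finset.Icc 1 (2 ^ m), (mu k (2 ^ m) : ℝ) * F (rho (k + j - 1) (2 ^ m)) (2 ^ m)) ∧
    -- sums and products of the two parts in the steps 1, ..., 11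
    (∀ m ∈ Finset.Icc 1 11, ∀ j ∈ Finset.Icc 1 (2 ^ (m - 1)),
      F j (2 ^ m) + F (j + 2 ^ (m - 1)) (2 ^ m) = F j (2 ^ (m - 1)) ∧
      F j (2 ^ m) * F (j + 2 ^ (m - 1)) (2 ^ m) =
        prodF m (fun k => F k (2 ^ (m - 1))) j) ∧
    -- steps 1, ..., 9: all splittings, with the information which part is larger
    (∀ m ∈ Finset.Icc 1 9, ∀ j ∈ Finset.Icc 1 (2 ^ (m - 1)),
      SplitsBy (j ∈ larger m) (F j (2 ^ (m - 1))) (prodF m (fun k => F k (2 ^ (m - 1))) j)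
        (F j (2 ^ m)) (F (j + 2 ^ (m - 1)) (2 ^ m))) ∧
    -- step 10: 181 splittings
    (∀ j ∈ split10, SplitsBy (j ∈ larger 10) (F j 512) (prodF 10 (fun k => F k 512) j)
      (F j 1024) (F (j + 512) 1024)) ∧
    -- step 11: 18 splittings
    (∀ j ∈ split11, SplitsBy (j ∈ larger 11) (F j 1024) (prodF 11 (fun k => F k 1024) j)
      (G j) (G (j + 1024))) ∧
    -- step 12: 6 splittings
    (∀ k ∈ split12, SplitsBy (k = 1) (G k) (prod12 G k) (Gpart k 1 2) (Gpart k 2 2)) ∧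
    -- step 13: 4 splittings
    (∀ k ∈ [1, 1025], ∀ s ∈ [1, 2], SplitsBy (¬ (k = 1025 ∧ s = 2)) (Gpart k s 2)
      (prod13 (fun l t => Gpart l t 2) k s) (Gpart k s 4) (Gpart k (s + 2) 4)) ∧
    -- step 14: 2 splittings
    (∀ s ∈ [1, 2], Splits (Gpart 1 s 4) (prod14 (fun l t => Gpart l t 4) s)
      (Gpart 1 s 8) (Gpart 1 (s + 4) 8)) ∧
    -- step 15: the last splitting
    Splits (Gpart 1 1 8) (prod15 (fun t => Gpart 1 t 8)) (p 1) (p 256) ∧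
    -- the parts of `G_1`, written out
    (G 1 = ∑ i ∈ Finset.range 16, p (2 ^ i) ∧
      Gpart 1 1 2 = p 1 + p 4 + p 16 + p 64 + p 256 + p 1024 + p 4096 + p 16384 ∧
      Gpart 1 2 2 = p 2 + p 8 + p 32 + p 128 + p 512 + p 2048 + p 8192 + p 32768 ∧
      Gpart 1 1 4 = p 1 + p 16 + p 256 + p 4096 ∧ Gpart 1 3 4 = p 4 + p 64 + p 1024 + p 16384 ∧
      Gpart 1 1 8 = p 1 + p 256 ∧ Gpart 1 5 8 = p 16 + p 4096) ∧
    -- the lists of indices are complete: every value used in a step is calculated in the previous one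
    (∀ k ∈ split12, rho k 1024 ∈ split11 ∧ ∀ l ∈ terms12 k, rho l 1024 ∈ split11) ∧
    (∀ i, i ∈ needed11 ↔
      i ∈ split11 ∨ ∃ j ∈ split11, ∃ t ∈ terms11, i = rho (t.2 + j - 1) 1024) ∧
    (∀ i, i ∈ split10 ↔ i ∈ Finset.Icc 1 512 ∧ (i ∈ needed11 ∨ i + 512 ∈ needed11)) ∧
    (∀ i, i ∈ both10 ↔ i ∈ Finset.Icc 1 512 ∧ i ∈ needed11 ∧ i + 512 ∈ needed11) ∧
    (split11.Nodup ∧ split11.length = 18) ∧ (needed11.Nodup ∧ needed11.length = 213) ∧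
    (split10.Nodup ∧ split10.length = 181) ∧ (both10.Nodup ∧ both10.length = 32) ∧
    -- the chain of the 15 steps calculates the values in question by successive square roots
    (∀ m ≤ 9, ∀ j ∈ Finset.Icc 1 (2 ^ m), radF m j = F j (2 ^ m)) ∧
    (∀ j ∈ needed11, radF10 j = F j 1024) ∧
    (∀ j ∈ split11, radG j = G j ∧ radG (j + 1024) = G (j + 1024)) ∧
    (∀ k ∈ split12, ∀ s ∈ [1, 2], radHalf k s = Gpart k s 2) ∧
    (∀ k ∈ [1, 1025], ∀ s ∈ [1, 2, 3, 4], radQuarter k s = Gpart k s 4) ∧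
    (∀ s ∈ [1, 2], radEighth s = Gpart 1 s 8) ∧
    2 * Real.cos (2 * Real.pi / 65537) = radP1 ∧
    -- the regular 65537-gon is constructible
    (∀ m ≤ 11, ∀ j ∈ Finset.Icc 1 (2 ^ m), IsConstructible ((F j (2 ^ m) : ℝ) : ℂ)) ∧
    IsConstructible ((p 1 : ℝ) : ℂ) ∧
    (∀ k : ℕ, IsConstructible (Complex.exp (2 * Real.pi * Complex.I * k / 65537))) := by
  have fit : ∀ {m : ℕ}, m ∈ Finset.Icc 1 11 → m - 1 ≤ 10 ∧ m - 1 + 1 = m := fun hm => by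
    rw [Finset.mem_Icc] at hm
    omega
  refine ⟨ofReal_p_eq, fun k _ => ⟨card_degSet k, ofReal_G_eq_sum k⟩,
    fun d hd => existsUnique_mem_degSet hd, F_one_eq_sum, F_one, fun j _ => F_level_top j,
    G_one_sq, G_one_mul_G_1025, fun q hq => G_one_mul_G hq,
    mu_table rfl fun k hk => ?_, mu_table rfl fun k hk => mu_four hk,
    mu_table rfl fun k hk => mu_eight hk, mu_table rfl fun k hk => mu_sixteen hk,
    mu_table rfl fun k hk => mu_thirtytwo hk,
    mu_64_table, mu_128_table, mu_256_table, mu_512_table, fun m hm j hj => ?_,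
    fun m hm j hj => ?_, fun m hm j hj => ?_, fun j hj => ?_, fun j hj => ?_,
    fun k hk => splitsBy_half hk, fun k hk s hs => splitsBy_quarter hk hs,
    fun s hs => splits_eighth hs, splits_pair, Gpart_one_eq, terms12_complete, mem_needed11_iff,
    mem_split10_iff, mem_both10_iff, ?_, ?_, ?_, ?_, fun m hm j hj => radF_eq hm hj,
    fun j hj => radF10_eq hj, fun j hj => radG_eq hj, fun k hk s hs => radHalf_eq hk hs,
    fun k hk s hs => radQuarter_eq hk hs, fun s hs => radEighth_eq hs, ?_,
    fun m hm j hj => IsConstructible.F hm hj, IsConstructible.p_one, IsConstructible.vertex⟩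
  · rw [mu_two hk]
    rw [Finset.mem_Icc] at hk
    obtain ⟨h1, h2⟩ := hk
    interval_cases k <;> rfl
  · rw [pow_succ']
    exact F_mul_F (pow_dvd_pow 2 (Finset.mem_Icc.1 hm).2) (Finset.mem_Icc.1 hj).1
  · have h := F_add_F_pow (fit hm).1 j
    rw [(fit hm).2] at h
    exact ⟨h, F_mul_F_eq_prodF hm hj⟩
  · rw [Finset.mem_Icc] at hm
    have hm' := fit (Finset.mem_Icc.2 ⟨hm.1, hm.2.trans (by norm_num)⟩)
    have h := splitsBy_F hm'.1 hj (Or.inl (Nat.sub_le_sub_right hm.2 1))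
    rwa [hm'.2] at h
  · exact splitsBy_F (m := 9) (by norm_num) ((mem_split10_iff j).1 hj).1 (Or.inr (Or.inl ⟨rfl, hj⟩))
  · have h := splitsBy_F (m := 10) (by norm_num) (split11_subset j hj) (Or.inr (Or.inr ⟨rfl, hj⟩))
    rw [show 2 ^ (10 + 1) = 2048 by norm_num, F_level_top, F_level_top] at h
    exact h
  · exact ⟨by decide +kernel, rfl⟩
  · exact ⟨by decide +kernel, rfl⟩
  · exact ⟨by decide +kernel, rfl⟩
  · exact ⟨by decide +kernel, rfl⟩
  · rw [radP1_eq, p, Nat.cast_one, mul_one]
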